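/- **Systems.** The finite types are $0$, $\sigma\to\tau$ and $\sigma^{*}$ (finite sequences of objects of type $\sigma$); $1=0\to0$ and $2=1\to0$. Equality at type $0$ is primitive; at higher types it is defined extensionally, and for sequences by equal length and equal entries. $\mathsf{E\text{-}PRA}^{\omega*}$ is classical many-sorted logic with the full axiom of extensionality, the usual axioms for zero and successor, the combinators $\Pi,\Sigma$, the recursor $R_0$ for recursion with values of type $0$, induction for quantifier-free formulas, and the defining axioms for finite sequences (empty sequence, prepending, length, projection, and forming $\langle f(0),\dots,f(n-1)\rangle$). $\mathsf{RCA}_0^{\omega}$ is $\mathsf{E\text{-}PRA}^{\omega*}$ plus $\mathsf{QF\text{-}AC}^{1,0}$: $\forall f^1\exists n^0A(f,n)\to\exists Y^2\forall f^1A(f,Y(f))$ for quantifier-free $A$. $\mathsf{RCA}_0^{\Lambda}$ is $\mathsf{RCA}_0^{\omega}$ in the language extended by a predicate $\mathrm{st}$ ("standard") at each type, plus the axioms $\mathrm{st}(x)\wedge x=y\to\mathrm{st}(y)$, $\mathrm{st}(t)$ for closed terms $t$, $\mathrm{st}(f)\wedge\mathrm{st}(x)\to\mathrm{st}(f(x))$,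 and, for formulas $\varphi$ without $\mathrm{st}$ (parameters allowed), $$\mathsf{HAC}_{\mathsf{int}}:\ (\forall^{\mathrm{st}}x^{\rho})(\exists^{\mathrm{st}}y^{\tau})\varphi(x,y)\to(\exists^{\mathrm{st}}F^{\rho\to\tau^{*}})(\forall^{\mathrm{st}}x^\rho)(\exists y^\tau\in F(x))\varphi(x,y),$$ $$\mathsf{I}:\ (\forall^{\mathrm{st}}x^{\sigma^{*}})(\exists y^{\tau})(\forall z^\sigma\in x)\varphi(z,y)\to(\exists y^\tau)(\forall^{\mathrm{st}}z^{\sigma})\varphi(z,y).$$ **Notions.** Every $x^1$ codes a real: it is read as the sequence of (codes of) rationals $[x](n)$ which is $x$ itself if $|x(n)-x(n+i)|<2^{-n}$ for all $n,i$, and which otherwise follows $x$ as long as this condition holds and is constant from then on. Write $x=_{\mathbb R}y$ if $|[x](n)-[y](n)|\le2^{-(n-1)}$ for all $n>0$; $x\approx y$ if this holds for all standard $n>0$; $x<_{\mathbb R}y$ if $[x](n)+2^{-(n-1)}<[y](n)$ for some $n>0$; and $x\in[0,1]$ if neither $x<_{\mathbb R}0$ nor $1<_{\mathbb R}x$. For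 $\alpha,\beta$ of type $1$, $\alpha\approx_1\beta$ means $\alpha(n)=\beta(n)$ for all standard $n$. For $\Phi^{1\to1}$ let - $\mathsf{UBIN}(\Phi,x)$: $\Phi(x)(i)\le1$ for all $i$, and $x=_{\mathbb R}\sum_{i=1}^{\infty}\Phi(x)(i)2^{-i}$; - $\mathsf{UBIN}(\Phi)$: $\mathsf{UBIN}(\Phi,x)$ for all $x\in[0,1]$; - $\mathsf{UBIN}^{+}$: $(\exists^{\mathrm{st}}\Phi^{1\to1})(\forall^{\mathrm{st}}x\in[0,1])\big[\mathsf{UBIN}(\Phi,x)\wedge(\forall^{\mathrm{st}}x,y\in[0,1])(x\approx y\to\Phi(x)\approx_1\Phi(y))\big]$; - $\Pi^0_1\text{-}\mathsf{TRANS}$: $(\forall^{\mathrm{st}}f^1)\big[(\forall^{\mathrm{st}}n)f(n)\ne0\to(\forall n)f(n)\ne0\big]$; - $\mathsf{MU}(\mu)$, for $\mu^2$: $(\forall f^1)\big[(\exists n)f(n)=0\to f(\mu(f))=0\big]$; - $\Xi^{1\to(1\to(0\to0))}$ is an extensionality functional for $\Phi$ if for all $f^1,g^1,k^0$: whenever $f$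 and $g$ agree below $\Xi(f,g,k)$, then $\Phi(f)$ and $\Phi(g)$ agree below $k$. **Theorem.** $\mathsf{RCA}_0^{\Lambda}$ proves $\mathsf{UBIN}^{+}\leftrightarrow\Pi^0_1\text{-}\mathsf{TRANS}$. Moreover there are closed terms $s$ and $t$ of the language of $\mathsf{RCA}_0^{\omega}$ (in particular, terms of Gödel's $T$), of types $2\to(1\to1)$ and $(1\to1)\to(1\to(1\to(0\to0)))\to2$, such that $\mathsf{RCA}_0^{\omega}$ proves $$(\forall\mu^2)\big[\mathsf{MU}(\mu)\to\mathsf{UBIN}(s(\mu))\wedge(\forall x^1,y^1)(x=_{\mathbb R}y\to s(\mu)(x)=_1s(\mu)(y))\big]$$ and $$(\forall\Phi^{1\to1})(\forall\Xi)\big[\mathsf{UBIN}(\Phi)\wedge\Xi\text{ is an extensionality functional for }\Phi\to\mathsf{MU}(t(\Phi,\Xi))\big].$$ -/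

import Mathlib

/- Finite types and terms. -/

namespace HigherRM

/-- The finite types: `0`, function types `σ → τ`, and the types `σ*` of finite sequences. -/
inductive Ty : Type
  | nat : Ty
  | arr : Ty → Ty → Ty
  | seq : Ty → Ty

infixr:60 " ⇒ " => Ty.arr

/-- Type `0`: natural numbers. -/
abbrev ty0 : Ty := Ty.nat
/-- Type `1 = 0 → 0`. -/
abbrev ty1 : Ty := ty0 ⇒ ty0
/-- Type `2 = 1 → 0`. -/
abbrev ty2 : Ty := ty1 ⇒ ty0

/-- A context: the types of the free variables that may occur. -/
abbrev Ctx : Type := List Ty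

/-- Typed de Bruijn variables. -/
inductive Var : Ctx → Ty → Type
  | z {Γ : Ctx} {σ : Ty} : Var (σ :: Γ) σ
  | s {Γ : Ctx} {σ τ : Ty} : Var Γ τ → Var (σ :: Γ) τ

/-- The constants: zero, successor, the combinators `Π` and `Σ`, the recursor `R₀` for recursion
with values of type `0` (with arguments: number of steps, base value, step function), and the
constants for finite sequences: empty sequence, prepending, length, projection, and
`tab f n = ⟨f 0, …, f (n - 1)⟩`. -/
inductive Const : Ty → Type
  | zero : Const ty0
  | succ : Const (ty0 ⇒ ty0)
  | K (σ τ : Ty) : Const (σ ⇒ τ ⇒ σ)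
  | S (ρ σ τ : Ty) : Const ((ρ ⇒ σ ⇒ τ) ⇒ (ρ ⇒ σ) ⇒ ρ ⇒ τ)
  | R : Const (ty0 ⇒ ty0 ⇒ (ty0 ⇒ ty0 ⇒ ty0) ⇒ ty0)
  | nil (σ : Ty) : Const (Ty.seq σ)
  | cons (σ : Ty) : Const (σ ⇒ Ty.seq σ ⇒ Ty.seq σ)
  | len (σ : Ty) : Const (Ty.seq σ ⇒ ty0)
  | proj (σ : Ty) : Const (Ty.seq σ ⇒ ty0 ⇒ σ)
  | tab (σ : Ty) : Const ((ty0 ⇒ σ) ⇒ ty0 ⇒ Ty.seq σ)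

/-- Terms with free variables in the context `Γ`. Closed terms are the terms in context `[]`. -/
inductive Tm (Γ : Ctx) : Ty → Type
  | var {σ : Ty} : Var Γ σ → Tm Γ σ
  | const {σ : Ty} : Const σ → Tm Γ σ
  | app {σ τ : Ty} : Tm Γ (σ ⇒ τ) → Tm Γ σ → Tm Γ τ

infixl:90 " ⬝ " => Tm.app

/-- Simultaneous substitution in terms. -/
def Tm.subst {Γ Δ : Ctx} (f : (σ : Ty) → Var Γ σ → Tm Δ σ) : {σ : Ty} → Tm Γ σ → Tm Δ σ
  | _, .var v => f _ v
  | _, .const c => .const c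
  | _, .app t u => .app (t.subst f) (u.subst f)

/-- Renaming of variables in terms. -/
def Tm.rename {Γ Δ : Ctx} (f : (σ : Ty) → Var Γ σ → Var Δ σ) {σ : Ty} (t : Tm Γ σ) : Tm Δ σ :=
  t.subst (fun σ v => .var (f σ v))

/-- Weakening by one new variable. -/
def Tm.wk {Γ : Ctx} {ρ σ : Ty} (t : Tm Γ σ) : Tm (ρ :: Γ) σ := t.rename (fun _ v => .s v)

/-- The empty renaming. -/
def emptyRen {Γ : Ctx} (σ : Ty) (v : Var [] σ) : Var Γ σ := nomatch v

/-- A closed term, seen in an arbitrary context. -/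
def Tm.closed {Γ : Ctx} {σ : Ty} (t : Tm [] σ) : Tm Γ σ := t.rename emptyRen

/-- Extension of a renaming to a context with one more variable. -/
def liftRen {Γ Δ : Ctx} (ρ : Ty) (f : (σ : Ty) → Var Γ σ → Var Δ σ) :
    (σ : Ty) → Var (ρ :: Γ) σ → Var (ρ :: Δ) σ
  | _, .z => .z
  | _, .s v => .s (f _ v)

/-- Extension of a substitution to a context with one more variable. -/
def liftSub {Γ Δ : Ctx} (ρ : Ty) (f : (σ : Ty) → Var Γ σ → Tm Δ σ) :
    (σ : Ty) → Var (ρ :: Γ) σ → Tm (ρ :: Δ) σ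
  | _, .z => .var .z
  | _, .s v => (f _ v).wk

/-- The substitution that replaces the last variable by `t`. -/
def instSub {Γ : Ctx} {ρ : Ty} (t : Tm Γ ρ) : (σ : Ty) → Var (ρ :: Γ) σ → Tm Γ σ
  | _, .z => t
  | _, .s v => .var v

/-- The substitution that replaces the last variable `n` by `n + 1`. -/
def succSub {Γ : Ctx} : (σ : Ty) → Var (ty0 :: Γ) σ → Tm (ty0 :: Γ) σ
  | _, .z => .const .succ ⬝ .var .z
  | _, .s v => .var (.s v)

/-- The most recently bound variable. -/
abbrev v0 {Γ : Ctx} {σ : Ty} : Tm (σ :: Γ) σ := .var .z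
/-- The variable bound before `v0`. -/
abbrev v1 {Γ : Ctx} {σ ρ : Ty} : Tm (ρ :: σ :: Γ) σ := .var (.s .z)
/-- The variable bound before `v1`. -/
abbrev v2 {Γ : Ctx} {σ ρ ρ' : Ty} : Tm (ρ :: ρ' :: σ :: Γ) σ := .var (.s (.s .z))

/-- Lambda abstraction, defined from the combinators by bracket abstraction. -/
def lam {Γ : Ctx} {ρ : Ty} : {σ : Ty} → Tm (ρ :: Γ) σ → Tm Γ (ρ ⇒ σ)
  | _, .var .z => .const (.S ρ (ρ ⇒ ρ) ρ) ⬝ .const (.K ρ (ρ ⇒ ρ)) ⬝ .const (.K ρ ρ)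
  | _, .var (.s v) => .const (.K _ ρ) ⬝ .var v
  | _, .const c => .const (.K _ ρ) ⬝ .const c
  | _, .app t u => .const (.S ρ _ _) ⬝ lam t ⬝ lam u

/-- The zero object `0_σ` of each type. -/
def zeroTm {Γ : Ctx} : (σ : Ty) → Tm Γ σ
  | .nat => .const .zero
  | .arr _ τ => .const (.K _ _) ⬝ zeroTm τ
  | .seq _ => .const (.nil _)

/- Elementary arithmetic, defined by recursion of type 0. -/

section Arithmetic
variable {Γ : Ctx}

def zero : Tm Γ ty0 := .const .zero
def succ (n : Tm Γ ty0) : Tm Γ ty0 := .const .succ ⬝ n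
def one : Tm Γ ty0 := succ zero

/-- Recursion: value `a` at `0`; in `step`, the variable `v1` is the value at stage `v0`, and `step`
gives the value at stage `v0 + 1`. -/
def recTm (n a : Tm Γ ty0) (step : Tm (ty0 :: ty0 :: Γ) ty0) : Tm Γ ty0 :=
  .const .R ⬝ n ⬝ a ⬝ lam (lam step)

def add (a b : Tm Γ ty0) : Tm Γ ty0 := recTm b a (succ v1)
def mul (a b : Tm Γ ty0) : Tm Γ ty0 := recTm b zero (add v1 a.wk.wk)
/-- Predecessor, with `pred 0 = 0`. -/
def pred (a : Tm Γ ty0) : Tm Γ ty0 := recTm a zero v0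
/-- Truncated subtraction. -/
def sub (a b : Tm Γ ty0) : Tm Γ ty0 := recTm b a (pred v1)
/-- `2 ^ a`. -/
def pow2 (a : Tm Γ ty0) : Tm Γ ty0 := recTm a one (add v1 v1)
/-- `|a - b|`. -/
def absDiff (a b : Tm Γ ty0) : Tm Γ ty0 := add (sub a b) (sub b a)
/-- `a` if `c = 0`, and `b` otherwise. -/
def ifZero (c a b : Tm Γ ty0) : Tm Γ ty0 := recTm c a b.wk.wk
/-- `a mod 2`. -/
def parity (a : Tm Γ ty0) : Tm Γ ty0 := recTm a zero (sub one v1)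
/-- `a / 2`, rounded down. -/
def half (a : Tm Γ ty0) : Tm Γ ty0 := recTm a zero (add v1 (parity v0))
/-- `0 + 1 + ⋯ + a`. -/
def tri (a : Tm Γ ty0) : Tm Γ ty0 := recTm a zero (add v1 (succ v0))
/-- The Cantor pairing function. -/
def pair (a b : Tm Γ ty0) : Tm Γ ty0 := add (tri (add a b)) b
/-- The greatest `w` with `tri w ≤ c`. -/
def diag (c : Tm Γ ty0) : Tm Γ ty0 :=
  recTm c zero (ifZero (absDiff (tri (succ v1)) (succ v0)) (succ v1) v1)
/-- The projections of the Cantor pairing function. -/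
def snd (c : Tm Γ ty0) : Tm Γ ty0 := sub c (tri (diag c))
def fst (c : Tm Γ ty0) : Tm Γ ty0 := sub (diag c) (snd c)

/- Rational numbers: the code `pair n m` stands for `(n/2)/(m+1)` if `n` is even, and for
`-((n+1)/2)/(m+1)` if `n` is odd. -/

/-- Numerator of the positive part of the rational coded by `q`. -/
def posNum (q : Tm Γ ty0) : Tm Γ ty0 := mul (sub one (parity (fst q))) (half (fst q))
/-- Numerator of the negative part of the rational coded by `q`. -/
def negNum (q : Tm Γ ty0) : Tm Γ ty0 := mul (parity (fst q)) (half (succ (fst q)))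
/-- Denominator of the rational coded by `q`. -/
def den (q : Tm Γ ty0) : Tm Γ ty0 := succ (snd q)
def cross (q r : Tm Γ ty0) : Tm Γ ty0 := add (mul (posNum q) (den r)) (mul (negNum r) (den q))
/-- The product of the denominators. -/
def dens (q r : Tm Γ ty0) : Tm Γ ty0 := mul (den q) (den r)
/-- `max 0 (q - r)`, multiplied by `dens q r`. -/
def excess (q r : Tm Γ ty0) : Tm Γ ty0 := sub (cross q r) (cross r q)
/-- `|q - r|`, multiplied by `dens q r`. -/
def gap (q r : Tm Γ ty0) : Tm Γ ty0 := add (excess q r) (excess r q)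
def ratZero : Tm Γ ty0 := pair zero zero
def ratOne : Tm Γ ty0 := pair (succ one) zero

/- Real numbers: every `x` of type 1 stands for the fast converging Cauchy sequence `hat x`. -/

/-- This is zero exactly if `|x j - x (k+1)| < 1 / 2 ^ j` for all `j ≤ k`. -/
def slow (x : Tm Γ ty1) (k : Tm Γ ty0) : Tm Γ ty0 :=
  recTm (succ k) zero (add v1
    (sub (succ (mul (gap (x.wk.wk ⬝ v0) (x.wk.wk ⬝ succ k.wk.wk)) (pow2 v0)))
      (dens (x.wk.wk ⬝ v0) (x.wk.wk ⬝ succ k.wk.wk))))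

/-- The greatest `m ≤ n` such that `|x j - x k| < 1 / 2 ^ j` for all `j < k ≤ m`. -/
def hatIndex (x : Tm Γ ty1) (n : Tm Γ ty0) : Tm Γ ty0 :=
  recTm n zero (ifZero (add (absDiff v1 v0) (slow x.wk.wk v0)) (succ v0) v1)

/-- The sequence `x` itself if it is a fast converging Cauchy sequence, that is, if
`|x n - x (n+i)| < 1 / 2 ^ n` for all `n` and `i`; otherwise the sequence that follows `x` as long as
this holds and is constant from there on. -/
def hat (x : Tm Γ ty1) : Tm Γ ty1 := lam (x.wk ⬝ hatIndex x.wk v0)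

def realZero : Tm Γ ty1 := lam ratZero
def realOne : Tm Γ ty1 := lam ratOne

/-- `2 ^ n * ∑_{i=1}^{n} a(i) / 2 ^ i`. -/
def binNum (a : Tm Γ ty1) (n : Tm Γ ty0) : Tm Γ ty0 :=
  recTm n zero (add (add v1 v1) (a.wk.wk ⬝ succ v0))

/-- The sequence of the partial sums `∑_{i=1}^{n} a(i) / 2 ^ i`, that is, the real
`∑_{i=1}^{∞} a(i) / 2 ^ i` if `a ≤ 1`. -/
def binSum (a : Tm Γ ty1) : Tm Γ ty1 :=
  lam (pair (add (binNum a.wk v0) (binNum a.wk v0)) (pred (pow2 v0)))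

end Arithmetic

/- Formulas. -/

/-- Formulas with free variables in `Γ`. The only prime formulas are equations of type `0` and, if
`b = true`, `st t`. So `Fm false Γ` are the internal formulas, and `Fm true Γ` the formulas of the
language with `st`. -/
inductive Fm (b : Bool) : Ctx → Type
  | eq {Γ : Ctx} : Tm Γ ty0 → Tm Γ ty0 → Fm b Γ
  | st {Γ : Ctx} {σ : Ty} (h : b = true) : Tm Γ σ → Fm b Γ
  | bot {Γ : Ctx} : Fm b Γ
  | imp {Γ : Ctx} : Fm b Γ → Fm b Γ → Fm b Γ
  | and {Γ : Ctx} : Fm b Γ → Fm b Γ → Fm b Γ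
  | or {Γ : Ctx} : Fm b Γ → Fm b Γ → Fm b Γ
  | all {Γ : Ctx} (σ : Ty) : Fm b (σ :: Γ) → Fm b Γ
  | ex {Γ : Ctx} (σ : Ty) : Fm b (σ :: Γ) → Fm b Γ

infixr:30 " ⟹ " => Fm.imp
infixr:35 " ⋏ " => Fm.and

namespace Fm

/-- Capture-free simultaneous substitution in formulas. -/
def subst {b : Bool} : {Γ Δ : Ctx} → ((σ : Ty) → Var Γ σ → Tm Δ σ) → Fm b Γ → Fm b Δ
  | _, _, f, .eq t u => .eq (t.subst f) (u.subst f)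
  | _, _, f, .st h t => .st h (t.subst f)
  | _, _, _, .bot => .bot
  | _, _, f, .imp A B => .imp (A.subst f) (B.subst f)
  | _, _, f, .and A B => .and (A.subst f) (B.subst f)
  | _, _, f, .or A B => .or (A.subst f) (B.subst f)
  | _, _, f, .all σ A => .all σ (A.subst (liftSub σ f))
  | _, _, f, .ex σ A => .ex σ (A.subst (liftSub σ f))

/-- Renaming of free variables. -/
def rename {b : Bool} {Γ Δ : Ctx} (f : (σ : Ty) → Var Γ σ → Var Δ σ) (A : Fm b Γ) : Fm b Δ :=
  A.subst (fun σ v => .var (f σ v))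

/-- Weakening by one new variable. -/
def wk {b : Bool} {Γ : Ctx} {ρ : Ty} (A : Fm b Γ) : Fm b (ρ :: Γ) := A.rename (fun _ v => .s v)

/-- Substitution of `t` for the last variable. -/
def inst {b : Bool} {Γ : Ctx} {ρ : Ty} (A : Fm b (ρ :: Γ)) (t : Tm Γ ρ) : Fm b Γ :=
  A.subst (instSub t)

/-- An internal formula, seen as a formula of either language. -/
def ofInt {b : Bool} : {Γ : Ctx} → Fm false Γ → Fm b Γ
  | _, .eq t u => .eq t u
  | _, .st h _ => nomatch h
  | _, .bot => .bot
  | _, .imp A B => .imp A.ofInt B.ofInt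
  | _, .and A B => .and A.ofInt B.ofInt
  | _, .or A B => .or A.ofInt B.ofInt
  | _, .all σ A => .all σ A.ofInt
  | _, .ex σ A => .ex σ A.ofInt

/-- Quantifier-free internal formulas. -/
def IsQF {b : Bool} : {Γ : Ctx} → Fm b Γ → Prop
  | _, .eq _ _ => True
  | _, .st _ _ => False
  | _, .bot => True
  | _, .imp A B => A.IsQF ∧ B.IsQF
  | _, .and A B => A.IsQF ∧ B.IsQF
  | _, .or A B => A.IsQF ∧ B.IsQF
  | _, .all _ _ => False
  | _, .ex _ _ => False

def neg {b : Bool} {Γ : Ctx} (A : Fm b Γ) : Fm b Γ := A ⟹ .bot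

def iff {b : Bool} {Γ : Ctx} (A B : Fm b Γ) : Fm b Γ := (A ⟹ B) ⋏ (B ⟹ A)

/-- `∀^st x^σ A`. -/
def allSt {Γ : Ctx} (σ : Ty) (A : Fm true (σ :: Γ)) : Fm true Γ := .all σ (.st rfl v0 ⟹ A)

/-- `∃^st x^σ A`. -/
def exSt {Γ : Ctx} (σ : Ty) (A : Fm true (σ :: Γ)) : Fm true Γ := .ex σ (.st rfl v0 ⋏ A)

/-- `a ≤ b` for numbers. -/
def le {b : Bool} {Γ : Ctx} (s t : Tm Γ ty0) : Fm b Γ := .eq (sub s t) zero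

/-- `a < b` for numbers. -/
def lt {b : Bool} {Γ : Ctx} (s t : Tm Γ ty0) : Fm b Γ := le (succ s) t

/-- Equality `s =_σ t` at each type: extensional at function types; for finite sequences, same length
and same entries. -/
def eqT {b : Bool} : {Γ : Ctx} → (σ : Ty) → Tm Γ σ → Tm Γ σ → Fm b Γ
  | _, .nat, s, t => .eq s t
  | _, .arr ρ τ, s, t => .all ρ (eqT τ (s.wk ⬝ v0) (t.wk ⬝ v0))
  | _, .seq ρ, s, t =>
      .eq (.const (.len ρ) ⬝ s) (.const (.len ρ) ⬝ t) ⋏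
        .all ty0 (lt v0 (.const (.len ρ) ⬝ s.wk) ⟹
          eqT ρ (.const (.proj ρ) ⬝ s.wk ⬝ v0) (.const (.proj ρ) ⬝ t.wk ⬝ v0))

/-- `y ∈ s` for a finite sequence `s`: `y` is one of the entries of `s`. -/
def mem {b : Bool} {Γ : Ctx} {σ : Ty} (y : Tm Γ σ) (s : Tm Γ (.seq σ)) : Fm b Γ :=
  .ex ty0 (lt v0 (.const (.len σ) ⬝ s.wk) ⋏ eqT σ y.wk (.const (.proj σ) ⬝ s.wk ⬝ v0))

end Fm

/- Derivations and theories. -/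

/-- Derivability in classical many-sorted predicate logic (natural deduction) from the axioms `Ax`
and the hypotheses in the list; the free variables are those of the context. -/
inductive Prf {b : Bool} (Ax : (Γ : Ctx) → Fm b Γ → Prop) :
    (Γ : Ctx) → List (Fm b Γ) → Fm b Γ → Prop
  | ax {Γ : Ctx} {H : List (Fm b Γ)} {A : Fm b Γ} : Ax Γ A → Prf Ax Γ H A
  | hyp {Γ : Ctx} {H : List (Fm b Γ)} {A : Fm b Γ} : A ∈ H → Prf Ax Γ H A
  | impI {Γ : Ctx} {H : List (Fm b Γ)} {A B : Fm b Γ} : Prf Ax Γ (A :: H) B → Prf Ax Γ H (A ⟹ B)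
  | impE {Γ : Ctx} {H : List (Fm b Γ)} {A B : Fm b Γ} :
      Prf Ax Γ H (A ⟹ B) → Prf Ax Γ H A → Prf Ax Γ H B
  | andI {Γ : Ctx} {H : List (Fm b Γ)} {A B : Fm b Γ} :
      Prf Ax Γ H A → Prf Ax Γ H B → Prf Ax Γ H (A ⋏ B)
  | andL {Γ : Ctx} {H : List (Fm b Γ)} {A B : Fm b Γ} : Prf Ax Γ H (A ⋏ B) → Prf Ax Γ H A
  | andR {Γ : Ctx} {H : List (Fm b Γ)} {A B : Fm b Γ} : Prf Ax Γ H (A ⋏ B) → Prf Ax Γ H B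
  | orL {Γ : Ctx} {H : List (Fm b Γ)} {A B : Fm b Γ} : Prf Ax Γ H A → Prf Ax Γ H (.or A B)
  | orR {Γ : Ctx} {H : List (Fm b Γ)} {A B : Fm b Γ} : Prf Ax Γ H B → Prf Ax Γ H (.or A B)
  | orE {Γ : Ctx} {H : List (Fm b Γ)} {A B C : Fm b Γ} : Prf Ax Γ H (.or A B) →
      Prf Ax Γ (A :: H) C → Prf Ax Γ (B :: H) C → Prf Ax Γ H C
  | raa {Γ : Ctx} {H : List (Fm b Γ)} {A : Fm b Γ} : Prf Ax Γ (A.neg :: H) .bot → Prf Ax Γ H A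
  | allI {Γ : Ctx} {H : List (Fm b Γ)} {σ : Ty} {A : Fm b (σ :: Γ)} :
      Prf Ax (σ :: Γ) (H.map Fm.wk) A → Prf Ax Γ H (.all σ A)
  | allE {Γ : Ctx} {H : List (Fm b Γ)} {σ : Ty} {A : Fm b (σ :: Γ)} (t : Tm Γ σ) :
      Prf Ax Γ H (.all σ A) → Prf Ax Γ H (A.inst t)
  | exI {Γ : Ctx} {H : List (Fm b Γ)} {σ : Ty} {A : Fm b (σ :: Γ)} (t : Tm Γ σ) :
      Prf Ax Γ H (A.inst t) → Prf Ax Γ H (.ex σ A)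
  | exE {Γ : Ctx} {H : List (Fm b Γ)} {σ : Ty} {A : Fm b (σ :: Γ)} {C : Fm b Γ} :
      Prf Ax Γ H (.ex σ A) → Prf Ax (σ :: Γ) (A :: H.map Fm.wk) C.wk → Prf Ax Γ H C

/-- The sentence `A` is provable from the axioms `Ax`. -/
def Provable {b : Bool} (Ax : (Γ : Ctx) → Fm b Γ → Prop) (A : Fm b []) : Prop := Prf Ax [] [] A

/-- The axioms of `E-PRA^{ω*}`: primitive recursive arithmetic in all finite types with full
extensionality, recursion of type `0` and quantifier-free induction, extended by finite sequences. -/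
inductive EPRA (b : Bool) : (Γ : Ctx) → Fm b Γ → Prop
  | refl {Γ : Ctx} (s : Tm Γ ty0) : EPRA b Γ (.eq s s)
  | eucl {Γ : Ctx} (s t u : Tm Γ ty0) : EPRA b Γ (.eq s t ⟹ .eq s u ⟹ .eq t u)
  | ext {Γ : Ctx} {ρ τ : Ty} (s t : Tm Γ ρ) (f : Tm Γ (ρ ⇒ τ)) :
      EPRA b Γ (Fm.eqT ρ s t ⟹ Fm.eqT τ (f ⬝ s) (f ⬝ t))
  | succ_ne {Γ : Ctx} (s : Tm Γ ty0) : EPRA b Γ (Fm.neg (.eq (succ s) zero))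
  | succ_inj {Γ : Ctx} (s t : Tm Γ ty0) : EPRA b Γ (.eq (succ s) (succ t) ⟹ .eq s t)
  | combK {Γ : Ctx} {σ τ : Ty} (s : Tm Γ σ) (t : Tm Γ τ) :
      EPRA b Γ (Fm.eqT σ (.const (.K σ τ) ⬝ s ⬝ t) s)
  | combS {Γ : Ctx} {ρ σ τ : Ty} (s : Tm Γ (ρ ⇒ σ ⇒ τ)) (t : Tm Γ (ρ ⇒ σ)) (u : Tm Γ ρ) :
      EPRA b Γ (Fm.eqT τ (.const (.S ρ σ τ) ⬝ s ⬝ t ⬝ u) (s ⬝ u ⬝ (t ⬝ u)))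
  | rec_zero {Γ : Ctx} (a : Tm Γ ty0) (f : Tm Γ (ty0 ⇒ ty0 ⇒ ty0)) :
      EPRA b Γ (.eq (.const .R ⬝ zero ⬝ a ⬝ f) a)
  | rec_succ {Γ : Ctx} (n a : Tm Γ ty0) (f : Tm Γ (ty0 ⇒ ty0 ⇒ ty0)) :
      EPRA b Γ (.eq (.const .R ⬝ succ n ⬝ a ⬝ f) (f ⬝ (.const .R ⬝ n ⬝ a ⬝ f) ⬝ n))
  | qf_ind {Γ : Ctx} (A : Fm b (ty0 :: Γ)) : A.IsQF →
      EPRA b Γ (A.inst zero ⟹ .all ty0 (A ⟹ A.subst succSub) ⟹ .all ty0 A)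
  | len_nil {Γ : Ctx} (σ : Ty) : EPRA b Γ (.eq (.const (.len σ) ⬝ .const (.nil σ)) zero)
  | len_cons {Γ : Ctx} {σ : Ty} (a : Tm Γ σ) (s : Tm Γ (.seq σ)) :
      EPRA b Γ (.eq (.const (.len σ) ⬝ (.const (.cons σ) ⬝ a ⬝ s)) (succ (.const (.len σ) ⬝ s)))
  | cons_zero {Γ : Ctx} {σ : Ty} (a : Tm Γ σ) (s : Tm Γ (.seq σ)) :
      EPRA b Γ (Fm.eqT σ (.const (.proj σ) ⬝ (.const (.cons σ) ⬝ a ⬝ s) ⬝ zero) a)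
  | cons_succ {Γ : Ctx} {σ : Ty} (a : Tm Γ σ) (s : Tm Γ (.seq σ)) (i : Tm Γ ty0) :
      EPRA b Γ (Fm.eqT σ (.const (.proj σ) ⬝ (.const (.cons σ) ⬝ a ⬝ s) ⬝ succ i)
        (.const (.proj σ) ⬝ s ⬝ i))
  | len_tab {Γ : Ctx} {σ : Ty} (f : Tm Γ (ty0 ⇒ σ)) (n : Tm Γ ty0) :
      EPRA b Γ (.eq (.const (.len σ) ⬝ (.const (.tab σ) ⬝ f ⬝ n)) n)
  | proj_tab {Γ : Ctx} {σ : Ty} (f : Tm Γ (ty0 ⇒ σ)) (n i : Tm Γ ty0) :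
      EPRA b Γ (Fm.lt i n ⟹
        Fm.eqT σ (.const (.proj σ) ⬝ (.const (.tab σ) ⬝ f ⬝ n) ⬝ i) (f ⬝ i))
  | proj_default {Γ : Ctx} {σ : Ty} (s : Tm Γ (.seq σ)) (i : Tm Γ ty0) :
      EPRA b Γ (Fm.le (.const (.len σ) ⬝ s) i ⟹
        Fm.eqT σ (.const (.proj σ) ⬝ s ⬝ i) (zeroTm σ))

/-- The axioms of `RCA₀^ω`: `E-PRA^{ω*}` with `QF-AC^{1,0}`, that is,
`∀ f^1 ∃ n^0 A(f, n) → ∃ Y^2 ∀ f^1 A(f, Y f)` for quantifier-free `A`. -/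
inductive RCAω (b : Bool) : (Γ : Ctx) → Fm b Γ → Prop
  | base {Γ : Ctx} {A : Fm b Γ} : EPRA b Γ A → RCAω b Γ A
  | qf_ac {Γ : Ctx} (A : Fm b (ty0 :: ty1 :: Γ)) : A.IsQF →
      RCAω b Γ (.all ty1 (.ex ty0 A) ⟹
        .ex ty2 (.all ty1
          ((A.rename (liftRen ty0 (liftRen ty1 (fun _ v => .s v)))).inst (v1 ⬝ v0))))

/-- The axioms of `RCA₀^Λ`: `RCA₀^ω`, the basic axioms for `st`, the Herbrandized axiom of choice
`HAC_int`, and idealisation `I`. -/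
inductive RCAΛ : (Γ : Ctx) → Fm true Γ → Prop
  | base {Γ : Ctx} {A : Fm true Γ} : RCAω true Γ A → RCAΛ Γ A
  | st_eq {Γ : Ctx} {σ : Ty} (s t : Tm Γ σ) : RCAΛ Γ (.st rfl s ⟹ Fm.eqT σ s t ⟹ .st rfl t)
  | st_closed {Γ : Ctx} {σ : Ty} (t : Tm [] σ) : RCAΛ Γ (.st rfl (t.closed : Tm Γ σ))
  | st_app {Γ : Ctx} {σ τ : Ty} (f : Tm Γ (σ ⇒ τ)) (s : Tm Γ σ) :
      RCAΛ Γ (.st rfl f ⟹ .st rfl s ⟹ .st rfl (f ⬝ s))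
  /-- `∀^st x^ρ ∃^st y^τ A(x, y) → ∃^st F^{ρ → τ*} ∀^st x^ρ ∃ y^τ ∈ F(x) A(x, y)`, `A` internal. -/
  | hac {Γ : Ctx} (ρ τ : Ty) (A : Fm false (τ :: ρ :: Γ)) :
      RCAΛ Γ (Fm.allSt ρ (Fm.exSt τ A.ofInt) ⟹
        Fm.exSt (ρ ⇒ .seq τ) (Fm.allSt ρ (.ex τ (Fm.mem v0 (v2 ⬝ v1) ⋏
          (A.rename (liftRen τ (liftRen ρ (fun _ v => .s v)))).ofInt))))
  /-- `∀^st x^{σ*} ∃ y^τ ∀ z^σ ∈ x A(z, y) → ∃ y^τ ∀^st z^σ A(z, y)`, `A` internal. -/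
  | ideal {Γ : Ctx} (σ τ : Ty) (A : Fm false (σ :: τ :: Γ)) :
      RCAΛ Γ (Fm.allSt (.seq σ) (.ex τ (.all σ (Fm.mem v0 v2 ⟹
          (A.rename (liftRen σ (liftRen τ (fun _ v => .s v)))).ofInt))) ⟹
        .ex τ (Fm.allSt σ A.ofInt))

/- The principles. -/

section Principles
variable {b : Bool} {Γ : Ctx}

/-- `x =_ℝ y`: `|[x](n) - [y](n)| ≤ 1 / 2 ^ (n-1)` for all `n > 0`. -/
def realEq (x y : Tm Γ ty1) : Fm b Γ :=
  .all ty0 (Fm.lt zero v0 ⟹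
    Fm.le (mul (gap ((hat x).wk ⬝ v0) ((hat y).wk ⬝ v0)) (pow2 (pred v0)))
      (dens ((hat x).wk ⬝ v0) ((hat y).wk ⬝ v0)))

/-- `x ≈ y`: the same, for all standard `n > 0`. -/
def approx (x y : Tm Γ ty1) : Fm true Γ :=
  Fm.allSt ty0 (Fm.lt zero v0 ⟹
    Fm.le (mul (gap ((hat x).wk ⬝ v0) ((hat y).wk ⬝ v0)) (pow2 (pred v0)))
      (dens ((hat x).wk ⬝ v0) ((hat y).wk ⬝ v0)))

/-- `x <_ℝ y`: `[x](n) + 1 / 2 ^ (n-1) < [y](n)` for some `n > 0`. -/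
def realLt (x y : Tm Γ ty1) : Fm b Γ :=
  .ex ty0 (Fm.lt zero v0 ⋏
    Fm.lt (dens ((hat y).wk ⬝ v0) ((hat x).wk ⬝ v0))
      (mul (excess ((hat y).wk ⬝ v0) ((hat x).wk ⬝ v0)) (pow2 (pred v0))))

/-- `x ∈ [0,1]`. -/
def inUnit (x : Tm Γ ty1) : Fm b Γ := (realLt x realZero).neg ⋏ (realLt realOne x).neg

/-- `UBIN(Φ, x)`: `Φ(x) ≤₁ 1` and `x =_ℝ ∑_{i=1}^{∞} Φ(x)(i) / 2 ^ i`. -/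
def UBINat (Φ : Tm Γ (ty1 ⇒ ty1)) (x : Tm Γ ty1) : Fm b Γ :=
  .all ty0 (Fm.le ((Φ ⬝ x).wk ⬝ v0) one) ⋏ realEq x (binSum (Φ ⬝ x))

/-- `UBIN(Φ)`: `UBIN(Φ, x)` for all `x ∈ [0,1]`. -/
def UBIN (Φ : Tm Γ (ty1 ⇒ ty1)) : Fm b Γ := .all ty1 (inUnit v0 ⟹ UBINat Φ.wk v0)

/-- `Φ` maps equal reals to equal elements of Baire space. -/
def realExt (Φ : Tm Γ (ty1 ⇒ ty1)) : Fm b Γ :=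
  .all ty1 (.all ty1 (realEq v1 v0 ⟹ Fm.eqT ty1 (Φ.wk.wk ⬝ v1) (Φ.wk.wk ⬝ v0)))

/-- `MU(μ)`: `∀ f^1 (∃ n f(n) = 0 → f(μ(f)) = 0)`. -/
def MU (μ : Tm Γ ty2) : Fm b Γ :=
  .all ty1 (.ex ty0 (.eq (v1 ⬝ v0) zero) ⟹ .eq (v0 ⬝ (μ.wk ⬝ v0)) zero)

/-- The initial segments of `f` and `g` of length `n` are equal. -/
def initEq (f g : Tm Γ ty1) (n : Tm Γ ty0) : Fm b Γ :=
  .all ty0 (Fm.lt v0 n.wk ⟹ .eq (f.wk ⬝ v0) (g.wk ⬝ v0))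

/-- `Ξ` is an extensionality functional for `Φ`: for all `f`, `g`, `k`, if `f` and `g` agree below
`Ξ(f, g, k)`, then `Φ(f)` and `Φ(g)` agree below `k`. -/
def ExtFunctional (Ξ : Tm Γ (ty1 ⇒ ty1 ⇒ ty0 ⇒ ty0)) (Φ : Tm Γ (ty1 ⇒ ty1)) : Fm b Γ :=
  .all ty1 (.all ty1 (.all ty0
    (initEq v2 v1 (Ξ.wk.wk.wk ⬝ v2 ⬝ v1 ⬝ v0) ⟹
      initEq (Φ.wk.wk.wk ⬝ v2) (Φ.wk.wk.wk ⬝ v1) v0)))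

/-- `x ≈₁ y` for elements of Baire space: `x(n) = y(n)` for all standard `n`. -/
def approxOne (x y : Tm Γ ty1) : Fm true Γ := Fm.allSt ty0 (.eq (x.wk ⬝ v0) (y.wk ⬝ v0))

/-- `UBIN⁺`:
`∃^st Φ ∀^st x ∈ [0,1] [UBIN(Φ, x) ∧ ∀^st x, y ∈ [0,1] (x ≈ y → Φ(x) ≈₁ Φ(y))]`. -/
def UBINplus : Fm true Γ :=
  Fm.exSt (ty1 ⇒ ty1) (Fm.allSt ty1 (inUnit v0 ⟹ (UBINat v1 v0 ⋏
    Fm.allSt ty1 (inUnit v0 ⟹ Fm.allSt ty1 (inUnit v0 ⟹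
      (approx v1 v0 ⟹ approxOne (.var (.s (.s (.s .z))) ⬝ v1) (.var (.s (.s (.s .z))) ⬝ v0)))))))

/-- `Π⁰₁-TRANS`: `∀^st f^1 [∀^st n f(n) ≠ 0 → ∀ n f(n) ≠ 0]`. -/
def PiTRANS : Fm true Γ :=
  Fm.allSt ty1 (Fm.allSt ty0 (Fm.neg (.eq (v1 ⬝ v0) zero)) ⟹
    .all ty0 (Fm.neg (.eq (v1 ⬝ v0) zero)))

end Principles

end HigherRM

/-!
A sentence is derivable as soon as it is true in all models of the axioms (`completeness`). So it
suffices to argue informally in an arbitrary model `M` of the axioms in which the defined equality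
at each type is identity of objects, and no derivation has to be written down.

Completeness is shown with a generic ideal of finite consistent sets of hypotheses, which decides
each formula and has a witness for each existential formula that it proves. The language is
countable, so such an ideal exists by the Rasiowa–Sikorski lemma, and the terms modulo provable
equality form a model in which precisely the formulas of the ideal are true.

In `M` the numbers need not be the natural numbers, but by quantifier-free induction they are the
nonnegative part of a discretely ordered ring. Its ordered field of fractions (`Model.Q`) contains
the values of the codes of rationals, and the estimates for fast converging sequences can be done
there as usual. Only the primitive recursive part of the theories is used for this.

* From a search functional `μ` to binary expansions (`isBinary_expansion`, `expansion_congr`): `μ`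
  decides whether a real is below a given rational, since this is a `Σ⁰₁` property. The `n`-th digit
  is found by comparing the real with a dyadic rational. These decisions depend only on the value of
  the real, and so does the expansion.
* From binary expansions to a search functional (`search_spec`): `1 / 2` has exactly two expansions,
  and `d = Φ(1 / 2)(1)` tells which one `Φ` chooses. For given `f`, let `y` be `1 / 2` if `f` has no
  zero, and otherwise `1 / 2` shifted slightly, by an amount that depends on the least zero of `f`,
  to the side where the first digit is not `d`. If `f` has a zero, then `Φ(1 / 2)` and `Φ(y)` differ
  in the first digit, so the codes of the two reals differ below a number provided by the
  extensionality functional. They agree up to the least zero of `f`, so bounded search finds it.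
* From `UBIN⁺` to `Π⁰₁-TRANS` (`transfer_of_binary`): if a standard `f` has zeros, but no standard
  ones, then the same `y` is standard and infinitely close to `1 / 2`, but the first digits of the
  expansions differ.
* From `Π⁰₁-TRANS` to `UBIN⁺`: `HAC_int` yields a standard functional that finds zeros of standard
  functions (`exists_search`). By `Π⁰₁-TRANS`, infinitely close standard reals are equal
  (`realEq_of_approx`). The comparison of a standard real with a nonstandard rational is not a
  search with a standard function; but correctness of the functional for all rationals says that one
  standard function of pairs has no zero, so it transfers (`searches_of_transfer`).
-/

namespace HigherRM

/-! ### Substitution -/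

/-- Simultaneous substitutions from the context `Γ` to the context `Δ`. -/
abbrev Sub (Γ Δ : Ctx) : Type := (σ : Ty) → Var Γ σ → Tm Δ σ

/-- Extension of a substitution by a value for the last variable. -/
def Sub.cons {Γ Δ : Ctx} {ρ : Ty} (t : Tm Δ ρ) (f : Sub Γ Δ) : Sub (ρ :: Γ) Δ
  | _, .z => t
  | _, .s v => f _ v

/-- Composition of substitutions. -/
def Sub.comp {Γ Δ Θ : Ctx} (f : Sub Γ Δ) (g : Sub Δ Θ) : Sub Γ Θ := fun σ v => (f σ v).subst g

/-- The identity substitution. -/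
def Sub.id (Γ : Ctx) : Sub Γ Γ := fun _ v => .var v

/-- Weakening by one variable, as a substitution. -/
def Sub.wk {Γ : Ctx} (ρ : Ty) : Sub Γ (ρ :: Γ) := fun _ v => .var (.s v)

theorem Tm.subst_subst {Γ Δ Θ : Ctx} (f : Sub Γ Δ) (g : Sub Δ Θ) {σ : Ty} (t : Tm Γ σ) :
    (t.subst f).subst g = t.subst (f.comp g) := by
  induction t with
  | var v => rfl
  | const c => rfl
  | app t u iht ihu => simp only [Tm.subst, iht, ihu]

theorem Tm.subst_id {Γ : Ctx} {σ : Ty} (t : Tm Γ σ) : t.subst (Sub.id Γ) = t := by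
  induction t with
  | var v => rfl
  | const c => rfl
  | app t u iht ihu => simp only [Tm.subst, iht, ihu]

theorem Tm.wk_eq {Γ : Ctx} {ρ σ : Ty} (t : Tm Γ σ) : (t.wk : Tm (ρ :: Γ) σ) = t.subst (Sub.wk ρ) :=
  rfl

theorem Tm.closed_subst {Γ Δ : Ctx} {σ : Ty} (f : Sub Γ Δ) (t : Tm [] σ) :
    (t.closed : Tm Γ σ).subst f = t.closed := by
  unfold Tm.closed Tm.rename
  rw [Tm.subst_subst]
  congr 1
  funext σ v
  nomatch v

theorem Sub.wk_comp_cons {Γ Δ : Ctx} {ρ : Ty} (t : Tm Δ ρ) (f : Sub Γ Δ) :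
    (Sub.wk ρ).comp (Sub.cons t f) = f := rfl

theorem Sub.wk_comp_lift {Γ Δ : Ctx} {ρ : Ty} (f : Sub Γ Δ) :
    (Sub.wk ρ).comp (liftSub ρ f) = f.comp (Sub.wk ρ) := rfl

theorem Sub.id_comp {Γ Δ : Ctx} (f : Sub Γ Δ) : (Sub.id Γ).comp f = f := rfl

theorem Sub.comp_id {Γ Δ : Ctx} (f : Sub Γ Δ) : f.comp (Sub.id Δ) = f := by
  funext σ v; exact Tm.subst_id _

theorem Sub.comp_assoc {Γ Δ Θ Ξ : Ctx} (f : Sub Γ Δ) (g : Sub Δ Θ) (h : Sub Θ Ξ) :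
    (f.comp g).comp h = f.comp (g.comp h) := by
  funext σ v; exact Tm.subst_subst _ _ _

theorem instSub_eq {Γ : Ctx} {ρ : Ty} (t : Tm Γ ρ) : instSub t = Sub.cons t (Sub.id Γ) := by
  funext σ v; cases v <;> rfl

theorem liftSub_eq {Γ Δ : Ctx} {ρ : Ty} (f : Sub Γ Δ) :
    liftSub ρ f = Sub.cons v0 (f.comp (Sub.wk ρ)) := by
  funext σ v; cases v <;> rfl

theorem Sub.cons_comp {Γ Δ Θ : Ctx} {ρ : Ty} (t : Tm Δ ρ) (f : Sub Γ Δ) (g : Sub Δ Θ) :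
    (Sub.cons t f).comp g = Sub.cons (t.subst g) (f.comp g) := by
  funext σ v; cases v <;> rfl

theorem lift_comp_lift {Γ Δ Θ : Ctx} (ρ : Ty) (f : Sub Γ Δ) (g : Sub Δ Θ) :
    (Sub.comp (liftSub ρ f) (liftSub ρ g)) = liftSub ρ (f.comp g) := by
  rw [liftSub_eq f, Sub.cons_comp, liftSub_eq (f.comp g), Sub.comp_assoc, Sub.wk_comp_lift,
    Sub.comp_assoc]
  rfl

theorem lift_comp_cons {Γ Δ Θ : Ctx} {ρ : Ty} (f : Sub Γ Δ) (t : Tm Θ ρ) (g : Sub Δ Θ) :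
    (Sub.comp (liftSub ρ f) (Sub.cons t g)) = Sub.cons t (f.comp g) := by
  rw [liftSub_eq f, Sub.cons_comp, Sub.comp_assoc, Sub.wk_comp_cons]
  rfl

theorem liftSub_id {Γ : Ctx} (ρ : Ty) : liftSub ρ (Sub.id Γ) = Sub.id (ρ :: Γ) := by
  funext σ v; cases v <;> rfl

theorem liftSub_ren {Γ Δ : Ctx} (ρ : Ty) (f : (σ : Ty) → Var Γ σ → Var Δ σ) :
    liftSub ρ (fun σ v => Tm.var (f σ v)) = fun σ v => Tm.var (liftRen ρ f σ v) := by
  funext σ v; cases v <;> rfl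

namespace Fm
variable {b : Bool}

theorem subst_subst {Γ : Ctx} (A : Fm b Γ) : ∀ {Δ Θ : Ctx} (f : Sub Γ Δ) (g : Sub Δ Θ),
    (A.subst f).subst g = A.subst (f.comp g) := by
  induction A with
  | eq t u => intros; simp only [subst, Tm.subst_subst]
  | st h t => intros; simp only [subst, Tm.subst_subst]
  | bot => intros; rfl
  | imp A B ihA ihB => intros; simp only [subst, ihA, ihB]
  | and A B ihA ihB => intros; simp only [subst, ihA, ihB]
  | or A B ihA ihB => intros; simp only [subst, ihA, ihB]
  | all σ A ih => intros; simp only [subst, ih, lift_comp_lift]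
  | ex σ A ih => intros; simp only [subst, ih, lift_comp_lift]

theorem subst_id {Γ : Ctx} (A : Fm b Γ) : A.subst (Sub.id Γ) = A := by
  induction A with
  | eq t u => simp only [subst, Tm.subst_id]
  | st h t => simp only [subst, Tm.subst_id]
  | bot => rfl
  | imp A B ihA ihB => simp only [subst, ihA, ihB]
  | and A B ihA ihB => simp only [subst, ihA, ihB]
  | or A B ihA ihB => simp only [subst, ihA, ihB]
  | all σ A ih => simp only [subst, liftSub_id, ih]
  | ex σ A ih => simp only [subst, liftSub_id, ih]

theorem wk_eq {Γ : Ctx} {ρ : Ty} (A : Fm b Γ) : (A.wk : Fm b (ρ :: Γ)) = A.subst (Sub.wk ρ) := rfl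

theorem inst_eq {Γ : Ctx} {ρ : Ty} (A : Fm b (ρ :: Γ)) (t : Tm Γ ρ) :
    A.inst t = A.subst (Sub.cons t (Sub.id Γ)) := by
  rw [inst, instSub_eq]

theorem inst_subst {Γ Δ : Ctx} {ρ : Ty} (A : Fm b (ρ :: Γ)) (t : Tm Γ ρ) (f : Sub Γ Δ) :
    (A.inst t).subst f = (A.subst (liftSub ρ f)).inst (t.subst f) := by
  rw [inst_eq, inst_eq, subst_subst, subst_subst, Sub.cons_comp, lift_comp_cons, Sub.comp_id,
    Sub.id_comp]

theorem wk_subst_lift {Γ Δ : Ctx} {ρ : Ty} (A : Fm b Γ) (f : Sub Γ Δ) :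
    (A.wk : Fm b (ρ :: Γ)).subst (liftSub ρ f) = (A.subst f).wk := by
  rw [wk_eq, wk_eq, subst_subst, subst_subst, Sub.wk_comp_lift]

theorem inst_lift {Γ Δ : Ctx} {ρ : Ty} (A : Fm b (ρ :: Γ)) (f : Sub Γ Δ) (t : Tm Δ ρ) :
    (A.subst (liftSub ρ f)).inst t = A.subst (Sub.cons t f) := by
  rw [inst_eq, subst_subst, lift_comp_cons, Sub.comp_id]

theorem lift_wk_inst {Γ : Ctx} {ρ : Ty} (A : Fm b (ρ :: Γ)) :
    (A.subst (liftSub ρ (Sub.wk ρ))).inst v0 = A := by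
  rw [inst_lift]
  convert A.subst_id using 2
  funext σ v; cases v <;> rfl

theorem eqT_subst (σ : Ty) : ∀ {Γ Δ : Ctx} (f : Sub Γ Δ) (s t : Tm Γ σ),
    (eqT σ s t : Fm b Γ).subst f = eqT σ (s.subst f) (t.subst f) := by
  have key : ∀ {Γ Δ : Ctx} {ρ τ : Ty} (f : Sub Γ Δ) (t : Tm Γ τ),
      (t.wk : Tm (ρ :: Γ) τ).subst (liftSub ρ f) = (t.subst f).wk := by
    intro Γ Δ ρ τ f t
    rw [Tm.wk_eq, Tm.wk_eq, Tm.subst_subst, Tm.subst_subst, Sub.wk_comp_lift]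
  induction σ with
  | nat => intros; rfl
  | arr ρ τ _ ih => intros; simp only [eqT, subst, ih, Tm.subst, key, liftSub]
  | seq ρ ih =>
    intro Γ Δ f s t
    simp only [eqT, subst, ih, Tm.subst, key, liftSub, lt, le]
    congr 3
    simp only [sub, recTm, succ, Tm.subst, key, liftSub]
    rfl

theorem le_subst {Γ Δ : Ctx} (f : Sub Γ Δ) (s t : Tm Γ ty0) :
    (le s t : Fm b Γ).subst f = le (s.subst f) (t.subst f) := rfl

theorem lt_subst {Γ Δ : Ctx} (f : Sub Γ Δ) (s t : Tm Γ ty0) :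
    (lt s t : Fm b Γ).subst f = lt (s.subst f) (t.subst f) := rfl

theorem ofInt_subst {Γ : Ctx} (A : Fm false Γ) : ∀ {Δ : Ctx} (f : Sub Γ Δ),
    (A.ofInt : Fm b Γ).subst f = (A.subst f).ofInt := by
  induction A with
  | eq t u => intros; rfl
  | st h t => nomatch h
  | bot => intros; rfl
  | imp A B ihA ihB => intros; simp only [ofInt, subst, ihA, ihB]
  | and A B ihA ihB => intros; simp only [ofInt, subst, ihA, ihB]
  | or A B ihA ihB => intros; simp only [ofInt, subst, ihA, ihB]
  | all σ A ih => intros; simp only [ofInt, subst, ih]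
  | ex σ A ih => intros; simp only [ofInt, subst, ih]

theorem IsQF.subst {Γ : Ctx} {A : Fm b Γ} (h : A.IsQF) : ∀ {Δ : Ctx} (f : Sub Γ Δ),
    (A.subst f).IsQF := by
  induction A with
  | eq t u => intros; trivial
  | st h t => exact h.elim
  | bot => intros; trivial
  | imp A B ihA ihB => exact fun f => ⟨ihA h.1 f, ihB h.2 f⟩
  | and A B ihA ihB => exact fun f => ⟨ihA h.1 f, ihB h.2 f⟩
  | or A B ihA ihB => exact fun f => ⟨ihA h.1 f, ihB h.2 f⟩
  | all σ A ih => exact h.elim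
  | ex σ A ih => exact h.elim

theorem succSub_eq {Γ : Ctx} :
    (succSub : Sub (ty0 :: Γ) (ty0 :: Γ)) = Sub.cons (succ v0) (Sub.wk ty0) := by
  funext σ v; cases v <;> rfl

theorem lift_comp_succSub {Γ Δ : Ctx} (f : Sub Γ Δ) :
    Sub.comp (liftSub ty0 f) succSub = Sub.comp succSub (liftSub ty0 f) := by
  rw [succSub_eq, succSub_eq, lift_comp_cons, Sub.cons_comp, Sub.wk_comp_lift]
  rfl

theorem rename_lift2 {Γ : Ctx} {ρ τ κ : Ty} (A : Fm b (τ :: ρ :: Γ)) :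
    (A.rename (liftRen τ (liftRen ρ (fun _ v => .s v))) : Fm b (τ :: ρ :: κ :: Γ)) =
      A.subst (liftSub τ (liftSub ρ (Sub.wk κ))) := by
  rw [rename, ← liftSub_ren, ← liftSub_ren]
  rfl

/-- Substitution commutes with inserting a fresh variable below the last two variables. -/
theorem rename_lift2_subst {Γ Δ : Ctx} {ρ τ κ : Ty} (A : Fm b (τ :: ρ :: Γ)) (f : Sub Γ Δ) :
    (A.rename (liftRen τ (liftRen ρ (fun _ v => .s v)))).subst
        (liftSub τ (liftSub ρ (liftSub κ f))) =
      (A.subst (liftSub τ (liftSub ρ f))).rename (liftRen τ (liftRen ρ (fun _ v => .s v))) := by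
  rw [rename_lift2, rename_lift2, subst_subst, subst_subst, lift_comp_lift, lift_comp_lift,
    lift_comp_lift, lift_comp_lift, Sub.wk_comp_lift]

theorem mem_subst {Γ Δ : Ctx} {σ : Ty} (f : Sub Γ Δ) (y : Tm Γ σ) (s : Tm Γ (.seq σ)) :
    (mem y s : Fm b Γ).subst f = mem (y.subst f) (s.subst f) := by
  have key : ∀ {τ : Ty} (t : Tm Γ τ),
      (t.wk : Tm (ty0 :: Γ) τ).subst (liftSub ty0 f) = (t.subst f).wk := by
    intro τ t
    rw [Tm.wk_eq, Tm.wk_eq, Tm.subst_subst, Tm.subst_subst, Sub.wk_comp_lift]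
  simp only [mem, subst, eqT_subst, lt_subst, Tm.subst, key, liftSub]

end Fm

/-! ### Closure of the axiom systems under substitution -/

/-- The set of axioms `Ax` is closed under substitution. -/
def SubstClosed {b : Bool} (Ax : (Γ : Ctx) → Fm b Γ → Prop) : Prop :=
  ∀ {Γ Δ : Ctx} (f : Sub Γ Δ) {A : Fm b Γ}, Ax Γ A → Ax Δ (A.subst f)

theorem EPRA.substClosed (b : Bool) : SubstClosed (EPRA b) := by
  intro Γ Δ f A h
  cases h with
  | refl s => exact .refl _
  | eucl s t u => exact .eucl _ _ _
  | ext s t g => simpa only [Fm.subst, Fm.eqT_subst, Tm.subst] using EPRA.ext _ _ (g.subst f)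
  | succ_ne s => exact .succ_ne _
  | succ_inj s t => exact .succ_inj _ _
  | combK s t =>
    simpa only [Fm.eqT_subst, Tm.subst] using EPRA.combK (s.subst f) (t.subst f)
  | combS s t u =>
    simpa only [Fm.eqT_subst, Tm.subst] using
      EPRA.combS (s.subst f) (t.subst f) (u.subst f)
  | rec_zero a g => exact .rec_zero (a.subst f) (g.subst f)
  | rec_succ n a g => exact .rec_succ (n.subst f) (a.subst f) (g.subst f)
  | qf_ind A hA =>
    have := EPRA.qf_ind (A.subst (liftSub ty0 f)) (hA.subst _)
    simp only [Fm.subst, Fm.inst_subst, Fm.subst_subst, ← Fm.lift_comp_succSub] at this ⊢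
    exact this
  | len_nil σ => exact .len_nil σ
  | len_cons a s => exact .len_cons (a.subst f) (s.subst f)
  | cons_zero a s =>
    simpa only [Fm.eqT_subst, Tm.subst, zero, succ] using
      EPRA.cons_zero (a.subst f) (s.subst f)
  | cons_succ a s i =>
    simpa only [Fm.eqT_subst, Tm.subst, zero, succ] using
      EPRA.cons_succ (a.subst f) (s.subst f) (i.subst f)
  | len_tab g n => exact .len_tab (g.subst f) (n.subst f)
  | proj_tab g n i =>
    simpa only [Fm.eqT_subst, Fm.subst, Fm.lt_subst, Tm.subst] using
      EPRA.proj_tab (g.subst f) (n.subst f) (i.subst f)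
  | proj_default s i =>
    have hz : ∀ σ : Ty, (zeroTm σ : Tm Γ σ).subst f = zeroTm σ := by
      intro σ
      induction σ with
      | nat => rfl
      | arr ρ τ _ ih => simp only [zeroTm, Tm.subst, ih]
      | seq ρ _ => rfl
    simpa only [Fm.eqT_subst, Fm.subst, Fm.le_subst, hz, Tm.subst] using
      EPRA.proj_default (s.subst f) (i.subst f)

theorem RCAω.substClosed (b : Bool) : SubstClosed (RCAω b) := by
  intro Γ Δ f A h
  cases h with
  | base h => exact .base (EPRA.substClosed b f h)
  | qf_ac A hA =>
    have := RCAω.qf_ac (A.subst (liftSub ty0 (liftSub ty1 f))) (hA.subst _)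
    simp only [Fm.subst, Fm.inst_subst] at this ⊢
    rw [Fm.rename_lift2_subst]
    exact this

theorem RCAΛ.substClosed : SubstClosed RCAΛ := by
  intro Γ Δ f A h
  cases h with
  | base h => exact .base (RCAω.substClosed true f h)
  | st_eq s t =>
    simpa only [Fm.subst, Fm.eqT_subst] using RCAΛ.st_eq (s.subst f) (t.subst f)
  | st_closed t =>
    simpa only [Fm.subst, Tm.closed_subst] using RCAΛ.st_closed (Γ := Δ) t
  | st_app g s => exact .st_app (g.subst f) (s.subst f)
  | hac ρ τ A =>
    have := RCAΛ.hac ρ τ (A.subst (liftSub τ (liftSub ρ f)))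
    simp only [Fm.allSt, Fm.exSt, Fm.subst, Fm.ofInt_subst, Fm.mem_subst,
      Fm.rename_lift2_subst] at this ⊢
    exact this
  | ideal σ τ A =>
    have := RCAΛ.ideal σ τ (A.subst (liftSub σ (liftSub τ f)))
    simp only [Fm.allSt, Fm.subst, Fm.ofInt_subst, Fm.mem_subst,
      Fm.rename_lift2_subst] at this ⊢
    exact this

/-! ### Structural properties of derivations -/

namespace Prf
variable {b : Bool} {Ax : (Γ : Ctx) → Fm b Γ → Prop}

theorem weaken {Γ : Ctx} {H : List (Fm b Γ)} {A : Fm b Γ} (h : Prf Ax Γ H A) :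
    ∀ {H' : List (Fm b Γ)}, H ⊆ H' → Prf Ax Γ H' A := by
  induction h with
  | ax h => exact fun _ => .ax h
  | hyp h => exact fun s => .hyp (s h)
  | impI _ ih => exact fun s => .impI (ih (List.cons_subset_cons _ s))
  | impE _ _ ih1 ih2 => exact fun s => .impE (ih1 s) (ih2 s)
  | andI _ _ ih1 ih2 => exact fun s => .andI (ih1 s) (ih2 s)
  | andL _ ih => exact fun s => .andL (ih s)
  | andR _ ih => exact fun s => .andR (ih s)
  | orL _ ih => exact fun s => .orL (ih s)
  | orR _ ih => exact fun s => .orR (ih s)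
  | orE _ _ _ ih1 ih2 ih3 =>
    exact fun s => .orE (ih1 s) (ih2 (List.cons_subset_cons _ s)) (ih3 (List.cons_subset_cons _ s))
  | raa _ ih => exact fun s => .raa (ih (List.cons_subset_cons _ s))
  | allI _ ih => exact fun s => .allI (ih (List.map_subset _ s))
  | allE t _ ih => exact fun s => .allE t (ih s)
  | exI t _ ih => exact fun s => .exI t (ih s)
  | exE _ _ ih1 ih2 =>
    exact fun s => .exE (ih1 s) (ih2 (List.cons_subset_cons _ (List.map_subset _ s)))

theorem map_wk_lift {Γ Δ : Ctx} {ρ : Ty} (H : List (Fm b Γ)) (f : Sub Γ Δ) :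
    (H.map (Fm.wk (ρ := ρ))).map (Fm.subst (liftSub ρ f)) = (H.map (Fm.subst f)).map Fm.wk := by
  simp only [List.map_map]
  congr 1
  funext A
  exact A.wk_subst_lift f

theorem subst (hAx : SubstClosed Ax) {Γ : Ctx} {H : List (Fm b Γ)} {A : Fm b Γ}
    (h : Prf Ax Γ H A) : ∀ {Δ : Ctx} (f : Sub Γ Δ), Prf Ax Δ (H.map (Fm.subst f)) (A.subst f) := by
  induction h with
  | ax h => exact fun f => .ax (hAx f h)
  | hyp h => exact fun f => .hyp (List.mem_map_of_mem h)
  | impI _ ih => exact fun f => .impI (ih f)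
  | impE _ _ ih1 ih2 => exact fun f => .impE (ih1 f) (ih2 f)
  | andI _ _ ih1 ih2 => exact fun f => .andI (ih1 f) (ih2 f)
  | andL _ ih => exact fun f => .andL (ih f)
  | andR _ ih => exact fun f => .andR (ih f)
  | orL _ ih => exact fun f => .orL (ih f)
  | orR _ ih => exact fun f => .orR (ih f)
  | orE _ _ _ ih1 ih2 ih3 => exact fun f => .orE (ih1 f) (ih2 f) (ih3 f)
  | raa _ ih => exact fun f => .raa (ih f)
  | allI _ ih =>
    intro Δ f
    have := ih (liftSub _ f)
    rw [map_wk_lift] at this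
    exact .allI this
  | allE t _ ih =>
    intro Δ f
    rw [Fm.inst_subst]
    exact .allE _ (ih f)
  | exI t _ ih =>
    intro Δ f
    have := ih f
    rw [Fm.inst_subst] at this
    exact .exI _ this
  | exE _ _ ih1 ih2 =>
    intro Δ f
    have := ih2 (liftSub _ f)
    rw [List.map_cons, map_wk_lift, Fm.wk_subst_lift] at this
    exact .exE (ih1 f) this

theorem wk {Γ : Ctx} (hAx : SubstClosed Ax) {ρ : Ty} {H : List (Fm b Γ)} {A : Fm b Γ}
    (h : Prf Ax Γ H A) : Prf Ax (ρ :: Γ) (H.map Fm.wk) A.wk := h.subst hAx (Sub.wk ρ)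

/-- The body of a derivable universal formula is derivable for a fresh variable. -/
theorem allE_wk (hAx : SubstClosed Ax) {Γ : Ctx} {ρ : Ty} {H : List (Fm b Γ)} {A : Fm b (ρ :: Γ)}
    (h : Prf Ax Γ H (.all ρ A)) : Prf Ax (ρ :: Γ) (H.map Fm.wk) A := by
  have : Prf Ax (ρ :: Γ) (H.map Fm.wk) ((A.subst (liftSub ρ (Sub.wk ρ))).inst v0) :=
    Prf.allE v0 (h.wk (ρ := ρ) hAx)
  rwa [Fm.lift_wk_inst] at this

theorem exfalso {Γ : Ctx} {H : List (Fm b Γ)} {A : Fm b Γ} (h : Prf Ax Γ H .bot) : Prf Ax Γ H A :=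
  .raa (h.weaken (List.subset_cons_self _ _))

theorem hyp0 {Γ : Ctx} {H : List (Fm b Γ)} {A : Fm b Γ} : Prf Ax Γ (A :: H) A :=
  .hyp (List.mem_cons_self ..)

theorem hyp1 {Γ : Ctx} {H : List (Fm b Γ)} {A B : Fm b Γ} : Prf Ax Γ (B :: A :: H) A :=
  .hyp (List.mem_cons_of_mem _ (List.mem_cons_self ..))

/-! ### Equality at all types is a congruence -/

theorem eq_eucl
    (hE : ∀ {Γ : Ctx} {A : Fm b Γ}, EPRA b Γ A → Ax Γ A)
    {Γ : Ctx} {H : List (Fm b Γ)} {s t u : Tm Γ ty0} (h1 : Prf Ax Γ H (.eq s t))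
    (h2 : Prf Ax Γ H (.eq s u)) : Prf Ax Γ H (.eq t u) :=
  .impE (.impE (.ax (hE (.eucl s t u))) h1) h2

theorem eq_symm
    (hE : ∀ {Γ : Ctx} {A : Fm b Γ}, EPRA b Γ A → Ax Γ A)
    {Γ : Ctx} {H : List (Fm b Γ)} {s t : Tm Γ ty0} (h1 : Prf Ax Γ H (.eq s t)) :
    Prf Ax Γ H (.eq t s) := eq_eucl hE h1 (.ax (hE (.refl s)))

theorem eqT_congr_arg
    (hE : ∀ {Γ : Ctx} {A : Fm b Γ}, EPRA b Γ A → Ax Γ A)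
    {Γ : Ctx} {H : List (Fm b Γ)} {ρ τ : Ty} {s t : Tm Γ ρ} (f : Tm Γ (ρ ⇒ τ))
    (h : Prf Ax Γ H (Fm.eqT ρ s t)) : Prf Ax Γ H (Fm.eqT τ (f ⬝ s) (f ⬝ t)) :=
  .impE (.ax (hE (.ext s t f))) h

theorem eqT_congr_fun {Γ : Ctx} {H : List (Fm b Γ)} {ρ τ : Ty} {f g : Tm Γ (ρ ⇒ τ)}
    (h : Prf Ax Γ H (Fm.eqT (ρ ⇒ τ) f g)) (u : Tm Γ ρ) :
    Prf Ax Γ H (Fm.eqT τ (f ⬝ u) (g ⬝ u)) := by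
  have := Prf.allE u h
  rw [Fm.inst_eq, Fm.eqT_subst] at this
  simpa only [Tm.subst, Tm.wk_eq, Tm.subst_subst, Sub.wk_comp_cons, Tm.subst_id, Sub.cons]
    using this

/-- An upper bound may be replaced by an equal one. -/
theorem lt_congr
    (hE : ∀ {Γ : Ctx} {A : Fm b Γ}, EPRA b Γ A → Ax Γ A)
    {Γ : Ctx} {H : List (Fm b Γ)} {i s t : Tm Γ ty0}
    (h : Prf Ax Γ H (.eq s t)) (h2 : Prf Ax Γ H (.lt i s)) : Prf Ax Γ H (.lt i t) := by
  have h3 : Prf Ax Γ H (Fm.eqT ty0 (sub (succ i) s) (sub (succ i) t)) :=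
    eqT_congr_fun (eqT_congr_fun (eqT_congr_arg hE (ρ := ty0) (.const .R) h) _) _
  exact eq_eucl hE h3 h2

theorem eqT_refl
    (hE : ∀ {Γ : Ctx} {A : Fm b Γ}, EPRA b Γ A → Ax Γ A)
    (σ : Ty) : ∀ {Γ : Ctx} {H : List (Fm b Γ)} (t : Tm Γ σ),
    Prf Ax Γ H (Fm.eqT σ t t) := by
  induction σ with
  | nat => exact fun t => .ax (hE (.refl t))
  | arr ρ τ _ ih => exact fun t => .allI (ih _)
  | seq ρ ih => exact fun t => .andI (.ax (hE (.refl _))) (.allI (.impI (ih _)))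

theorem eqT_eucl (hAx : SubstClosed Ax)
    (hE : ∀ {Γ : Ctx} {A : Fm b Γ}, EPRA b Γ A → Ax Γ A)
    (σ : Ty) : ∀ {Γ : Ctx} {H : List (Fm b Γ)} {s t u : Tm Γ σ},
    Prf Ax Γ H (Fm.eqT σ s t) → Prf Ax Γ H (Fm.eqT σ s u) → Prf Ax Γ H (Fm.eqT σ t u) := by
  induction σ with
  | nat => exact fun h1 h2 => eq_eucl hE h1 h2
  | arr ρ τ _ ih => exact fun h1 h2 => .allI (ih (allE_wk hAx h1) (allE_wk hAx h2))
  | seq ρ ih =>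
    intro Γ H s t u h1 h2
    refine .andI (eq_eucl hE h1.andL h2.andL) (.allI (.impI ?_))
    have hl : Prf Ax (ty0 :: Γ) (Fm.lt v0 (.const (.len ρ) ⬝ t.wk) :: H.map Fm.wk)
        (Fm.lt v0 (.const (.len ρ) ⬝ s.wk)) :=
      lt_congr hE (((eq_symm hE h1.andL).wk hAx).weaken (List.subset_cons_self _ _)) hyp0
    exact ih (.impE ((allE_wk hAx h1.andR).weaken (List.subset_cons_self _ _)) hl)
      (.impE ((allE_wk hAx h2.andR).weaken (List.subset_cons_self _ _)) hl)

theorem eqT_symm (hAx : SubstClosed Ax)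
    (hE : ∀ {Γ : Ctx} {A : Fm b Γ}, EPRA b Γ A → Ax Γ A)
    {σ : Ty} {Γ : Ctx} {H : List (Fm b Γ)} {s t : Tm Γ σ}
    (h : Prf Ax Γ H (Fm.eqT σ s t)) : Prf Ax Γ H (Fm.eqT σ t s) :=
  eqT_eucl hAx hE σ h (eqT_refl hE σ s)

theorem eqT_trans (hAx : SubstClosed Ax)
    (hE : ∀ {Γ : Ctx} {A : Fm b Γ}, EPRA b Γ A → Ax Γ A)
    {σ : Ty} {Γ : Ctx} {H : List (Fm b Γ)} {s t u : Tm Γ σ}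
    (h : Prf Ax Γ H (Fm.eqT σ s t)) (h' : Prf Ax Γ H (Fm.eqT σ t u)) :
    Prf Ax Γ H (Fm.eqT σ s u) :=
  eqT_eucl hAx hE σ (eqT_symm hAx hE h) h'

end Prf

/-! ### Models -/

/-- A structure for the language: a domain for each type, an application, an interpretation of the
constants, and a predicate `st`. Equality of type `0` is interpreted by equality in the domain. -/
structure Model where
  D : Ty → Type
  app {σ τ : Ty} : D (σ ⇒ τ) → D σ → D τ
  con {σ : Ty} : Const σ → D σ
  st {σ : Ty} : D σ → Prop

/-- Assignments of objects of `M` to the variables of `Γ`. -/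
abbrev Env (M : Model) (Γ : Ctx) : Type := (σ : Ty) → Var Γ σ → M.D σ

/-- The assignment to the empty context. -/
def Env.nil (M : Model) : Env M [] := fun _ v => nomatch v

/-- Extension of an assignment by a value for the last variable. -/
def Env.cons {M : Model} {Γ : Ctx} {ρ : Ty} (d : M.D ρ) (e : Env M Γ) : Env M (ρ :: Γ)
  | _, .z => d
  | _, .s v => e _ v

/-- The value of a term. -/
def Tm.eval {M : Model} {Γ : Ctx} (e : Env M Γ) : {σ : Ty} → Tm Γ σ → M.D σ
  | _, .var v => e _ v
  | _, .const c => M.con c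
  | _, .app t u => M.app (t.eval e) (u.eval e)

/-- Truth of a formula in a model under an assignment. -/
def Fm.eval {M : Model} {b : Bool} : {Γ : Ctx} → Env M Γ → Fm b Γ → Prop
  | _, e, .eq t u => t.eval e = u.eval e
  | _, e, .st _ t => M.st (t.eval e)
  | _, _, .bot => False
  | _, e, .imp A B => A.eval e → B.eval e
  | _, e, .and A B => A.eval e ∧ B.eval e
  | _, e, .or A B => A.eval e ∨ B.eval e
  | _, e, .all σ A => ∀ d : M.D σ, A.eval (e.cons d)
  | _, e, .ex σ A => ∃ d : M.D σ, A.eval (e.cons d)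

/-! ### Countability of the language -/

/-- A code for a type. -/
def Ty.code : Ty → ℕ
  | .nat => Nat.pair 0 0
  | .arr σ τ => Nat.pair 1 (Nat.pair σ.code τ.code)
  | .seq σ => Nat.pair 2 σ.code

theorem Ty.code_injective : Function.Injective Ty.code := by
  intro σ
  induction σ with
  | nat => intro τ h; cases τ <;> simp_all [Ty.code, Nat.pair_eq_pair]
  | arr σ τ ih1 ih2 =>
    intro τ h
    cases τ <;> simp only [Ty.code, Nat.pair_eq_pair] at h
    · omega
    · rw [ih1 h.2.1, ih2 h.2.2]
    · omega
  | seq σ ih =>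
    intro τ h
    cases τ <;> simp only [Ty.code, Nat.pair_eq_pair] at h
    · omega
    · omega
    · rw [ih h.2]

/-- A code for a variable. -/
def Var.code : {Γ : Ctx} → {σ : Ty} → Var Γ σ → ℕ
  | _, _, .z => 0
  | _, _, .s v => v.code + 1

theorem Var.code_injective {Γ : Ctx} {σ : Ty} (v : Var Γ σ) : ∀ {σ' : Ty} (v' : Var Γ σ'),
    v.code = v'.code → (⟨σ, v⟩ : Σ σ, Var Γ σ) = ⟨σ', v'⟩ := by
  induction v with
  | z => intro σ' v' h; cases v' with
    | z => rfl
    | s v' => simp [Var.code] at h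
  | s v ih => intro σ' v' h; cases v' with
    | z => simp [Var.code] at h
    | s v' =>
      have := ih v' (by simpa [Var.code] using h)
      cases this; rfl

/-- A code for a constant. -/
def Const.code : {σ : Ty} → Const σ → ℕ
  | _, .zero => Nat.pair 0 0
  | _, .succ => Nat.pair 1 0
  | _, .K σ τ => Nat.pair 2 (Nat.pair σ.code τ.code)
  | _, .S ρ σ τ => Nat.pair 3 (Nat.pair ρ.code (Nat.pair σ.code τ.code))
  | _, .R => Nat.pair 4 0
  | _, .nil σ => Nat.pair 5 σ.code
  | _, .cons σ => Nat.pair 6 σ.code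
  | _, .len σ => Nat.pair 7 σ.code
  | _, .proj σ => Nat.pair 8 σ.code
  | _, .tab σ => Nat.pair 9 σ.code

theorem Const.code_injective {σ : Ty} (c : Const σ) {σ' : Ty} (c' : Const σ')
    (h : c.code = c'.code) : (⟨σ, c⟩ : Σ σ, Const σ) = ⟨σ', c'⟩ := by
  cases c <;> cases c' <;> simp only [Const.code, Nat.pair_eq_pair] at h <;>
    first
    | (exfalso; omega)
    | rfl
    | (obtain ⟨_, h⟩ := h; cases Ty.code_injective h; rfl)
    | (obtain ⟨_, h1, h2⟩ := h; cases Ty.code_injective h1; cases Ty.code_injective h2; rfl)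
    | (obtain ⟨_, h1, h2, h3⟩ := h; cases Ty.code_injective h1; cases Ty.code_injective h2
       cases Ty.code_injective h3; rfl)

/-- A code for a term. -/
def Tm.code {Γ : Ctx} : {σ : Ty} → Tm Γ σ → ℕ
  | _, .var v => Nat.pair 0 v.code
  | _, .const c => Nat.pair 1 c.code
  | _, .app t u => Nat.pair 2 (Nat.pair t.code u.code)

theorem Tm.code_injective {Γ : Ctx} {σ : Ty} (t : Tm Γ σ) : ∀ {σ' : Ty} (t' : Tm Γ σ'),
    t.code = t'.code → (⟨σ, t⟩ : Σ σ, Tm Γ σ) = ⟨σ', t'⟩ := by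
  induction t with
  | var v =>
    intro σ' t' h
    cases t' <;> simp only [Tm.code, Nat.pair_eq_pair] at h
    · cases v.code_injective _ h.2; rfl
    · omega
    · omega
  | const c =>
    intro σ' t' h
    cases t' <;> simp only [Tm.code, Nat.pair_eq_pair] at h
    · omega
    · cases c.code_injective _ h.2; rfl
    · omega
  | app t u iht ihu =>
    intro σ' t' h
    cases t' <;> simp only [Tm.code, Nat.pair_eq_pair] at h
    · omega
    · omega
    · cases iht _ h.2.1; cases ihu _ h.2.2; rfl

/-- A code for a formula. -/
def Fm.code {b : Bool} : {Γ : Ctx} → Fm b Γ → ℕ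
  | _, .eq t u => Nat.pair 0 (Nat.pair t.code u.code)
  | _, .st _ t => Nat.pair 1 t.code
  | _, .bot => Nat.pair 2 0
  | _, .imp A B => Nat.pair 3 (Nat.pair A.code B.code)
  | _, .and A B => Nat.pair 4 (Nat.pair A.code B.code)
  | _, .or A B => Nat.pair 5 (Nat.pair A.code B.code)
  | _, .all σ A => Nat.pair 6 (Nat.pair σ.code A.code)
  | _, .ex σ A => Nat.pair 7 (Nat.pair σ.code A.code)

theorem Fm.code_injective {b : Bool} {Γ : Ctx} :
    Function.Injective (Fm.code (b := b) (Γ := Γ)) := by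
  intro A
  induction A with
  | eq t u =>
    intro B h
    cases B <;> simp only [Fm.code, Nat.pair_eq_pair] at h <;> first | (exfalso; omega) | skip
    cases Tm.code_injective _ _ h.2.1; cases Tm.code_injective _ _ h.2.2; rfl
  | st _ t =>
    intro B h
    cases B <;> simp only [Fm.code, Nat.pair_eq_pair] at h <;> first | (exfalso; omega) | skip
    cases Tm.code_injective _ _ h.2; rfl
  | bot =>
    intro B h
    cases B <;> simp only [Fm.code, Nat.pair_eq_pair] at h <;> first | (exfalso; omega) | rfl
  | imp _ _ ih1 ih2 | and _ _ ih1 ih2 | or _ _ ih1 ih2 =>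
    intro B h
    cases B <;> simp only [Fm.code, Nat.pair_eq_pair] at h <;> first | (exfalso; omega) | skip
    rw [ih1 h.2.1, ih2 h.2.2]
  | all _ _ ih | ex _ _ ih =>
    intro B h
    cases B <;> simp only [Fm.code, Nat.pair_eq_pair] at h <;> first | (exfalso; omega) | skip
    cases Ty.code_injective h.2.1
    rw [ih h.2.2]

instance : Countable Ty := Ty.code_injective.countable

instance {b : Bool} {Γ : Ctx} : Countable (Fm b Γ) := Fm.code_injective.countable

/-! ### Extensions of contexts -/

/-- `Sfx Γ Δ`: the context `Δ` arises from `Γ` by adding variables. -/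
inductive Sfx : Ctx → Ctx → Type
  | refl (Γ : Ctx) : Sfx Γ Γ
  | step {Γ Δ : Ctx} (ρ : Ty) : Sfx Γ Δ → Sfx Γ (ρ :: Δ)

namespace Sfx

theorem length_le {Γ Δ : Ctx} (s : Sfx Γ Δ) : Γ.length ≤ Δ.length := by
  induction s with
  | refl => exact le_rfl
  | step ρ _ ih => exact ih.trans (Nat.le_succ _)

theorem unique {Γ Δ : Ctx} (s : Sfx Γ Δ) : ∀ s' : Sfx Γ Δ, s = s' := by
  induction s with
  | refl =>
    intro s'
    cases s' with
    | refl => rfl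
    | step ρ s' => have := s'.length_le; simp at this
  | step ρ s ih =>
    intro s'
    cases s' with
    | refl => have := s.length_le; simp at this
    | step _ s' => rw [ih s']

/-- Composition. -/
def trans {Γ Δ Θ : Ctx} (s : Sfx Γ Δ) : Sfx Δ Θ → Sfx Γ Θ
  | .refl _ => s
  | .step ρ s' => .step ρ (s.trans s')

/-- The inclusion of variables, as a substitution. -/
def sub {Γ Δ : Ctx} : Sfx Γ Δ → Sub Γ Δ
  | .refl _ => Sub.id _
  | .step ρ s => s.sub.comp (Sub.wk ρ)

theorem sub_trans {Γ Δ Θ : Ctx} (s : Sfx Γ Δ) (s' : Sfx Δ Θ) :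
    (s.trans s').sub = s.sub.comp s'.sub := by
  induction s' with
  | refl => exact (Sub.comp_id _).symm
  | step ρ s' ih => simp only [trans, sub, ih, Sub.comp_assoc]

end Sfx

/-! ### Generic filters of consistent sets of hypotheses -/

section Henkin
variable {b : Bool} {Ax : (Γ : Ctx) → Fm b Γ → Prop}

/-- The forcing conditions of the Henkin construction: finite consistent sets of hypotheses, each
with a context whose variables are the names of the witnesses it speaks about. -/
structure Cond (Ax : (Γ : Ctx) → Fm b Γ → Prop) where
  ctx : Ctx
  hyps : List (Fm b ctx)
  consistent : ¬ Prf Ax ctx hyps .bot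

/-- The stronger conditions, with more variables and more hypotheses, are the larger ones. -/
instance : Preorder (Cond Ax) where
  le p q := ∃ s : Sfx p.ctx q.ctx, ∀ A ∈ p.hyps, A.subst s.sub ∈ q.hyps
  le_refl p := ⟨.refl _, fun A hA => by simpa only [Sfx.sub, Fm.subst_id] using hA⟩
  le_trans p q r := by
    rintro ⟨s, hs⟩ ⟨s', hs'⟩
    refine ⟨s.trans s', fun A hA => ?_⟩
    rw [Sfx.sub_trans, ← Fm.subst_subst]
    exact hs' _ (hs _ hA)

theorem Cond.mono (hAx : SubstClosed Ax) {p q : Cond Ax} (h : p ≤ q) {A : Fm b p.ctx}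
    (hA : Prf Ax p.ctx p.hyps A) (s : Sfx p.ctx q.ctx) : Prf Ax q.ctx q.hyps (A.subst s.sub) := by
  obtain ⟨s', hs⟩ := h
  rw [s.unique s']
  refine (hA.subst hAx s'.sub).weaken fun B hB => ?_
  obtain ⟨C, hC, rfl⟩ := List.mem_map.1 hB
  exact hs C hC

/-- A condition that adds a hypothesis. -/
theorem Cond.exists_add (p : Cond Ax) (A : Fm b p.ctx) (h : ¬ Prf Ax p.ctx (A :: p.hyps) .bot) :
    ∃ q : Cond Ax, p ≤ q ∧ ∃ s : Sfx p.ctx q.ctx, Prf Ax q.ctx q.hyps (A.subst s.sub) :=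
  ⟨⟨p.ctx, A :: p.hyps, h⟩, ⟨.refl _, fun B hB => by
    simpa only [Sfx.sub, Fm.subst_id] using List.mem_cons_of_mem _ hB⟩, .refl _, by
    simpa only [Sfx.sub, Fm.subst_id] using Prf.hyp0⟩

/-- `p` decides `A`, and provides a witness if it proves `A` and `A` is an existential formula. -/
def Cond.Decides (p : Cond Ax) {Γ : Ctx} (A : Fm b Γ) (s : Sfx Γ p.ctx) : Prop :=
  Prf Ax p.ctx p.hyps (A.neg.subst s.sub) ∨
    (Prf Ax p.ctx p.hyps (A.subst s.sub) ∧ ∀ (σ : Ty) (B : Fm b (σ :: Γ)), A = .ex σ B →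
      ∃ t : Tm p.ctx σ, Prf Ax p.ctx p.hyps (B.subst (Sub.cons t s.sub)))

theorem Cond.exists_decides (hAx : SubstClosed Ax) (p : Cond Ax) {Γ : Ctx} (A : Fm b Γ)
    (s : Sfx Γ p.ctx) : ∃ q : Cond Ax, p ≤ q ∧ ∃ s : Sfx Γ q.ctx, q.Decides A s := by
  by_cases h : Prf Ax p.ctx (A.subst s.sub :: p.hyps) .bot
  · exact ⟨p, le_rfl, s, Or.inl (.impI h)⟩
  obtain ⟨q, hpq, s', hq⟩ := p.exists_add _ h
  rw [Fm.subst_subst, ← Sfx.sub_trans] at hq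
  by_cases hA : ∃ (σ : Ty) (B : Fm b (σ :: Γ)), A = .ex σ B
  · obtain ⟨σ, B, rfl⟩ := hA
    set r := s.trans s'
    have hc : ¬ Prf Ax (σ :: q.ctx) (B.subst (liftSub σ r.sub) :: q.hyps.map Fm.wk) .bot :=
      fun hc => q.consistent (.exE hq hc)
    have hle : q ≤ ⟨_, _, hc⟩ := ⟨.step σ (.refl _), fun C hC =>
      List.mem_cons_of_mem _ (List.mem_map.2 ⟨C, hC, rfl⟩)⟩
    refine ⟨⟨_, _, hc⟩, hpq.trans hle, .step σ r, Or.inr ⟨?_, ?_⟩⟩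
    · have := Cond.mono hAx hle hq (.step σ (.refl _))
      rw [Fm.subst_subst] at this
      exact this
    · intro σ' B' hB
      cases hB
      refine ⟨v0, ?_⟩
      have := Prf.hyp0 (Ax := Ax) (A := B.subst (liftSub σ r.sub)) (H := q.hyps.map Fm.wk)
      rw [liftSub_eq] at this
      exact this
  · exact ⟨q, hpq, _, Or.inr ⟨hq, fun σ B hB => (hA ⟨σ, B, hB⟩).elim⟩⟩

/-- The set of conditions that decide `A`, or have no extension whose context extends that of
`A`. -/
def decideSet (hAx : SubstClosed Ax) (A : Σ Γ : Ctx, Fm b Γ) : Order.Cofinal (Cond Ax) where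
  carrier := {p | (∀ q ≥ p, IsEmpty (Sfx A.1 q.ctx)) ∨ ∃ s : Sfx A.1 p.ctx, p.Decides A.2 s}
  isCofinal p := by
    by_cases h : ∀ q ≥ p, IsEmpty (Sfx A.1 q.ctx)
    · exact ⟨p, Or.inl h, le_rfl⟩
    · push Not at h
      obtain ⟨q, hq, ⟨s⟩⟩ := h
      obtain ⟨r, hr, hd⟩ := q.exists_decides hAx A.2 s
      exact ⟨r, Or.inr hd, le_trans hq hr⟩

/-- A directed set of conditions that decides every formula, over an axiom system that is closed
under substitution and for which `eqT` is a congruence. -/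
structure Generic (Ax : (Γ : Ctx) → Fm b Γ → Prop) where
  I : Order.Ideal (Cond Ax)
  hAx : SubstClosed Ax
  hE : ∀ {Γ : Ctx} {A : Fm b Γ}, EPRA b Γ A → Ax Γ A
  hst : ∀ (h : b = true) {Γ : Ctx} {σ : Ty} (s t : Tm Γ σ),
    Ax Γ (.st h s ⟹ Fm.eqT σ s t ⟹ .st h t)
  meets : ∀ A, ∃ p ∈ decideSet hAx A, p ∈ I

theorem Generic.exists_of_consistent (hAx : SubstClosed Ax)
    (hE : ∀ {Γ : Ctx} {A : Fm b Γ}, EPRA b Γ A → Ax Γ A)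
    (hst : ∀ (h : b = true) {Γ : Ctx} {σ : Ty} (s t : Tm Γ σ),
      Ax Γ (.st h s ⟹ Fm.eqT σ s t ⟹ .st h t)) (p : Cond Ax) :
    ∃ G : Generic Ax, p ∈ G.I := by
  have : Encodable (Σ Γ : Ctx, Fm b Γ) := Encodable.ofCountable _
  exact ⟨⟨Order.idealOfCofinals p (decideSet hAx), hAx, hE, hst,
    Order.cofinal_meets_idealOfCofinals p (decideSet hAx)⟩, Order.mem_idealOfCofinals p _⟩

namespace Generic
variable (G : Generic Ax)

/-- The contexts of the variables that occur in the generic set. -/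
def IsCtx (Γ : Ctx) : Prop := ∃ p ∈ G.I, Nonempty (Sfx Γ p.ctx)

/-- The formula `A` follows from some condition of the generic set. -/
def Holds {Γ : Ctx} (A : Fm b Γ) : Prop :=
  ∃ p ∈ G.I, ∃ s : Sfx Γ p.ctx, Prf Ax p.ctx p.hyps (A.subst s.sub)

variable {G}

theorem Holds.isCtx {Γ : Ctx} {A : Fm b Γ} (h : G.Holds A) : G.IsCtx Γ :=
  let ⟨p, hp, s, _⟩ := h; ⟨p, hp, ⟨s⟩⟩

theorem IsCtx.joint {Γ Δ : Ctx} (h : G.IsCtx Γ) (h' : G.IsCtx Δ) :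
    ∃ Θ, G.IsCtx Θ ∧ Nonempty (Sfx Γ Θ) ∧ Nonempty (Sfx Δ Θ) := by
  obtain ⟨p, hp, ⟨s⟩⟩ := h
  obtain ⟨q, hq, ⟨s'⟩⟩ := h'
  obtain ⟨r, hr, ⟨u, _⟩, ⟨u', _⟩⟩ := G.I.directed p hp q hq
  exact ⟨r.ctx, ⟨r, hr, ⟨.refl _⟩⟩, ⟨s.trans u⟩, ⟨s'.trans u'⟩⟩

theorem Holds.wk {Γ Δ : Ctx} {A : Fm b Γ} (h : G.Holds A) (hΔ : G.IsCtx Δ) (s : Sfx Γ Δ) :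
    G.Holds (A.subst s.sub) := by
  obtain ⟨p, hp, s', h⟩ := h
  obtain ⟨q, hq, ⟨t⟩⟩ := hΔ
  obtain ⟨r, hr, hpr, hqr⟩ := G.I.directed p hp q hq
  obtain ⟨u, -⟩ := id hpr
  obtain ⟨u', -⟩ := id hqr
  refine ⟨r, hr, t.trans u', ?_⟩
  have := Cond.mono G.hAx hpr h u
  rw [Fm.subst_subst, ← Sfx.sub_trans] at this ⊢
  rwa [Sfx.unique (s.trans (t.trans u')) (s'.trans u)]

theorem Holds.of_wk {Γ Δ : Ctx} {A : Fm b Γ} {s : Sfx Γ Δ} (h : G.Holds (A.subst s.sub)) :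
    G.Holds A := by
  obtain ⟨p, hp, s', h⟩ := h
  rw [Fm.subst_subst, ← Sfx.sub_trans] at h
  exact ⟨p, hp, _, h⟩

theorem prf_cut {Γ : Ctx} {H H' : List (Fm b Γ)} (h : ∀ B ∈ H, Prf Ax Γ H' B) :
    ∀ {A : Fm b Γ}, Prf Ax Γ H A → Prf Ax Γ H' A := by
  induction H with
  | nil => exact fun hA => hA.weaken (List.nil_subset _)
  | cons B H ih =>
    intro A hA
    exact .impE (ih (fun C hC => h C (List.mem_cons_of_mem _ hC)) (.impI hA))
      (h B List.mem_cons_self)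

theorem holds_of_prf {Γ : Ctx} (hΓ : G.IsCtx Γ) {H : List (Fm b Γ)} (hH : ∀ B ∈ H, G.Holds B)
    {A : Fm b Γ} (hA : Prf Ax Γ H A) : G.Holds A := by
  have key : ∃ p ∈ G.I, ∃ s : Sfx Γ p.ctx, ∀ B ∈ H, Prf Ax p.ctx p.hyps (B.subst s.sub) := by
    clear hA
    induction H with
    | nil =>
      obtain ⟨p, hp, ⟨s⟩⟩ := hΓ
      exact ⟨p, hp, s, fun B hB => by simp at hB⟩
    | cons B H ih =>
      obtain ⟨p, hp, s, h⟩ := ih fun C hC => hH C (List.mem_cons_of_mem _ hC)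
      obtain ⟨q, hq, s', h'⟩ := hH B List.mem_cons_self
      obtain ⟨r, hr, hpr, hqr⟩ := G.I.directed p hp q hq
      obtain ⟨u, -⟩ := id hpr
      obtain ⟨u', -⟩ := id hqr
      refine ⟨r, hr, s.trans u, fun C hC => ?_⟩
      rcases List.mem_cons.1 hC with rfl | hC
      · have := Cond.mono G.hAx hqr h' u'
        rwa [Fm.subst_subst, ← Sfx.sub_trans, Sfx.unique (s'.trans u') (s.trans u)] at this
      · have := Cond.mono G.hAx hpr (h C hC) u
        rwa [Fm.subst_subst, ← Sfx.sub_trans] at this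
  obtain ⟨p, hp, s, h⟩ := key
  refine ⟨p, hp, s, prf_cut (fun B hB => ?_) (hA.subst G.hAx s.sub)⟩
  obtain ⟨C, hC, rfl⟩ := List.mem_map.1 hB
  exact h C hC

theorem Holds.mp1 {Γ : Ctx} {A B : Fm b Γ} (hA : G.Holds A) (h : Prf Ax Γ [A] B) : G.Holds B :=
  holds_of_prf hA.isCtx (by simpa using hA) h

theorem Holds.mp2 {Γ : Ctx} {A B C : Fm b Γ} (hA : G.Holds A) (hB : G.Holds B)
    (h : Prf Ax Γ [A, B] C) : G.Holds C :=
  holds_of_prf hA.isCtx (by simpa using ⟨hA, hB⟩) h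

theorem not_holds_bot {Γ : Ctx} : ¬ G.Holds (.bot : Fm b Γ) :=
  fun ⟨p, _, _, h⟩ => p.consistent h

/-- Each formula is decided by the generic set. -/
theorem IsCtx.decides {Γ : Ctx} (hΓ : G.IsCtx Γ) (A : Fm b Γ) :
    ∃ p ∈ G.I, ∃ s : Sfx Γ p.ctx, p.Decides A s := by
  obtain ⟨p, hp, hpI⟩ := G.meets ⟨Γ, A⟩
  rcases hp with hp | ⟨s, hs⟩
  · obtain ⟨q, hq, ⟨s⟩⟩ := hΓ
    obtain ⟨r, hr, hpr, ⟨u, -⟩⟩ := G.I.directed p hpI q hq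
    exact ((hp r hpr).false (s.trans u)).elim
  · exact ⟨p, hpI, s, hs⟩

theorem holds_neg_iff {Γ : Ctx} (hΓ : G.IsCtx Γ) {A : Fm b Γ} : G.Holds A.neg ↔ ¬ G.Holds A := by
  constructor
  · exact fun h h' => not_holds_bot (h.mp2 h' (.impE .hyp0 .hyp1))
  · intro h
    obtain ⟨p, hp, s, hs | hs⟩ := hΓ.decides A
    · exact ⟨p, hp, s, hs⟩
    · exact (h ⟨p, hp, s, hs.1⟩).elim

/-- Generic sets have the Henkin property. -/
theorem Holds.exists_witness {Γ : Ctx} {σ : Ty} {A : Fm b (σ :: Γ)} (h : G.Holds (.ex σ A)) :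
    ∃ Δ, G.IsCtx Δ ∧ ∃ (s : Sfx Γ Δ) (t : Tm Δ σ), G.Holds (A.subst (Sub.cons t s.sub)) := by
  obtain ⟨p, hp, s, hs | hs⟩ := h.isCtx.decides (.ex σ A)
  · exact ((holds_neg_iff h.isCtx).1 ⟨p, hp, s, hs⟩ h).elim
  · obtain ⟨t, ht⟩ := hs.2 σ A rfl
    exact ⟨p.ctx, ⟨p, hp, ⟨.refl _⟩⟩, s, t, p, hp, .refl _, by
      simpa only [Sfx.sub, Fm.subst_id] using ht⟩

/-! ### The term model -/

theorem nonempty_sfx_nil (Γ : Ctx) : Nonempty (Sfx [] Γ) := by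
  induction Γ with
  | nil => exact ⟨.refl _⟩
  | cons ρ Γ ih => exact ⟨.step ρ ih.some⟩

variable (G)

/-- Terms in the contexts of the generic set. -/
structure Elem (G : Generic Ax) (σ : Ty) where
  ctx : Ctx
  isCtx : G.IsCtx ctx
  tm : Tm ctx σ

/-- Terms are identified if their equality holds, after both are moved into one context. -/
def Rel {σ : Ty} (x y : G.Elem σ) : Prop :=
  ∃ (Θ : Ctx) (s : Sfx x.ctx Θ) (s' : Sfx y.ctx Θ),
    G.Holds (Fm.eqT σ (x.tm.subst s.sub) (y.tm.subst s'.sub))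

variable {G}

theorem Rel.holds {σ : Ty} {x y : G.Elem σ} (h : G.Rel x y) {Θ : Ctx} (hΘ : G.IsCtx Θ)
    (s : Sfx x.ctx Θ) (s' : Sfx y.ctx Θ) :
    G.Holds (Fm.eqT σ (x.tm.subst s.sub) (y.tm.subst s'.sub)) := by
  obtain ⟨Δ, t, t', h⟩ := h
  obtain ⟨Ξ, hΞ, ⟨u⟩, ⟨u'⟩⟩ := hΘ.joint h.isCtx
  refine Holds.of_wk (s := u) ?_
  have := h.wk hΞ u'
  rw [Fm.eqT_subst, Tm.subst_subst, Tm.subst_subst, ← Sfx.sub_trans, ← Sfx.sub_trans] at this ⊢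
  rwa [Sfx.unique (s.trans u) (t.trans u'), Sfx.unique (s'.trans u) (t'.trans u')]

instance setoid (G : Generic Ax) (σ : Ty) : Setoid (G.Elem σ) where
  r := G.Rel
  iseqv := by
    refine ⟨fun x => ⟨_, .refl _, .refl _, ?_⟩, ?_, ?_⟩
    · exact holds_of_prf x.isCtx (H := []) (by simp) (Prf.eqT_refl G.hE σ _)
    · rintro x y ⟨Θ, s, s', h⟩
      exact ⟨Θ, s', s, h.mp1 (Prf.eqT_symm G.hAx G.hE .hyp0)⟩
    · rintro x y z h h'
      obtain ⟨Θ, hΘ, ⟨s⟩, ⟨s'⟩⟩ := x.isCtx.joint y.isCtx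
      obtain ⟨Ξ, hΞ, ⟨t⟩, ⟨t'⟩⟩ := hΘ.joint z.isCtx
      exact ⟨Ξ, s.trans t, t', (h.holds hΞ (s.trans t) (s'.trans t)).mp2
        (h'.holds hΞ (s'.trans t) t') (Prf.eqT_trans G.hAx G.hE .hyp0 .hyp1)⟩

/-- The class of a term. -/
def cls {Γ : Ctx} (hΓ : G.IsCtx Γ) {σ : Ty} (t : Tm Γ σ) : Quotient (G.setoid σ) :=
  Quotient.mk _ ⟨Γ, hΓ, t⟩

theorem cls_eq_cls {Γ : Ctx} (hΓ : G.IsCtx Γ) {σ : Ty} {t u : Tm Γ σ} :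
    cls hΓ t = cls hΓ u ↔ G.Holds (Fm.eqT σ t u) := by
  refine Quotient.eq.trans ⟨fun h => ?_, fun h => ?_⟩
  · simpa only [Sfx.sub, Tm.subst_id] using Rel.holds h hΓ (.refl _) (.refl _)
  · exact ⟨Γ, .refl _, .refl _, by simpa only [Sfx.sub, Tm.subst_id] using h⟩

theorem cls_wk {Γ Δ : Ctx} (hΓ : G.IsCtx Γ) (hΔ : G.IsCtx Δ) (s : Sfx Γ Δ) {σ : Ty} (t : Tm Γ σ) :
    cls hΓ t = cls hΔ (t.subst s.sub) :=
  Quotient.sound ⟨Δ, s, .refl _, by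
    simpa only [Sfx.sub, Tm.subst_id] using
      holds_of_prf hΔ (H := []) (by simp) (Prf.eqT_refl G.hE σ _)⟩

theorem exists_cls {σ : Ty} (x : Quotient (G.setoid σ)) :
    ∃ (Γ : Ctx) (hΓ : G.IsCtx Γ) (t : Tm Γ σ), x = cls hΓ t := by
  induction x using Quotient.inductionOn with
  | h x => exact ⟨x.ctx, x.isCtx, x.tm, rfl⟩

/-- Finitely many objects of the term model are named in one context. -/
theorem exists_sub {Γ : Ctx} (e : (σ : Ty) → Var Γ σ → Quotient (G.setoid σ))
    (h0 : G.IsCtx []) : ∃ (Θ : Ctx) (hΘ : G.IsCtx Θ) (f : Sub Γ Θ),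
      e = fun σ v => cls hΘ (f σ v) := by
  induction Γ with
  | nil => exact ⟨[], h0, fun _ v => (nomatch v), by funext σ v; nomatch v⟩
  | cons ρ Γ ih =>
    obtain ⟨Θ, hΘ, f, hf⟩ := ih fun σ v => e σ (.s v)
    obtain ⟨Δ, hΔ, t, ht⟩ := exists_cls (e ρ .z)
    obtain ⟨Ξ, hΞ, ⟨s⟩, ⟨s'⟩⟩ := hΘ.joint hΔ
    refine ⟨Ξ, hΞ, Sub.cons (t.subst s'.sub) (f.comp s.sub), ?_⟩
    funext σ v
    cases v with
    | z => exact ht.trans (cls_wk _ _ s' t)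
    | s v => exact (congrFun (congrFun hf σ) v).trans (cls_wk _ _ s _)

theorem cls_congr_app {Γ : Ctx} (hΓ : G.IsCtx Γ) {σ τ : Ty} {t t' : Tm Γ (σ ⇒ τ)} {u u' : Tm Γ σ}
    (ht : cls hΓ t = cls hΓ t') (hu : cls hΓ u = cls hΓ u') :
    cls hΓ (t ⬝ u) = cls hΓ (t' ⬝ u') := by
  rw [cls_eq_cls] at *
  exact ht.mp2 hu (Prf.eqT_trans G.hAx G.hE (Prf.eqT_congr_fun .hyp0 u)
    (Prf.eqT_congr_arg G.hE t' .hyp1))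

/-- Application of terms, after moving them into one context. -/
noncomputable def appElem {σ τ : Ty} (x : G.Elem (σ ⇒ τ)) (y : G.Elem σ) :
    Quotient (G.setoid τ) :=
  let h := x.isCtx.joint y.isCtx
  cls h.choose_spec.1
    (x.tm.subst h.choose_spec.2.1.some.sub ⬝ y.tm.subst h.choose_spec.2.2.some.sub)

theorem appElem_eq {σ τ : Ty} (x : G.Elem (σ ⇒ τ)) (y : G.Elem σ) {Γ : Ctx} (hΓ : G.IsCtx Γ)
    {t : Tm Γ (σ ⇒ τ)} {u : Tm Γ σ} (hx : cls x.isCtx x.tm = cls hΓ t)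
    (hy : cls y.isCtx y.tm = cls hΓ u) : appElem x y = cls hΓ (t ⬝ u) := by
  have h := x.isCtx.joint y.isCtx
  obtain ⟨Ξ, hΞ, ⟨v⟩, ⟨w⟩⟩ := h.choose_spec.1.joint hΓ
  unfold appElem
  dsimp only
  rw [cls_wk h.choose_spec.1 hΞ v, cls_wk hΓ hΞ w (t ⬝ u)]
  refine cls_congr_app hΞ ?_ ?_
  · rw [← cls_wk h.choose_spec.1 hΞ v, ← cls_wk x.isCtx, ← cls_wk hΓ hΞ w, hx]
  · rw [← cls_wk h.choose_spec.1 hΞ v, ← cls_wk y.isCtx, ← cls_wk hΓ hΞ w, hy]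

/-- Application in the term model. -/
noncomputable def app {σ τ : Ty} (x : Quotient (G.setoid (σ ⇒ τ))) (y : Quotient (G.setoid σ)) :
    Quotient (G.setoid τ) := appElem x.out y.out

theorem app_cls {Γ : Ctx} (hΓ : G.IsCtx Γ) {σ τ : Ty} (t : Tm Γ (σ ⇒ τ)) (u : Tm Γ σ) :
    app (cls hΓ t) (cls hΓ u) = cls hΓ (t ⬝ u) :=
  appElem_eq _ _ hΓ (Quotient.out_eq _) (Quotient.out_eq _)

theorem isCtx_nil : G.IsCtx [] := by
  obtain ⟨p, hp⟩ := G.I.nonempty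
  exact ⟨p, hp, nonempty_sfx_nil _⟩

variable (G)

/-- The model of the equivalence classes of terms. -/
noncomputable def model : Model where
  D σ := Quotient (G.setoid σ)
  app := app
  con c := cls isCtx_nil (.const c)
  st {σ} x := ∃ (h : b = true) (Γ : Ctx) (hΓ : G.IsCtx Γ) (t : Tm Γ σ),
    x = cls hΓ t ∧ G.Holds (.st h t)

variable {G}

/-- The assignment given by a substitution. -/
def env {Γ Θ : Ctx} (hΘ : G.IsCtx Θ) (f : Sub Γ Θ) : Env G.model Γ := fun _ v => cls hΘ (f _ v)

theorem eval_tm {Γ Θ : Ctx} (hΘ : G.IsCtx Θ) (f : Sub Γ Θ) {σ : Ty} (t : Tm Γ σ) :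
    t.eval (env hΘ f) = cls hΘ (t.subst f) := by
  induction t with
  | var v => rfl
  | const c => exact cls_wk isCtx_nil hΘ (nonempty_sfx_nil Θ).some (.const c)
  | app t u iht ihu => exact (congrArg₂ app iht ihu).trans (app_cls hΘ _ _)

theorem st_cls (h : b = true) {Θ : Ctx} (hΘ : G.IsCtx Θ) {σ : Ty} (t : Tm Θ σ) :
    G.model.st (show G.model.D σ from cls hΘ t) ↔ G.Holds (.st h t) := by
  constructor
  · rintro ⟨_, Γ, hΓ, u, htu, hu⟩
    obtain ⟨Ξ, hΞ, ⟨v⟩, ⟨w⟩⟩ := hΘ.joint hΓ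
    refine Holds.of_wk (s := v) ?_
    have htu : cls hΘ t = cls hΓ u := htu
    rw [cls_wk hΘ hΞ v, cls_wk hΓ hΞ w, cls_eq_cls] at htu
    exact (hu.wk hΞ w).mp2 htu
      (.impE (.impE (.ax (G.hst h _ _)) .hyp0) (Prf.eqT_symm G.hAx G.hE .hyp1))
  · exact fun ht => ⟨h, Θ, hΘ, t, rfl, ht⟩

theorem env_cons {Γ Θ Δ : Ctx} (hΘ : G.IsCtx Θ) (hΔ : G.IsCtx Δ) (f : Sub Γ Θ) (s : Sfx Θ Δ)
    {σ : Ty} (t : Tm Δ σ) :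
    Env.cons (show G.model.D σ from cls hΔ t) (env hΘ f) = env hΔ (Sub.cons t (f.comp s.sub)) := by
  funext τ v
  cases v with
  | z => rfl
  | s v => exact cls_wk hΘ hΔ s _

/-- Truth in the term model is derivability from the generic set. -/
theorem eval_iff {Γ : Ctx} (A : Fm b Γ) : ∀ {Θ : Ctx} (hΘ : G.IsCtx Θ) (f : Sub Γ Θ),
    A.eval (env hΘ f) ↔ G.Holds (A.subst f) := by
  induction A with
  | eq t u =>
    intro Θ hΘ f
    simp only [Fm.eval, eval_tm]
    exact cls_eq_cls hΘ
  | st h t =>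
    intro Θ hΘ f
    simp only [Fm.eval, eval_tm]
    exact st_cls h hΘ _
  | bot => exact fun hΘ f => ⟨False.elim, not_holds_bot⟩
  | imp A B ihA ihB =>
    intro Θ hΘ f
    simp only [Fm.eval, Fm.subst, ihA hΘ, ihB hΘ]
    constructor
    · intro h
      by_cases hA : G.Holds (A.subst f)
      · exact (h hA).mp1 (.impI .hyp1)
      · exact ((holds_neg_iff hΘ).2 hA).mp1 (.impI (.exfalso (.impE .hyp1 .hyp0)))
    · exact fun h hA => h.mp2 hA (.impE .hyp0 .hyp1)
  | and A B ihA ihB =>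
    intro Θ hΘ f
    simp only [Fm.eval, Fm.subst, ihA hΘ, ihB hΘ]
    exact ⟨fun h => h.1.mp2 h.2 (.andI .hyp0 .hyp1),
      fun h => ⟨h.mp1 (.andL .hyp0), h.mp1 (.andR .hyp0)⟩⟩
  | or A B ihA ihB =>
    intro Θ hΘ f
    simp only [Fm.eval, Fm.subst, ihA hΘ, ihB hΘ]
    constructor
    · rintro (h | h)
      · exact h.mp1 (.orL .hyp0)
      · exact h.mp1 (.orR .hyp0)
    · intro h
      by_contra! hn
      refine not_holds_bot (holds_of_prf hΘ (H := [Fm.or (A.subst f) (B.subst f),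
        (A.subst f).neg, (B.subst f).neg]) ?_ (A := .bot) ?_)
      · simpa using ⟨h, (holds_neg_iff hΘ).2 hn.1, (holds_neg_iff hΘ).2 hn.2⟩
      · exact .orE .hyp0 (.impE (.hyp (by simp [Fm.neg])) .hyp0)
          (.impE (.hyp (by simp [Fm.neg])) .hyp0)
  | all σ A ih =>
    intro Θ hΘ f
    constructor
    · intro h
      by_contra hn
      -- A counterexample is named by a witness of the existential formula `∃ ¬ A`.
      have hex : G.Holds (.ex σ (A.subst (liftSub σ f)).neg) := by
        refine ((holds_neg_iff hΘ).2 hn).mp1 (.raa (.impE .hyp1 (.allI (.raa ?_))))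
        refine .impE (.hyp (List.mem_cons_of_mem _ List.mem_cons_self)) (.exI v0 ?_)
        have := Fm.lift_wk_inst (A.subst (liftSub σ f)).neg
        unfold Fm.wk Fm.rename at *
        change Prf Ax _ _ (((A.subst (liftSub σ f)).neg.subst (liftSub σ (Sub.wk σ))).inst v0)
        rw [this]
        exact .hyp0
      obtain ⟨Δ, hΔ, s, t, ht⟩ := hex.exists_witness
      have h' := h (cls hΔ t)
      rw [env_cons hΘ hΔ f s, ih] at h'
      refine (holds_neg_iff hΔ).1 ht ?_
      rw [Fm.subst_subst, lift_comp_cons]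
      exact h'
    · intro h d
      obtain ⟨Δ, hΔ, t, rfl⟩ := exists_cls d
      obtain ⟨Ξ, hΞ, ⟨v⟩, ⟨w⟩⟩ := hΘ.joint hΔ
      rw [cls_wk hΔ hΞ w, env_cons hΘ hΞ f v, ih]
      have := (h.wk hΞ v).mp1 (.allE (t.subst w.sub) .hyp0)
      rwa [Fm.subst_subst, lift_comp_lift, Fm.inst_lift] at this
  | ex σ A ih =>
    intro Θ hΘ f
    constructor
    · rintro ⟨d, h⟩
      obtain ⟨Δ, hΔ, t, rfl⟩ := exists_cls d
      obtain ⟨Ξ, hΞ, ⟨v⟩, ⟨w⟩⟩ := hΘ.joint hΔ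
      rw [cls_wk hΔ hΞ w, env_cons hΘ hΞ f v, ih] at h
      refine Holds.of_wk (s := v) (h.mp1 (.exI (t.subst w.sub) ?_))
      rw [Fm.subst_subst, lift_comp_lift, Fm.inst_lift]
      exact .hyp0
    · intro h
      obtain ⟨Δ, hΔ, s, t, ht⟩ := Holds.exists_witness h
      refine ⟨cls hΔ t, ?_⟩
      rw [env_cons hΘ hΔ f s, ih]
      rwa [Fm.subst_subst, lift_comp_cons] at ht

end Generic

/-- A model is extensional if the defined equality at each type is equality of objects. -/
def Model.Extensional (M : Model) : Prop :=
  ∀ {Γ : Ctx} (e : Env M Γ) {σ : Ty} (s t : Tm Γ σ),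
    (Fm.eqT σ s t : Fm false Γ).eval e ↔ s.eval e = t.eval e

/-- The defined equality means the same in the languages with and without `st`. -/
theorem Fm.eval_eqT_bool {M : Model} (b b' : Bool) {σ : Ty} : ∀ {Γ : Ctx} (e : Env M Γ)
    (s t : Tm Γ σ), (Fm.eqT σ s t : Fm b Γ).eval e ↔ (Fm.eqT σ s t : Fm b' Γ).eval e := by
  induction σ with
  | nat => exact fun _ _ _ => Iff.rfl
  | arr ρ τ _ ih => exact fun e s t => forall_congr' fun d => ih _ _ _
  | seq ρ ih =>
    exact fun e s t => and_congr Iff.rfl (forall_congr' fun d => imp_congr Iff.rfl (ih _ _ _))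

/-- Completeness: what is true in all extensional models of the axioms is derivable. A generic set
that contains `¬ A` would give a term model in which `A` fails; that all equalities are identities
there is due to the axiom of extensionality, and for `st` to `hst`. -/
theorem completeness (hAx : SubstClosed Ax) (hE : ∀ {Γ : Ctx} {A : Fm b Γ}, EPRA b Γ A → Ax Γ A)
    (hst : ∀ (h : b = true) {Γ : Ctx} {σ : Ty} (s t : Tm Γ σ),
      Ax Γ (.st h s ⟹ Fm.eqT σ s t ⟹ .st h t))
    {A : Fm b []}
    (h : ∀ M : Model, M.Extensional →
      (∀ {Γ : Ctx} {B : Fm b Γ} (e : Env M Γ), Ax Γ B → B.eval e) → A.eval (Env.nil M)) :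
    Provable Ax A := by
  by_contra hA
  have hc : ¬ Prf Ax [] [A.neg] .bot := fun hc => hA (.raa hc)
  obtain ⟨G, hG⟩ := Generic.exists_of_consistent hAx hE hst ⟨[], [A.neg], hc⟩
  have h0 : G.IsCtx [] := Generic.isCtx_nil
  have hneg : G.Holds A.neg := ⟨_, hG, .refl _, by
    simpa only [Sfx.sub, Fm.subst_id] using Prf.hyp0⟩
  refine (Generic.holds_neg_iff h0).1 hneg ?_
  have hT := h G.model ?_ ?_
  · have he : Env.nil G.model = Generic.env h0 (Sub.id []) := by funext σ v; nomatch v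
    rwa [he, Generic.eval_iff, Fm.subst_id] at hT
  · intro Γ e σ s t
    obtain ⟨Θ, hΘ, f, rfl⟩ := Generic.exists_sub e h0
    change _ ↔ s.eval (Generic.env hΘ f) = t.eval (Generic.env hΘ f)
    rw [Generic.eval_tm, Generic.eval_tm]
    refine (Fm.eval_eqT_bool false b _ _ _).trans ((Generic.eval_iff _ hΘ f).trans ?_)
    rw [Fm.eqT_subst]
    exact (Generic.cls_eq_cls hΘ).symm
  · intro Γ B e hB
    obtain ⟨Θ, hΘ, f, rfl⟩ := Generic.exists_sub e h0
    exact (Generic.eval_iff B hΘ f).2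
      (Generic.holds_of_prf hΘ (H := []) (by simp) (.ax (hAx f hB)))

end Henkin

/-! ### Evaluation of terms and formulas -/

theorem Tm.eval_subst {M : Model} {Γ Δ : Ctx} (e : Env M Δ) (f : Sub Γ Δ) {σ : Ty} (t : Tm Γ σ) :
    (t.subst f).eval e = t.eval (fun σ v => (f σ v).eval e) := by
  induction t with
  | var v => rfl
  | const c => rfl
  | app t u iht ihu => simp only [Tm.subst, Tm.eval, iht, ihu]

@[simp] theorem Tm.eval_wk {M : Model} {Γ : Ctx} (e : Env M Γ) {ρ σ : Ty} (d : M.D ρ)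
    (t : Tm Γ σ) : (t.wk : Tm (ρ :: Γ) σ).eval (e.cons d) = t.eval e := Tm.eval_subst _ _ t

@[simp] theorem Tm.eval_closed {M : Model} {Γ : Ctx} (e : Env M Γ) {σ : Ty} (t : Tm [] σ) :
    (t.closed : Tm Γ σ).eval e = t.eval (Env.nil M) := by
  refine (Tm.eval_subst _ _ t).trans (congrArg (fun e => t.eval e) ?_)
  funext σ v; nomatch v

theorem Fm.eval_subst {M : Model} {b : Bool} {Γ : Ctx} (A : Fm b Γ) :
    ∀ {Δ : Ctx} (e : Env M Δ) (f : Sub Γ Δ),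
      (A.subst f).eval e ↔ A.eval (fun σ v => (f σ v).eval e) := by
  have key : ∀ {Γ Δ : Ctx} {ρ : Ty} (e : Env M Δ) (f : Sub Γ Δ) (d : M.D ρ),
      (fun σ v => (liftSub ρ f σ v).eval (e.cons d)) =
        Env.cons d (fun σ v => (f σ v).eval e) := by
    intro Γ Δ ρ e f d
    funext σ v
    cases v with
    | z => rfl
    | s v => exact Tm.eval_wk e d _
  induction A with
  | eq t u => intro Δ e f; simp only [Fm.subst, Fm.eval, Tm.eval_subst]
  | st h t => intro Δ e f; simp only [Fm.subst, Fm.eval, Tm.eval_subst]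
  | bot => exact fun e f => Iff.rfl
  | imp A B ihA ihB => intro Δ e f; simp only [Fm.subst, Fm.eval, ihA, ihB]
  | and A B ihA ihB => intro Δ e f; simp only [Fm.subst, Fm.eval, ihA, ihB]
  | or A B ihA ihB => intro Δ e f; simp only [Fm.subst, Fm.eval, ihA, ihB]
  | all σ A ih => intro Δ e f; simp only [Fm.subst, Fm.eval, ih, key]
  | ex σ A ih => intro Δ e f; simp only [Fm.subst, Fm.eval, ih, key]

theorem Fm.eval_inst {M : Model} {b : Bool} {Γ : Ctx} {ρ : Ty} (A : Fm b (ρ :: Γ)) (t : Tm Γ ρ)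
    (e : Env M Γ) : (A.inst t).eval e ↔ A.eval (e.cons (t.eval e)) := by
  rw [Fm.inst, Fm.eval_subst]
  refine iff_of_eq (congrArg (fun e => A.eval e) ?_)
  funext σ v; cases v <;> rfl

theorem Fm.eval_ofInt {M : Model} {b : Bool} {Γ : Ctx} (A : Fm false Γ) :
    ∀ (e : Env M Γ), (A.ofInt : Fm b Γ).eval e ↔ A.eval e := by
  induction A with
  | eq t u => exact fun e => Iff.rfl
  | st h t => nomatch h
  | bot => exact fun e => Iff.rfl
  | imp A B ihA ihB => intro e; simp only [Fm.ofInt, Fm.eval, ihA, ihB]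
  | and A B ihA ihB => intro e; simp only [Fm.ofInt, Fm.eval, ihA, ihB]
  | or A B ihA ihB => intro e; simp only [Fm.ofInt, Fm.eval, ihA, ihB]
  | all σ A ih => intro e; simp only [Fm.ofInt, Fm.eval, ih]
  | ex σ A ih => intro e; simp only [Fm.ofInt, Fm.eval, ih]

theorem Fm.IsQF.ofInt {b : Bool} {Γ : Ctx} {A : Fm false Γ} (h : A.IsQF) :
    (A.ofInt : Fm b Γ).IsQF := by
  induction A with
  | eq t u => trivial
  | st h t => exact h.elim
  | bot => trivial
  | imp A B ihA ihB => exact ⟨ihA h.1, ihB h.2⟩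
  | and A B ihA ihB => exact ⟨ihA h.1, ihB h.2⟩
  | or A B ihA ihB => exact ⟨ihA h.1, ihB h.2⟩
  | all σ A ih => exact h.elim
  | ex σ A ih => exact h.elim

/-! ### Models of primitive recursive arithmetic in all finite types -/

/-- The objects of type `0`, the numbers of the model. -/
abbrev Model.N (M : Model) : Type := M.D ty0

/-- The successor of a number of the model. -/
def Model.succN (M : Model) (n : M.N) : M.N := M.app (M.con .succ) n

instance (M : Model) : Zero M.N := ⟨M.con .zero⟩

@[simp] theorem eval_var_z {M : Model} {Γ : Ctx} (e : Env M Γ) {σ : Ty} (d : M.D σ) :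
    (Tm.var .z : Tm (σ :: Γ) σ).eval (e.cons d) = d := rfl

@[simp] theorem eval_var_s {M : Model} {Γ : Ctx} (e : Env M Γ) {σ τ : Ty} (d : M.D σ)
    (v : Var Γ τ) :
    (Tm.var (.s v) : Tm (σ :: Γ) τ).eval (e.cons d) = (Tm.var v : Tm Γ τ).eval e := rfl

@[simp] theorem eval_app {M : Model} {Γ : Ctx} (e : Env M Γ) {σ τ : Ty} (t : Tm Γ (σ ⇒ τ))
    (u : Tm Γ σ) :
    (t ⬝ u).eval e = M.app (t.eval e) (u.eval e) := rfl

@[simp] theorem eval_zero {M : Model} {Γ : Ctx} (e : Env M Γ) : (zero : Tm Γ ty0).eval e = 0 := rfl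

@[simp] theorem eval_succ {M : Model} {Γ : Ctx} (e : Env M Γ) (n : Tm Γ ty0) :
    (succ n).eval e = M.succN (n.eval e) := rfl

instance (M : Model) : One M.N := ⟨M.succN 0⟩

theorem one_eqN {M : Model} : (1 : M.N) = M.succN 0 := rfl

@[simp] theorem eval_one {M : Model} {Γ : Ctx} (e : Env M Γ) : (one : Tm Γ ty0).eval e = 1 := rfl

/-- The axioms of `E-PRA^ω` (without those for sequences), read in a model in which equality is
identity. That the successor is injective is left out, since it follows from the equations of the
predecessor function. -/
class IsPRA (M : Model) : Prop where
  ext {σ τ : Ty} (f g : M.D (σ ⇒ τ)) : (∀ x, M.app f x = M.app g x) → f = g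
  K_eq {σ τ : Ty} (x : M.D σ) (y : M.D τ) : M.app (M.app (M.con (.K σ τ)) x) y = x
  S_eq {ρ σ τ : Ty} (f : M.D (ρ ⇒ σ ⇒ τ)) (g : M.D (ρ ⇒ σ)) (x : M.D ρ) :
    M.app (M.app (M.app (M.con (.S ρ σ τ)) f) g) x = M.app (M.app f x) (M.app g x)
  R_zero (a : M.N) (f : M.D (ty0 ⇒ ty0 ⇒ ty0)) : M.app (M.app (M.app (M.con .R) 0) a) f = a
  R_succ (n a : M.N) (f : M.D (ty0 ⇒ ty0 ⇒ ty0)) :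
    M.app (M.app (M.app (M.con .R) (M.succN n)) a) f =
      M.app (M.app f (M.app (M.app (M.app (M.con .R) n) a) f)) n
  succ_ne (n : M.N) : M.succN n ≠ 0
  qf_ind {Γ : Ctx} (e : Env M Γ) (A : Fm false (ty0 :: Γ)) : A.IsQF → A.eval (e.cons 0) →
    (∀ n, A.eval (e.cons n) → A.eval (e.cons (M.succN n))) → ∀ n, A.eval (e.cons n)

/-- The extensional models of the axioms satisfy `IsPRA`. -/
theorem isPRA_of_EPRA {M : Model} (hM : M.Extensional) {b : Bool}
    (h : ∀ {Γ : Ctx} {B : Fm b Γ} (e : Env M Γ), EPRA b Γ B → B.eval e) : IsPRA M := by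
  have hM' : ∀ {Γ : Ctx} (e : Env M Γ) {σ : Ty} (s t : Tm Γ σ),
      (Fm.eqT σ s t : Fm b Γ).eval e ↔ s.eval e = t.eval e :=
    fun e σ s t => (Fm.eval_eqT_bool b false e s t).trans (hM e s t)
  refine ⟨?_, ?_, ?_, ?_, ?_, ?_, ?_⟩
  · intro σ τ f g hfg
    refine (hM (((Env.nil M).cons f).cons g) (σ := σ ⇒ τ) v1 v0).1 fun d => ?_
    exact (hM _ _ _).2 (hfg d)
  · intro σ τ x y
    exact (hM' (((Env.nil M).cons x).cons y) _ _).1 (h _ (.combK v1 v0))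
  · intro ρ σ τ f g x
    exact (hM' ((((Env.nil M).cons f).cons g).cons x) _ _).1 (h _ (.combS v2 v1 v0))
  · intro a f
    exact h (((Env.nil M).cons a).cons f) (.rec_zero v1 v0)
  · intro n a f
    exact h ((((Env.nil M).cons n).cons a).cons f) (.rec_succ v2 v1 v0)
  · intro n
    exact h ((Env.nil M).cons n) (.succ_ne v0)
  · intro Γ e A hA h0 hs n
    have := h e (.qf_ind A.ofInt hA.ofInt)
    refine (Fm.eval_ofInt A _).1 (this ?_ ?_ n)
    · rw [Fm.eval_inst]
      exact (Fm.eval_ofInt A _).2 h0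
    · intro k hk
      rw [Fm.eval_subst]
      have := (Fm.eval_ofInt (b := b) A _).2 (hs k ((Fm.eval_ofInt A _).1 hk))
      convert this using 1
      funext σ v; cases v <;> rfl

section Interpretation
variable {M : Model} [IsPRA M]

@[simp] theorem app_lam {Γ : Ctx} (e : Env M Γ) {ρ σ : Ty} (t : Tm (ρ :: Γ) σ) (d : M.D ρ) :
    M.app ((lam t).eval e) d = t.eval (e.cons d) := by
  induction t with
  | var v =>
    cases v with
    | z => exact (IsPRA.S_eq _ _ _).trans (IsPRA.K_eq _ _)
    | s v => exact IsPRA.K_eq _ _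
  | const c => exact IsPRA.K_eq _ _
  | app t u iht ihu => exact (IsPRA.S_eq _ _ _).trans (congrArg₂ M.app iht ihu)

/-- Recursion of type `0` in a model, for a step function that is given by an object of the model
(for any other step function the value is `a`); `step v k` is the value at stage `k + 1` if `v` is
the value at stage `k`. -/
noncomputable def Model.recN (M : Model) (n a : M.N) (step : M.N → M.N → M.N) : M.N :=
  open Classical in
  if h : ∃ G : M.D (ty0 ⇒ ty0 ⇒ ty0), ∀ v k, M.app (M.app G v) k = step v k then
    M.app (M.app (M.app (M.con .R) n) a) h.choose else a

theorem recN_eq {n a : M.N} {step : M.N → M.N → M.N} (G : M.D (ty0 ⇒ ty0 ⇒ ty0))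
    (hG : ∀ v k, M.app (M.app G v) k = step v k) :
    M.recN n a step = M.app (M.app (M.app (M.con .R) n) a) G := by
  have h : ∃ G : M.D (ty0 ⇒ ty0 ⇒ ty0), ∀ v k, M.app (M.app G v) k = step v k := ⟨G, hG⟩
  rw [Model.recN, dif_pos h]
  congr 1
  exact IsPRA.ext _ _ fun v => IsPRA.ext _ _ fun k => (h.choose_spec v k).trans (hG v k).symm

@[simp] theorem eval_recTm {Γ : Ctx} (e : Env M Γ) (n a : Tm Γ ty0)
    (step : Tm (ty0 :: ty0 :: Γ) ty0) : (recTm n a step).eval e =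
      M.recN (n.eval e) (a.eval e) (fun v k => step.eval ((e.cons v).cons k)) :=
  (recN_eq ((lam (lam step)).eval e) (fun v k => by simp)).symm

/-- Recursion equations for a step function that is the value of a term. -/
theorem recN_zero {Γ : Ctx} (e : Env M Γ) (step : Tm (ty0 :: ty0 :: Γ) ty0)
    {f : M.N → M.N → M.N} (hf : ∀ v k, step.eval ((e.cons v).cons k) = f v k) (a : M.N) :
    M.recN 0 a f = a := by
  rw [recN_eq ((lam (lam step)).eval e) (fun v k => by simpa using hf v k), IsPRA.R_zero]

theorem recN_succ {Γ : Ctx} (e : Env M Γ) (step : Tm (ty0 :: ty0 :: Γ) ty0)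
    {f : M.N → M.N → M.N} (hf : ∀ v k, step.eval ((e.cons v).cons k) = f v k) (n a : M.N) :
    M.recN (M.succN n) a f = f (M.recN n a f) n := by
  have h := recN_eq (n := n) (a := a) ((lam (lam step)).eval e)
    (fun v k => by simpa using hf v k)
  rw [recN_eq ((lam (lam step)).eval e) (fun v k => by simpa using hf v k), IsPRA.R_succ, ← h]
  simpa using hf _ _

/-! ### Functions given by objects of the model -/

/-- The function `f` is represented by an object of the model. -/
@[fun_prop]
def Dfn {M : Model} {ρ σ : Ty} (f : M.D ρ → M.D σ) : Prop :=
  ∃ F : M.D (ρ ⇒ σ), ∀ x, M.app F x = f x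

theorem Dfn.ofTm {Γ : Ctx} (e : Env M Γ) {ρ σ : Ty} (t : Tm (ρ :: Γ) σ) :
    Dfn (fun x => t.eval (e.cons x)) := ⟨(lam t).eval e, app_lam e t⟩

@[fun_prop]
theorem Dfn.const {ρ σ : Ty} (c : M.D σ) : Dfn (fun _ : M.D ρ => c) :=
  ⟨M.app (M.con (.K _ _)) c, fun x => IsPRA.K_eq c x⟩

@[fun_prop]
theorem Dfn.id {ρ : Ty} : Dfn (fun x : M.D ρ => x) := Dfn.ofTm (Env.nil M) v0

@[fun_prop]
theorem Dfn.app {ρ σ τ : Ty} {f : M.D ρ → M.D (σ ⇒ τ)} {g : M.D ρ → M.D σ} (hf : Dfn f)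
    (hg : Dfn g) : Dfn (fun x => M.app (f x) (g x)) := by
  obtain ⟨F, hF⟩ := hf
  obtain ⟨G, hG⟩ := hg
  exact ⟨M.app (M.app (M.con (.S _ _ _)) F) G, fun x => by rw [IsPRA.S_eq, hF, hG]⟩

@[fun_prop]
theorem Dfn.comp {ρ σ τ : Ty} {f : M.D σ → M.D τ} {g : M.D ρ → M.D σ} (hf : Dfn f)
    (hg : Dfn g) : Dfn (fun x => f (g x)) := by
  obtain ⟨F, hF⟩ := hf
  simpa only [hF] using (Dfn.const F).app hg

/-- A binary operation that is the value of a term preserves represented functions. -/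
theorem Dfn.ofTm₂ {ρ σ τ κ : Ty} {op : M.D σ → M.D τ → M.D κ} (t : Tm [τ, σ] κ)
    (ht : ∀ a b, t.eval (((Env.nil M).cons a).cons b) = op a b) {f : M.D ρ → M.D σ}
    {g : M.D ρ → M.D τ} (hf : Dfn f) (hg : Dfn g) : Dfn (fun x => op (f x) (g x)) := by
  have : ∀ a b, op a b = M.app (M.app ((lam (lam t)).eval (Env.nil M)) a) b := by
    intro a b; simp [ht]
  simp only [this]
  exact ((Dfn.const _).app hf).app hg

/-- Induction for equations between represented functions. -/
theorem eq_induction {f g : M.N → M.N} (hf : Dfn f) (hg : Dfn g) (h0 : f 0 = g 0)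
    (hs : ∀ n, f n = g n → f (M.succN n) = g (M.succN n)) (n : M.N) : f n = g n := by
  obtain ⟨F, hF⟩ := hf
  obtain ⟨G, hG⟩ := hg
  have := IsPRA.qf_ind (((Env.nil M).cons F).cons G) (.eq (v2 ⬝ v0) (v1 ⬝ v0)) trivial
    ((hF 0).trans (h0.trans (hG 0).symm))
    (fun n hn => (hF _).trans ((hs n ((hF n).symm.trans (hn.trans (hG n)))).trans (hG _).symm)) n
  exact (hF n).symm.trans (this.trans (hG n))

/-- Induction for properties given by quantifier-free formulas. -/
theorem formula_induction {Γ : Ctx} (e : Env M Γ) (A : Fm false (ty0 :: Γ)) (hA : A.IsQF)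
    {P : M.N → Prop} (hP : ∀ n, A.eval (e.cons n) ↔ P n) (h0 : P 0)
    (hs : ∀ n, P n → P (M.succN n)) (n : M.N) : P n := by
  simp only [← hP] at *
  exact IsPRA.qf_ind e A hA h0 hs n

/-! ### Arithmetic -/

section Arithmetic
open Model

@[fun_prop]
theorem Dfn.succN {ρ : Ty} {f : M.D ρ → M.N} (hf : Dfn f) : Dfn (fun x => M.succN (f x)) :=
  (Dfn.const (M.con .succ)).app hf

noncomputable instance : Add M.N := ⟨fun a b => M.recN b a (fun v _ => M.succN v)⟩

noncomputable instance : Mul M.N := ⟨fun a b => M.recN b 0 (fun v _ => v + a)⟩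

/-- The value of the term `pred`. -/
noncomputable def Model.predN (M : Model) [IsPRA M] (a : M.N) : M.N := M.recN a 0 (fun _ k => k)

/-- The value of the term `sub`. -/
noncomputable def Model.subN (M : Model) [IsPRA M] (a b : M.N) : M.N :=
  M.recN b a (fun v _ => M.predN v)

@[simp] theorem eval_add {Γ : Ctx} (e : Env M Γ) (a b : Tm Γ ty0) :
    (add a b).eval e = a.eval e + b.eval e := by simp only [add, eval_recTm]; rfl

@[simp] theorem eval_mul {Γ : Ctx} (e : Env M Γ) (a b : Tm Γ ty0) :
    (mul a b).eval e = a.eval e * b.eval e := by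
  simp only [mul, eval_recTm, eval_add, Tm.eval_wk]; rfl

@[simp] theorem eval_pred {Γ : Ctx} (e : Env M Γ) (a : Tm Γ ty0) :
    (pred a).eval e = M.predN (a.eval e) := by simp only [pred, eval_recTm]; rfl

@[simp] theorem eval_sub {Γ : Ctx} (e : Env M Γ) (a b : Tm Γ ty0) :
    (sub a b).eval e = M.subN (a.eval e) (b.eval e) := by
  simp only [sub, eval_recTm, eval_pred]; rfl

@[fun_prop]
theorem Dfn.add {ρ : Ty} {f g : M.D ρ → M.N} (hf : Dfn f) (hg : Dfn g) :
    Dfn (fun x => f x + g x) := Dfn.ofTm₂ (HigherRM.add v1 v0) (by simp) hf hg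

@[fun_prop]
theorem Dfn.mul {ρ : Ty} {f g : M.D ρ → M.N} (hf : Dfn f) (hg : Dfn g) :
    Dfn (fun x => f x * g x) := Dfn.ofTm₂ (HigherRM.mul v1 v0) (by simp) hf hg

@[fun_prop]
theorem Dfn.subN {ρ : Ty} {f g : M.D ρ → M.N} (hf : Dfn f) (hg : Dfn g) :
    Dfn (fun x => M.subN (f x) (g x)) := Dfn.ofTm₂ (sub v1 v0) (by simp) hf hg

theorem add_zeroN (a : M.N) : a + 0 = a := recN_zero (Env.nil M) (succ v1) (fun _ _ => rfl) a

theorem add_succN (a b : M.N) : a + M.succN b = M.succN (a + b) :=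
  recN_succ (Env.nil M) (succ v1) (fun _ _ => rfl) b a

theorem predN_zero : M.predN 0 = 0 := recN_zero (Env.nil M) v0 (fun _ _ => rfl) 0

@[simp] theorem predN_succ (a : M.N) : M.predN (M.succN a) = a :=
  recN_succ (Env.nil M) v0 (fun _ _ => rfl) a 0

theorem subN_zero (a : M.N) : M.subN a 0 = a :=
  recN_zero (Env.nil M) (pred v1) (fun _ _ => by simp) a

theorem subN_succ (a b : M.N) : M.subN a (M.succN b) = M.predN (M.subN a b) :=
  recN_succ (Env.nil M) (pred v1) (fun _ _ => by simp) b a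

theorem mul_zeroN (a : M.N) : a * 0 = 0 :=
  recN_zero ((Env.nil M).cons a) (add v1 v2) (fun _ _ => by simp) 0

theorem mul_succN (a b : M.N) : a * M.succN b = a * b + a :=
  recN_succ ((Env.nil M).cons a) (add v1 v2) (fun _ _ => by simp) b 0

theorem zero_addN (a : M.N) : 0 + a = a := by
  refine eq_induction (f := fun a => 0 + a) (g := fun a => a) (by fun_prop) (by fun_prop)
    (add_zeroN 0) (fun n hn => ?_) a
  rw [add_succN, hn]

theorem succ_addN (a b : M.N) : M.succN a + b = M.succN (a + b) := by
  refine eq_induction (f := fun b => M.succN a + b) (g := fun b => M.succN (a + b)) (by fun_prop)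
    (by fun_prop) (by simp only [add_zeroN]) (fun n hn => ?_) b
  rw [add_succN, hn, add_succN]

theorem add_commN (a b : M.N) : a + b = b + a := by
  refine eq_induction (f := fun b => a + b) (g := fun b => b + a) (by fun_prop)
    (by fun_prop) (by simp only [add_zeroN, zero_addN]) (fun n hn => ?_) b
  rw [add_succN, hn, succ_addN]

theorem add_assocN (a b c : M.N) : a + b + c = a + (b + c) := by
  refine eq_induction (f := fun c => a + b + c) (g := fun c => a + (b + c)) (by fun_prop)
    (by fun_prop) (by simp only [add_zeroN]) (fun n hn => ?_) c
  rw [add_succN, hn, add_succN, add_succN]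

noncomputable instance : AddCommMonoid M.N where
  add_assoc := add_assocN
  zero_add := zero_addN
  add_zero := add_zeroN
  add_comm := add_commN
  nsmul := nsmulRec

theorem zero_mulN (a : M.N) : 0 * a = 0 := by
  refine eq_induction (f := fun a => 0 * a) (g := fun _ => 0) (by fun_prop) (by fun_prop)
    (mul_zeroN 0) (fun n hn => ?_) a
  rw [mul_succN, hn, add_zero]

theorem succ_mulN (a b : M.N) : M.succN a * b = a * b + b := by
  refine eq_induction (f := fun b => M.succN a * b) (g := fun b => a * b + b) (by fun_prop)
    (by fun_prop) (by simp only [mul_zeroN, add_zero]) (fun n hn => ?_) b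
  rw [mul_succN, hn, mul_succN, add_succN, add_succN, add_right_comm]

theorem mul_commN (a b : M.N) : a * b = b * a := by
  refine eq_induction (f := fun b => a * b) (g := fun b => b * a) (by fun_prop)
    (by fun_prop) (by simp only [mul_zeroN, zero_mulN]) (fun n hn => ?_) b
  rw [mul_succN, hn, succ_mulN]

theorem mul_addN (a b c : M.N) : a * (b + c) = a * b + a * c := by
  refine eq_induction (f := fun c => a * (b + c)) (g := fun c => a * b + a * c) (by fun_prop)
    (by fun_prop) (by simp only [mul_zeroN, add_zero]) (fun n hn => ?_) c
  rw [add_succN, mul_succN, hn, mul_succN, add_assoc]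

theorem mul_assocN (a b c : M.N) : a * b * c = a * (b * c) := by
  refine eq_induction (f := fun c => a * b * c) (g := fun c => a * (b * c)) (by fun_prop)
    (by fun_prop) (by simp only [mul_zeroN]) (fun n hn => ?_) c
  rw [mul_succN, hn, mul_succN, mul_addN]

theorem mul_oneN (a : M.N) : a * 1 = a := by rw [one_eqN, mul_succN, mul_zeroN, zero_add]

noncomputable instance : CommSemiring M.N where
  left_distrib := mul_addN
  right_distrib a b c := by rw [mul_commN, mul_addN, mul_commN c a, mul_commN c b]
  zero_mul := zero_mulN
  mul_zero := mul_zeroN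
  mul_assoc := mul_assocN
  one_mul a := by rw [mul_commN, mul_oneN]
  mul_one := mul_oneN
  mul_comm := mul_commN

theorem succN_eq (a : M.N) : M.succN a = a + 1 := by
  rw [one_eqN, add_succN, add_zero]

theorem add_one_ne_zeroN (a : M.N) : a + 1 ≠ 0 := succN_eq a ▸ IsPRA.succ_ne a

/-- Every number is zero or a successor. -/
theorem zero_or_succ (n : M.N) : n = 0 ∨ n = M.predN n + 1 := by
  refine formula_induction (Env.nil M) (.or (.eq v0 zero) (.eq v0 (succ (pred v0))))
    ⟨trivial, trivial⟩ (P := fun n => n = 0 ∨ n = M.predN n + 1)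
    (fun n => by simp [Fm.eval, succN_eq]) (Or.inl rfl) (fun n _ => Or.inr ?_) n
  rw [predN_succ, succN_eq]

theorem subN_succ_succ (a b : M.N) : M.subN (a + 1) (b + 1) = M.subN a b := by
  simp only [← succN_eq]
  refine eq_induction (f := fun b => M.subN (M.succN a) (M.succN b)) (g := fun b => M.subN a b)
    (by fun_prop) (by fun_prop) ?_ (fun n hn => ?_) b
  · rw [subN_succ, subN_zero, predN_succ, subN_zero]
  · rw [subN_succ, hn, subN_succ]

theorem add_subN (a b : M.N) : M.subN (b + a) b = a := by
  refine eq_induction (f := fun b => M.subN (b + a) b) (g := fun _ => a) (by fun_prop)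
    (by fun_prop) (by simp only [subN_zero, zero_add]) (fun n hn => ?_) b
  rw [succN_eq, add_right_comm, subN_succ_succ, hn]

theorem subN_add (a b : M.N) : M.subN a (a + b) = 0 := by
  refine eq_induction (f := fun b => M.subN a (a + b)) (g := fun _ => 0) (by fun_prop)
    (by fun_prop) ?_ (fun n hn => ?_) b
  · simpa only [add_zero] using add_subN 0 a
  · rw [add_succN, subN_succ, hn, predN_zero]

instance : IsRightCancelAdd M.N where
  add_right_cancel c a b h := by
    have h' : a + c = b + c := h
    rw [← add_subN a c, add_comm, h', add_comm, add_subN]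

instance : IsCancelAdd M.N := AddCommMagma.IsRightCancelAdd.toIsCancelAdd M.N

/-- Any two numbers are comparable. -/
theorem totalN (a b : M.N) : a = b + M.subN a b ∨ b = a + M.subN b a := by
  refine formula_induction ((Env.nil M).cons a)
    (.or (.eq v1 (add v0 (sub v1 v0))) (.eq v0 (add v1 (sub v0 v1)))) ⟨trivial, trivial⟩
    (P := fun b => a = b + M.subN a b ∨ b = a + M.subN b a) (fun n => by simp [Fm.eval])
    (Or.inl ?_) (fun n hn => ?_) b
  · rw [subN_zero, zero_add]
  · rw [succN_eq]
    rcases hn with h | h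
    · rcases zero_or_succ (M.subN a n) with h0 | h0
      · rw [h0, add_zero] at h
        subst h
        exact Or.inr (by rw [add_subN])
      · left
        have : a = n + 1 + M.predN (M.subN a n) := by
          conv_lhs => rw [h, h0]
          rw [add_right_comm, add_assoc]
        conv_rhs => rw [this, add_subN]
        exact this
    · right
      have : n + 1 = a + (M.subN n a + 1) := by rw [← add_assoc, ← h]
      conv_rhs => rw [this, add_subN]
      exact this

theorem add_eq_zeroN {a b : M.N} (h : a + b = 0) : a = 0 := by
  rcases zero_or_succ a with ha | ha
  · exact ha
  · rw [ha, add_right_comm] at h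
    exact (add_one_ne_zeroN _ h).elim

instance : NoZeroDivisors M.N where
  eq_zero_or_eq_zero_of_mul_eq_zero {a b} h := by
    rcases zero_or_succ a with ha | ha
    · exact Or.inl ha
    rcases zero_or_succ b with hb | hb
    · exact Or.inr hb
    rw [ha, hb, mul_add, mul_one, ← add_assoc] at h
    exact (add_one_ne_zeroN _ h).elim

instance : Nontrivial M.N := ⟨0, 1, fun h => add_one_ne_zeroN (M := M) 0 (by rw [zero_add, ← h])⟩

end Arithmetic

end Interpretation

/-! ### Ordered fields over semirings of numbers -/

/-- An ordered field with a cofinal embedding of the semiring `N` into its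
non-negative elements. -/
structure FieldOver (N : Type) [CommSemiring N] where
  K : Type
  [field : Field K]
  [linearOrder : LinearOrder K]
  [isStrictOrderedRing : IsStrictOrderedRing K]
  ι : N →+* K
  injective : Function.Injective ι
  nonneg : ∀ a, 0 ≤ ι a
  exists_ge : ∀ x, ∃ a, x ≤ ι a

section Completion
variable (N : Type) [CommSemiring N] [IsCancelAdd N]

/-- Pairs of numbers, read as formal differences. -/
def diffSetoid : Setoid (N × N) where
  r x y := x.1 + y.2 = y.1 + x.2
  iseqv := by
    refine ⟨fun x => rfl, fun h => h.symm, fun {x y z} h h' => ?_⟩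
    refine add_right_cancel (b := y.2) ?_
    calc x.1 + z.2 + y.2 = (x.1 + y.2) + z.2 := by ring
      _ = (y.1 + z.2) + x.2 := by rw [h]; ring
      _ = z.1 + x.2 + y.2 := by rw [h']; ring

/-- The ring of differences of elements of `N`. -/
def Diff : Type := Quotient (diffSetoid N)

namespace Diff
variable {N}

/-- The formal difference of two elements. -/
def mk (a b : N) : Diff N := Quotient.mk (diffSetoid N) (a, b)

theorem mk_eq {a b c d : N} : mk a b = mk c d ↔ a + d = c + b := Quotient.eq (r := diffSetoid N)

theorem ind {p : Diff N → Prop} (h : ∀ a b, p (mk a b)) (x : Diff N) : p x :=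
  Quotient.inductionOn x fun _ => h _ _

instance : Zero (Diff N) := ⟨mk 0 0⟩
instance : One (Diff N) := ⟨mk 1 0⟩
instance : Neg (Diff N) := ⟨Quotient.lift (fun x => mk x.2 x.1) fun x y h =>
  mk_eq.2 (by have h : x.1 + y.2 = y.1 + x.2 := h; rw [add_comm, ← h, add_comm])⟩
instance : Add (Diff N) := ⟨Quotient.lift₂ (fun x y => mk (x.1 + y.1) (x.2 + y.2))
  fun x y x' y' h h' => mk_eq.2 (by
    have h : x.1 + x'.2 = x'.1 + x.2 := h
    have h' : y.1 + y'.2 = y'.1 + y.2 := h'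
    rw [add_add_add_comm, h, h', add_add_add_comm])⟩
instance : Mul (Diff N) := ⟨Quotient.lift₂
  (fun x y => mk (x.1 * y.1 + x.2 * y.2) (x.1 * y.2 + x.2 * y.1))
  fun x y x' y' h h' => mk_eq.2 (by
    have h : x.1 + x'.2 = x'.1 + x.2 := h
    have h' : y.1 + y'.2 = y'.1 + y.2 := h'
    refine add_right_cancel (b := x'.1 * y.2 + x'.2 * y.1 + x'.1 * y.1 + x'.2 * y.2) ?_
    calc _ = (x.1 + x'.2) * y.1 + (x'.1 + x.2) * y.2 + x'.1 * (y.1 + y'.2) + x'.2 * (y'.1 + y.2)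
          := by ring
      _ = (x'.1 + x.2) * y.1 + (x.1 + x'.2) * y.2 + x'.1 * (y'.1 + y.2) + x'.2 * (y.1 + y'.2) := by
          rw [h, h']
      _ = _ := by ring)⟩

theorem add_mk (a b c d : N) : mk a b + mk c d = mk (a + c) (b + d) := rfl
theorem mul_mk (a b c d : N) : mk a b * mk c d = mk (a * c + b * d) (a * d + b * c) := rfl
theorem neg_mk (a b : N) : -mk a b = mk b a := rfl
theorem zero_eq : (0 : Diff N) = mk 0 0 := rfl
theorem one_eq : (1 : Diff N) = mk 1 0 := rfl

instance : CommRing (Diff N) where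
  add_assoc x y z := by
    induction x using ind; induction y using ind; induction z using ind
    simp only [add_mk, mk_eq]; ring
  zero_add x := by induction x using ind; simp only [add_mk, zero_eq, mk_eq]; ring
  add_zero x := by induction x using ind; simp only [add_mk, zero_eq, mk_eq]; ring
  add_comm x y := by
    induction x using ind; induction y using ind
    simp only [add_mk, mk_eq]; ring
  neg_add_cancel x := by induction x using ind; simp only [add_mk, zero_eq, neg_mk, mk_eq]; ring
  left_distrib x y z := by
    induction x using ind; induction y using ind; induction z using ind
    simp only [add_mk, mul_mk, mk_eq]; ring
  right_distrib x y z := by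
    induction x using ind; induction y using ind; induction z using ind
    simp only [add_mk, mul_mk, mk_eq]; ring
  zero_mul x := by induction x using ind; simp only [mul_mk, zero_eq, mk_eq]; ring
  mul_zero x := by induction x using ind; simp only [mul_mk, zero_eq, mk_eq]; ring
  mul_assoc x y z := by
    induction x using ind; induction y using ind; induction z using ind
    simp only [mul_mk, mk_eq]; ring
  one_mul x := by induction x using ind; simp only [mul_mk, one_eq, mk_eq]; ring
  mul_one x := by induction x using ind; simp only [mul_mk, one_eq, mk_eq]; ring
  mul_comm x y := by
    induction x using ind; induction y using ind
    simp only [mul_mk, mk_eq]; ring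
  nsmul := nsmulRec
  zsmul := zsmulRec

/-- The embedding of `N` into its ring of differences. -/
def of : N →+* Diff N where
  toFun a := mk a 0
  map_zero' := rfl
  map_one' := rfl
  map_add' a b := by simp only [add_mk, mk_eq]; ring
  map_mul' a b := by simp only [mul_mk, mk_eq]; ring

theorem of_injective : Function.Injective (of (N := N)) := fun a b h => by
  simpa using (mk_eq (a := a) (b := 0) (c := b) (d := 0)).1 h

theorem exists_of_or_neg (total : ∀ a b : N, ∃ c, a = b + c ∨ b = a + c) (x : Diff N) :
    ∃ c, x = of c ∨ x = -of c := by
  induction x using ind with | h a b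
  obtain ⟨c, h | h⟩ := total a b
  · exact ⟨c, Or.inl (mk_eq.2 (by rw [h]; ring))⟩
  · exact ⟨c, Or.inr (mk_eq.2 (by rw [h]; ring))⟩

end Diff

variable {N} in
/-- A cancellative semiring without zero divisors whose elements are comparable, and in which
`a + b = 0` only for `a = 0` and all `d ≠ 0` are of the form `c + 1`, is contained in an ordered
field. -/
theorem nonempty_fieldOver [NoZeroDivisors N] [Nontrivial N]
    (total : ∀ a b : N, ∃ c, a = b + c ∨ b = a + c) (pos : ∀ a b : N, a + b = 0 → a = 0)
    (discrete : ∀ d : N, d ≠ 0 → ∃ c, d = c + 1) :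
    Nonempty (FieldOver N) := by
  have : Nontrivial (Diff N) := Diff.of_injective.nontrivial
  have : NoZeroDivisors (Diff N) := ⟨fun {x y} h => by
    obtain ⟨a, ha⟩ := Diff.exists_of_or_neg total x
    obtain ⟨b, hb⟩ := Diff.exists_of_or_neg total y
    have h0 : Diff.of (a * b) = 0 := by
      rcases ha with rfl | rfl <;> rcases hb with rfl | rfl <;> simpa using h
    rw [map_eq_zero_iff _ Diff.of_injective, mul_eq_zero] at h0
    rcases h0 with rfl | rfl
    · exact Or.inl (by simpa using ha)
    · exact Or.inr (by simpa using hb)⟩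
  have : IsDomain (Diff N) := NoZeroDivisors.to_isDomain _
  let K := FractionRing (Diff N)
  let ι : N →+* K := (algebraMap (Diff N) K).comp Diff.of
  have hι : Function.Injective ι := (IsFractionRing.injective (Diff N) K).comp Diff.of_injective
  -- The non-negative elements are the fractions of numbers.
  let C : RingCone K :=
    { carrier := {x | ∃ a d : N, d ≠ 0 ∧ x * ι d = ι a}
      zero_mem' := ⟨0, 1, one_ne_zero, by simp⟩
      one_mem' := ⟨1, 1, one_ne_zero, by simp⟩
      add_mem' := by
        rintro x y ⟨a, d, hd, h⟩ ⟨a', d', hd', h'⟩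
        refine ⟨a * d' + a' * d, d * d', mul_ne_zero hd hd', ?_⟩
        simp only [map_add, map_mul, ← h, ← h']
        ring
      mul_mem' := by
        rintro x y ⟨a, d, hd, h⟩ ⟨a', d', hd', h'⟩
        refine ⟨a * a', d * d', mul_ne_zero hd hd', ?_⟩
        simp only [map_mul, ← h, ← h']
        ring
      eq_zero_of_mem_of_neg_mem' := by
        rintro x ⟨a, d, hd, h⟩ ⟨a', d', hd', h'⟩
        have h0 : ι (a * d' + a' * d) = 0 := by
          simp only [map_add, map_mul, ← h, ← h']
          ring
        rw [map_eq_zero_iff _ hι] at h0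
        have h1 := pos _ _ h0
        rw [mul_eq_zero, or_iff_left hd'] at h1
        rw [h1, map_zero, mul_eq_zero, or_iff_left ((map_ne_zero_iff _ hι).2 hd)] at h
        exact h }
  have htot : HasMemOrNegMem C := ⟨fun x => by
    obtain ⟨u, v, hv, rfl⟩ := IsFractionRing.div_surjective (A := Diff N) x
    have hv0 : v ≠ 0 := nonZeroDivisors.ne_zero hv
    obtain ⟨a, ha⟩ := Diff.exists_of_or_neg total u
    obtain ⟨d, hd⟩ := Diff.exists_of_or_neg total v
    have hd0 : d ≠ 0 := by rintro rfl; exact hv0 (by simpa using hd)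
    have hdK : ι d ≠ 0 := (map_ne_zero_iff _ hι).2 hd0
    have hu : algebraMap (Diff N) K u = ι a ∨ algebraMap (Diff N) K u = -ι a := by
      rcases ha with rfl | rfl
      · exact Or.inl rfl
      · exact Or.inr (map_neg _ _)
    have hv : algebraMap (Diff N) K v = ι d ∨ algebraMap (Diff N) K v = -ι d := by
      rcases hd with rfl | rfl
      · exact Or.inl rfl
      · exact Or.inr (map_neg _ _)
    have key : algebraMap (Diff N) K u / algebraMap (Diff N) K v * ι d = ι a ∨
        -(algebraMap (Diff N) K u / algebraMap (Diff N) K v) * ι d = ι a := by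
      have hc : ι a / ι d * ι d = ι a := div_mul_cancel₀ _ hdK
      rcases hu with hu | hu <;> rcases hv with hv | hv <;> rw [hu, hv]
      · exact Or.inl hc
      · exact Or.inr (by rw [div_neg, neg_neg, hc])
      · exact Or.inr (by rw [neg_div, neg_neg, hc])
      · exact Or.inl (by rw [neg_div_neg_eq, hc])
    exact key.imp (fun h => ⟨a, d, hd0, h⟩) (fun h => ⟨a, d, hd0, h⟩)⟩
  classical
  let _ : LinearOrder K := LinearOrder.mkOfAddGroupCone C
  have : IsOrderedRing K := IsOrderedRing.mkOfCone C
  have : IsStrictOrderedRing K := IsOrderedRing.toIsStrictOrderedRing K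
  have hnn : ∀ a, 0 ≤ ι a := fun a => by
    change ι a - 0 ∈ C
    exact ⟨a, 1, one_ne_zero, by simp⟩
  refine ⟨⟨K, ι, hι, hnn, fun x => ?_⟩⟩
  rcases le_total x 0 with hx | hx
  · exact ⟨0, hx.trans (hnn 0)⟩
  · have hx' : x - 0 ∈ C := hx
    rw [sub_zero] at hx'
    obtain ⟨a, d, hd, h⟩ := hx'
    obtain ⟨c, rfl⟩ := discrete d hd
    refine ⟨a, ?_⟩
    rw [← h, map_add, map_one]
    nlinarith [hnn c]

end Completion

/-! ### The ordered field of a model -/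

section Arithmetic
open Model
variable {M : Model} [IsPRA M]

theorem nonempty_fieldOver_N (M : Model) [IsPRA M] : Nonempty (FieldOver M.N) :=
  nonempty_fieldOver
    (fun a b => (totalN a b).elim (fun h => ⟨_, Or.inl h⟩) (fun h => ⟨_, Or.inr h⟩))
    (fun _ _ => add_eq_zeroN) (fun d hd => ⟨_, (zero_or_succ d).resolve_left hd⟩)

/-- An ordered field over the numbers of the model. -/
noncomputable def Model.fld (M : Model) [IsPRA M] : FieldOver M.N := (nonempty_fieldOver_N M).some

/-- The rationals of the model. -/
abbrev Model.Q (M : Model) [IsPRA M] : Type := M.fld.K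

noncomputable instance : Field M.Q := M.fld.field
noncomputable instance : LinearOrder M.Q := M.fld.linearOrder
instance : IsStrictOrderedRing M.Q := M.fld.isStrictOrderedRing

/-- The embedding of the numbers of the model into its rationals. -/
noncomputable def Model.ι (M : Model) [IsPRA M] : M.N →+* M.Q := M.fld.ι

theorem ι_injective : Function.Injective M.ι := M.fld.injective

@[simp] theorem ι_nonneg (a : M.N) : 0 ≤ M.ι a := M.fld.nonneg a

@[simp] theorem ι_inj {a b : M.N} : M.ι a = M.ι b ↔ a = b := ι_injective.eq_iff

noncomputable instance : LinearOrder M.N := LinearOrder.lift' M.ι ι_injective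

@[simp] theorem ι_le {a b : M.N} : M.ι a ≤ M.ι b ↔ a ≤ b := Iff.rfl

@[simp] theorem ι_lt {a b : M.N} : M.ι a < M.ι b ↔ a < b := Iff.rfl

theorem zero_leN (a : M.N) : 0 ≤ a := by rw [← ι_le, map_zero]; exact ι_nonneg a

theorem leN_iff_exists {a b : M.N} : a ≤ b ↔ ∃ c, b = a + c := by
  constructor
  · intro h
    rcases totalN a b with h' | h'
    · refine ⟨0, ?_⟩
      rw [← ι_le, h', map_add] at h
      have := ι_nonneg (M.subN a b)
      have h0 : M.ι (M.subN a b) = 0 := by linarith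
      rw [map_eq_zero_iff _ ι_injective] at h0
      rw [h0, add_zero] at h'
      rw [h', add_zero]
    · exact ⟨_, h'⟩
  · rintro ⟨c, rfl⟩
    rw [← ι_le, map_add]
    linarith [ι_nonneg c]

theorem ltN_add_one {a b : M.N} : a < b + 1 ↔ a ≤ b := by
  constructor
  · intro h
    by_contra! hn
    obtain ⟨c, rfl⟩ := leN_iff_exists.1 hn.le
    rcases zero_or_succ c with hc | hc
    · rw [hc, add_zero] at hn; exact lt_irrefl _ hn
    · rw [hc, ← ι_lt] at h
      simp only [map_add, map_one] at h
      linarith [ι_nonneg (M.predN c)]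
  · intro h
    rw [← ι_le] at h
    rw [← ι_lt, map_add, map_one]
    linarith

theorem add_one_leN {a b : M.N} : a + 1 ≤ b ↔ a < b := by
  rw [← not_lt, ltN_add_one, not_le]

theorem leN_zero {a : M.N} : a ≤ 0 ↔ a = 0 :=
  ⟨fun h => le_antisymm h (zero_leN a), fun h => h.le⟩

theorem posN_iff {a : M.N} : 0 < a ↔ a ≠ 0 := by rw [← not_le, leN_zero]

theorem lt_add_oneN (a : M.N) : a < a + 1 := ltN_add_one.2 le_rfl

theorem ι_subN (a b : M.N) : M.ι (M.subN a b) = max (M.ι a - M.ι b) 0 := by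
  rcases le_total a b with h | h
  · obtain ⟨c, rfl⟩ := leN_iff_exists.1 h
    rw [subN_add, map_zero, max_eq_right (sub_nonpos.2 (ι_le.2 h))]
  · obtain ⟨c, rfl⟩ := leN_iff_exists.1 h
    rw [add_subN, map_add, add_sub_cancel_left, max_eq_left (ι_nonneg c)]

@[simp] theorem subN_eq_zero {a b : M.N} : M.subN a b = 0 ↔ a ≤ b := by
  rw [← ι_inj, ι_subN, map_zero, max_eq_right_iff, sub_nonpos, ι_le]

@[simp] theorem add_eq_zeroN_iff {a b : M.N} : a + b = 0 ↔ a = 0 ∧ b = 0 :=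
  ⟨fun h => ⟨add_eq_zeroN h, add_eq_zeroN (add_comm a b ▸ h)⟩, fun h => by rw [h.1, h.2, add_zero]⟩

@[simp] theorem eval_le {b : Bool} {Γ : Ctx} (e : Env M Γ) (s t : Tm Γ ty0) :
    (Fm.le s t : Fm b Γ).eval e ↔ s.eval e ≤ t.eval e := by simp [Fm.le, Fm.eval]

@[simp] theorem eval_lt {b : Bool} {Γ : Ctx} (e : Env M Γ) (s t : Tm Γ ty0) :
    (Fm.lt s t : Fm b Γ).eval e ↔ s.eval e < t.eval e := by
  simp [Fm.lt, succN_eq, add_one_leN]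

/-- The property `P` is decided by an object of the model. -/
@[fun_prop]
def DfnP {M : Model} {ρ : Ty} (P : M.D ρ → Prop) : Prop :=
  ∃ f : M.D ρ → M.N, Dfn f ∧ ∀ x, P x ↔ f x = 0

@[fun_prop]
theorem DfnP.le {ρ : Ty} {f g : M.D ρ → M.N} (hf : Dfn f) (hg : Dfn g) :
    DfnP (fun x => f x ≤ g x) := ⟨fun x => M.subN (f x) (g x), by fun_prop, fun x => by simp⟩

@[fun_prop]
theorem DfnP.not {ρ : Ty} {P : M.D ρ → Prop} (hP : DfnP P) : DfnP (fun x => ¬ P x) := by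
  obtain ⟨f, hf, h⟩ := hP
  refine ⟨fun x => M.subN 1 (f x), by fun_prop, fun x => ?_⟩
  have : (1 : M.N) = 0 + 1 := (zero_add 1).symm
  rw [subN_eq_zero, this, add_one_leN, posN_iff]
  exact not_congr (h x)

@[fun_prop]
theorem DfnP.and {ρ : Ty} {P Q : M.D ρ → Prop} (hP : DfnP P) (hQ : DfnP Q) :
    DfnP (fun x => P x ∧ Q x) := by
  obtain ⟨f, hf, h⟩ := hP
  obtain ⟨g, hg, h'⟩ := hQ
  exact ⟨fun x => f x + g x, by fun_prop, fun x => by simp [h, h']⟩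

@[fun_prop]
theorem DfnP.or {ρ : Ty} {P Q : M.D ρ → Prop} (hP : DfnP P) (hQ : DfnP Q) :
    DfnP (fun x => P x ∨ Q x) := by
  obtain ⟨f, hf, h⟩ := hP
  obtain ⟨g, hg, h'⟩ := hQ
  exact ⟨fun x => f x * g x, by fun_prop, fun x => by simp [h, h']⟩

theorem DfnP.imp {ρ : Ty} {P Q : M.D ρ → Prop} (hP : DfnP P) (hQ : DfnP Q) :
    DfnP (fun x => P x → Q x) := by
  simp only [imp_iff_not_or]; fun_prop

@[fun_prop]
theorem DfnP.lt {ρ : Ty} {f g : M.D ρ → M.N} (hf : Dfn f) (hg : Dfn g) :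
    DfnP (fun x => f x < g x) := by simp only [← not_le]; fun_prop

@[fun_prop]
theorem DfnP.eq {ρ : Ty} {f g : M.D ρ → M.N} (hf : Dfn f) (hg : Dfn g) :
    DfnP (fun x => f x = g x) := by simp only [le_antisymm_iff]; fun_prop

/-- Induction for decidable properties. -/
theorem inductionN {P : M.N → Prop} (hP : DfnP P) (h0 : P 0) (hs : ∀ n, P n → P (n + 1))
    (n : M.N) : P n := by
  obtain ⟨f, hf, h⟩ := hP
  rw [h] at h0 ⊢
  refine eq_induction hf (Dfn.const 0) h0 (fun n hn => ?_) n
  rw [succN_eq, ← h]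
  exact hs n ((h n).2 hn)

/-- Induction for decidable properties, from a given number on. -/
theorem inductionN_from {P : M.N → Prop} (hP : DfnP P) {m : M.N} (h0 : P m)
    (hs : ∀ n, m ≤ n → P n → P (n + 1)) {n : M.N} (hn : m ≤ n) : P n := by
  obtain ⟨c, rfl⟩ := leN_iff_exists.1 hn
  refine inductionN (P := fun c => P (m + c)) ?_ (by rwa [add_zero]) (fun k hk => ?_) c
  · obtain ⟨f, hf, h⟩ := hP
    exact ⟨fun c => f (m + c), by fun_prop, fun c => h _⟩
  · rw [← add_assoc]
    exact hs _ (leN_iff_exists.2 ⟨k, rfl⟩) hk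

/-- The recursion equations of `recN`, with `n + 1` for the successor. -/
theorem recN_add_one {Γ : Ctx} (e : Env M Γ) (step : Tm (ty0 :: ty0 :: Γ) ty0)
    {f : M.N → M.N → M.N} (hf : ∀ v k, step.eval ((e.cons v).cons k) = f v k) (n a : M.N) :
    M.recN (n + 1) a f = f (M.recN n a f) n := by rw [← succN_eq]; exact recN_succ e step hf n a

/-! ### Elementary functions -/

/-- `2 ^ n` in the model. -/
noncomputable def Model.pow2N (M : Model) [IsPRA M] (n : M.N) : M.N := M.recN n 1 (fun v _ => v + v)

/-- The value of the term `parity`. -/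
noncomputable def Model.parityN (M : Model) [IsPRA M] (n : M.N) : M.N :=
  M.recN n 0 (fun v _ => M.subN 1 v)

/-- The value of the term `half`. -/
noncomputable def Model.halfN (M : Model) [IsPRA M] (n : M.N) : M.N :=
  M.recN n 0 (fun v k => v + M.parityN k)

/-- The value of the term `tri`. -/
noncomputable def Model.triN (M : Model) [IsPRA M] (n : M.N) : M.N :=
  M.recN n 0 (fun v k => v + (k + 1))

/-- The value of the term `diag`. -/
noncomputable def Model.diagN (M : Model) [IsPRA M] (n : M.N) : M.N :=
  M.recN n 0 (fun v k => if M.triN (v + 1) = k + 1 then v + 1 else v)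

@[simp] theorem eval_pow2 {Γ : Ctx} (e : Env M Γ) (n : Tm Γ ty0) :
    (pow2 n).eval e = M.pow2N (n.eval e) := by simp [pow2, pow2N]

@[simp] theorem eval_parity {Γ : Ctx} (e : Env M Γ) (n : Tm Γ ty0) :
    (parity n).eval e = M.parityN (n.eval e) := by simp [parity, parityN]

@[simp] theorem eval_half {Γ : Ctx} (e : Env M Γ) (n : Tm Γ ty0) :
    (half n).eval e = M.halfN (n.eval e) := by simp [half, halfN]

@[simp] theorem eval_tri {Γ : Ctx} (e : Env M Γ) (n : Tm Γ ty0) :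
    (tri n).eval e = M.triN (n.eval e) := by simp [tri, triN, succN_eq]

@[simp] theorem eval_absDiff_eq_zero {Γ : Ctx} (e : Env M Γ) (a b : Tm Γ ty0) :
    (absDiff a b).eval e = 0 ↔ a.eval e = b.eval e := by
  rw [absDiff, eval_add, add_eq_zeroN_iff, eval_sub, eval_sub, subN_eq_zero, subN_eq_zero,
    le_antisymm_iff]

@[simp] theorem eval_ifZero {Γ : Ctx} (e : Env M Γ) (c a b : Tm Γ ty0) :
    (ifZero c a b).eval e = if c.eval e = 0 then a.eval e else b.eval e := by
  simp only [ifZero, eval_recTm, Tm.eval_wk]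
  split_ifs with h
  · rw [h]
    exact recN_zero ((Env.nil M).cons (b.eval e)) v2 (fun _ _ => rfl) _
  · rw [(zero_or_succ _).resolve_left h]
    exact recN_add_one ((Env.nil M).cons (b.eval e)) v2 (fun _ _ => rfl) _ _

@[simp] theorem eval_diag {Γ : Ctx} (e : Env M Γ) (n : Tm Γ ty0) :
    (diag n).eval e = M.diagN (n.eval e) := by simp [diag, diagN, succN_eq]

theorem pow2N_zero : M.pow2N 0 = 1 :=
  recN_zero (Env.nil M) (add v1 v1) (fun _ _ => by simp) _

theorem pow2N_add_one (n : M.N) : M.pow2N (n + 1) = M.pow2N n + M.pow2N n :=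
  recN_add_one (Env.nil M) (add v1 v1) (fun _ _ => by simp) _ _

theorem parityN_zero : M.parityN 0 = 0 :=
  recN_zero (Env.nil M) (sub one v1) (fun _ _ => by simp) _

theorem parityN_add_one (n : M.N) : M.parityN (n + 1) = M.subN 1 (M.parityN n) :=
  recN_add_one (Env.nil M) (sub one v1) (fun _ _ => by simp) _ _

theorem halfN_zero : M.halfN 0 = 0 :=
  recN_zero (Env.nil M) (add v1 (parity v0)) (fun _ _ => by simp) _

theorem halfN_add_one (n : M.N) : M.halfN (n + 1) = M.halfN n + M.parityN n :=
  recN_add_one (Env.nil M) (add v1 (parity v0)) (fun _ _ => by simp) _ _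

theorem triN_zero : M.triN 0 = 0 :=
  recN_zero (Env.nil M) (add v1 (succ v0)) (fun _ _ => by simp [succN_eq]) _

theorem triN_add_one (n : M.N) : M.triN (n + 1) = M.triN n + (n + 1) :=
  recN_add_one (Env.nil M) (add v1 (succ v0)) (fun _ _ => by simp [succN_eq]) _ _

theorem diagN_zero : M.diagN 0 = 0 :=
  recN_zero (Env.nil M) (ifZero (absDiff (tri (succ v1)) (succ v0)) (succ v1) v1)
    (fun _ _ => by simp [succN_eq]) _

theorem diagN_add_one (n : M.N) : M.diagN (n + 1) =
    if M.triN (M.diagN n + 1) = n + 1 then M.diagN n + 1 else M.diagN n :=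
  recN_add_one (Env.nil M) (ifZero (absDiff (tri (succ v1)) (succ v0)) (succ v1) v1)
    (fun _ _ => by simp [succN_eq]) _ _

@[fun_prop]
theorem Dfn.pow2N {ρ : Ty} {f : M.D ρ → M.N} (hf : Dfn f) : Dfn (fun x => M.pow2N (f x)) :=
  Dfn.comp (f := M.pow2N) (by simpa using Dfn.ofTm (Env.nil M) (pow2 v0)) hf

@[fun_prop]
theorem Dfn.parityN {ρ : Ty} {f : M.D ρ → M.N} (hf : Dfn f) : Dfn (fun x => M.parityN (f x)) :=
  Dfn.comp (f := M.parityN) (by simpa using Dfn.ofTm (Env.nil M) (parity v0)) hf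

@[fun_prop]
theorem Dfn.halfN {ρ : Ty} {f : M.D ρ → M.N} (hf : Dfn f) : Dfn (fun x => M.halfN (f x)) :=
  Dfn.comp (f := M.halfN) (by simpa using Dfn.ofTm (Env.nil M) (half v0)) hf

@[fun_prop]
theorem Dfn.triN {ρ : Ty} {f : M.D ρ → M.N} (hf : Dfn f) : Dfn (fun x => M.triN (f x)) :=
  Dfn.comp (f := M.triN) (by simpa using Dfn.ofTm (Env.nil M) (tri v0)) hf

@[fun_prop]
theorem Dfn.diagN {ρ : Ty} {f : M.D ρ → M.N} (hf : Dfn f) : Dfn (fun x => M.diagN (f x)) :=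
  Dfn.comp (f := M.diagN) (by simpa using Dfn.ofTm (Env.nil M) (diag v0)) hf

theorem parityN_double (n : M.N) : M.parityN (n + n) = 0 := by
  refine inductionN (P := fun n => M.parityN (n + n) = 0) (by fun_prop) ?_ (fun n hn => ?_) n
  · simp only [add_zero, parityN_zero]
  · have : n + 1 + (n + 1) = n + n + 1 + 1 := by ring
    rw [this, parityN_add_one, parityN_add_one, hn, subN_zero]
    exact subN_eq_zero.2 le_rfl

theorem parityN_double_add_one (n : M.N) : M.parityN (n + n + 1) = 1 := by
  rw [parityN_add_one, parityN_double, subN_zero]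

theorem halfN_double (n : M.N) : M.halfN (n + n) = n := by
  refine inductionN (P := fun n => M.halfN (n + n) = n) (by fun_prop) ?_ (fun n hn => ?_) n
  · simp only [add_zero, halfN_zero]
  · have : n + 1 + (n + 1) = n + n + 1 + 1 := by ring
    rw [this, halfN_add_one, halfN_add_one, hn, parityN_double, parityN_double_add_one, add_zero]

theorem diagN_spec (n : M.N) : M.triN (M.diagN n) ≤ n ∧ n < M.triN (M.diagN n + 1) := by
  refine inductionN (P := fun n => M.triN (M.diagN n) ≤ n ∧ n < M.triN (M.diagN n + 1))
    (by fun_prop) ?_ (fun n hn => ?_) n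
  · rw [diagN_zero, triN_zero, triN_add_one, triN_zero, zero_add, zero_add]
    exact ⟨le_rfl, posN_iff.2 one_ne_zero⟩
  · rw [diagN_add_one]
    split_ifs with h
    · refine ⟨h.le, ?_⟩
      rw [triN_add_one, h, ← add_assoc, ltN_add_one]
      exact leN_iff_exists.2 ⟨_, rfl⟩
    · exact ⟨hn.1.trans (lt_add_oneN n).le, lt_of_le_of_ne (add_one_leN.2 hn.2) (Ne.symm h)⟩

theorem triN_mono {a b : M.N} (h : a ≤ b) : M.triN a ≤ M.triN b := by
  refine inductionN_from (P := fun b => M.triN a ≤ M.triN b) (by fun_prop) le_rfl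
    (fun n _ hn => hn.trans ?_) h
  rw [triN_add_one]
  exact leN_iff_exists.2 ⟨_, rfl⟩

theorem diagN_tri_add {w b : M.N} (h : b ≤ w) : M.diagN (M.triN w + b) = w := by
  obtain ⟨h1, h2⟩ := diagN_spec (M.triN w + b)
  have h3 : M.triN w + b < M.triN (w + 1) := by
    rw [triN_add_one, ← ι_lt]
    rw [← ι_le] at h
    simp only [map_add, map_one]
    linarith
  refine le_antisymm ?_ ?_
  · by_contra! hn
    exact absurd (h1.trans_lt h3) (not_lt.2 (triN_mono (add_one_leN.2 hn)))
  · by_contra! hn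
    have := (leN_iff_exists.2 ⟨b, rfl⟩ : M.triN w ≤ M.triN w + b).trans_lt h2
    exact absurd this (not_lt.2 (triN_mono (add_one_leN.2 hn)))

/-! ### Rational numbers -/

/-- The value of the term `pair`. -/
noncomputable def Model.pairN (M : Model) [IsPRA M] (a b : M.N) : M.N := M.triN (a + b) + b

/-- The value of the term `snd`. -/
noncomputable def Model.sndN (M : Model) [IsPRA M] (c : M.N) : M.N := M.subN c (M.triN (M.diagN c))

/-- The value of the term `fst`. -/
noncomputable def Model.fstN (M : Model) [IsPRA M] (c : M.N) : M.N := M.subN (M.diagN c) (M.sndN c)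

@[simp] theorem eval_pair {Γ : Ctx} (e : Env M Γ) (a b : Tm Γ ty0) :
    (pair a b).eval e = M.pairN (a.eval e) (b.eval e) := by simp [pair, pairN]

@[simp] theorem eval_snd {Γ : Ctx} (e : Env M Γ) (a : Tm Γ ty0) :
    (snd a).eval e = M.sndN (a.eval e) := by simp [snd, sndN]

@[simp] theorem eval_fst {Γ : Ctx} (e : Env M Γ) (a : Tm Γ ty0) :
    (fst a).eval e = M.fstN (a.eval e) := by simp [fst, fstN]

@[simp] theorem sndN_pair (a b : M.N) : M.sndN (M.pairN a b) = b := by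
  rw [sndN, pairN, diagN_tri_add (leN_iff_exists.2 ⟨a, add_comm a b⟩), add_subN]

@[simp] theorem fstN_pair (a b : M.N) : M.fstN (M.pairN a b) = a := by
  rw [fstN, sndN_pair, pairN, diagN_tri_add (leN_iff_exists.2 ⟨a, add_comm a b⟩), add_comm a,
    add_subN]

/-- The rational number coded by `q`. -/
noncomputable def Model.val (M : Model) [IsPRA M] (q : M.N) : M.Q :=
  (M.ι (M.subN 1 (M.parityN (M.fstN q)) * M.halfN (M.fstN q)) -
    M.ι (M.parityN (M.fstN q) * M.halfN (M.fstN q + 1))) / M.ι (M.sndN q + 1)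

@[simp] theorem ι_add_one_pos (a : M.N) : 0 < M.ι (a + 1) := by
  rw [map_add, map_one]
  linarith [ι_nonneg a]

theorem val_pair (a m : M.N) : M.val (M.pairN (a + a) m) = M.ι a / M.ι (m + 1) := by
  simp only [val, fstN_pair, sndN_pair, parityN_double, halfN_double, subN_zero, one_mul, zero_mul,
    map_zero, sub_zero]

/-- The value of the term `dens`. -/
noncomputable def Model.densN (M : Model) [IsPRA M] (q r : M.N) : M.N :=
  (M.sndN q + 1) * (M.sndN r + 1)

theorem ι_densN_pos (q r : M.N) : 0 < M.ι (M.densN q r) := by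
  rw [densN, map_mul]
  exact mul_pos (ι_add_one_pos _) (ι_add_one_pos _)

@[simp] theorem eval_dens {Γ : Ctx} (e : Env M Γ) (q r : Tm Γ ty0) :
    (dens q r).eval e = M.densN (q.eval e) (r.eval e) := by simp [dens, den, densN, succN_eq]

/-- The value of the term `excess`. -/
noncomputable def Model.excessN (M : Model) [IsPRA M] (q r : M.N) : M.N :=
  (excess v1 v0).eval (((Env.nil M).cons q).cons r)

/-- The value of the term `gap`. -/
noncomputable def Model.gapN (M : Model) [IsPRA M] (q r : M.N) : M.N :=
  M.excessN q r + M.excessN r q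

@[simp] theorem eval_excess {Γ : Ctx} (e : Env M Γ) (q r : Tm Γ ty0) :
    (excess q r).eval e = M.excessN (q.eval e) (r.eval e) := by
  simp [excess, cross, posNum, negNum, den, excessN]

@[simp] theorem eval_gap {Γ : Ctx} (e : Env M Γ) (q r : Tm Γ ty0) :
    (gap q r).eval e = M.gapN (q.eval e) (r.eval e) := by simp [gap, gapN]

theorem ι_excessN (q r : M.N) :
    M.ι (M.excessN q r) = max (M.val q - M.val r) 0 * M.ι (M.densN q r) := by
  have hq : M.ι (M.sndN q + 1) ≠ 0 := (ι_add_one_pos _).ne'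
  have hr : M.ι (M.sndN r + 1) ≠ 0 := (ι_add_one_pos _).ne'
  rw [max_mul_of_nonneg _ _ (ι_densN_pos q r).le, zero_mul]
  simp only [excessN, excess, cross, posNum, negNum, den, eval_sub, eval_add, eval_mul, eval_parity,
    eval_half, eval_fst, eval_snd, eval_succ, eval_one, eval_var_s, eval_var_z, succN_eq, ι_subN]
  congr 1
  rw [val, val, densN]
  generalize M.sndN q + 1 = d at *
  generalize M.sndN r + 1 = d' at *
  simp only [map_add, map_mul, ι_subN]
  field_simp
  ring

theorem ι_gapN (q r : M.N) : M.ι (M.gapN q r) = |M.val q - M.val r| * M.ι (M.densN q r) := by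
  have hc : M.densN r q = M.densN q r := mul_comm _ _
  rw [gapN, map_add, ι_excessN, ι_excessN, hc, ← add_mul]
  congr 1
  rcases le_total (M.val q) (M.val r) with h | h
  · rw [max_eq_right (sub_nonpos.2 h), max_eq_left (sub_nonneg.2 h), abs_of_nonpos (sub_nonpos.2 h)]
    ring
  · rw [max_eq_left (sub_nonneg.2 h), max_eq_right (sub_nonpos.2 h), abs_of_nonneg (sub_nonneg.2 h)]
    ring

/-- `1 / 2 ^ n` in the rationals of the model. -/
noncomputable def Model.eps (M : Model) [IsPRA M] (n : M.N) : M.Q := (M.ι (M.pow2N n))⁻¹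

theorem ι_pow2N_pos (n : M.N) : 0 < M.ι (M.pow2N n) := by
  rw [← map_zero M.ι, ι_lt]
  refine inductionN (P := fun n => 0 < M.pow2N n) (by fun_prop) ?_ (fun n hn => ?_) n
  · rw [pow2N_zero]; exact posN_iff.2 one_ne_zero
  · rw [pow2N_add_one]
    rw [posN_iff] at *
    exact fun h => hn (add_eq_zeroN h)

@[simp] theorem eps_pos (n : M.N) : 0 < M.eps n := inv_pos.2 (ι_pow2N_pos n)

theorem eps_zero : M.eps 0 = 1 := by rw [eps, pow2N_zero, map_one, inv_one]

theorem eps_add_one (n : M.N) : M.eps (n + 1) = M.eps n / 2 := by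
  rw [eps, eps, pow2N_add_one, map_add, ← two_mul, mul_inv]
  ring

theorem pow2N_mul_eps (n : M.N) : M.ι (M.pow2N n) * M.eps n = 1 :=
  mul_inv_cancel₀ (ι_pow2N_pos n).ne'

theorem lt_pow2N (n : M.N) : n < M.pow2N n := by
  refine inductionN (P := fun n => n < M.pow2N n) (by fun_prop) ?_ (fun n hn => ?_) n
  · rw [pow2N_zero]; exact posN_iff.2 one_ne_zero
  · have h1 : (0 : M.N) + 1 ≤ M.pow2N n := add_one_leN.2 (lt_of_le_of_lt (zero_leN n) hn)
    rw [pow2N_add_one]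
    rw [← ι_lt] at *
    rw [← ι_le] at h1
    simp only [map_add, map_one, map_zero] at *
    linarith

theorem pow2N_mono {a b : M.N} (h : a ≤ b) : M.pow2N a ≤ M.pow2N b := by
  refine inductionN_from (P := fun b => M.pow2N a ≤ M.pow2N b) (by fun_prop) le_rfl
    (fun n _ hn => hn.trans ?_) h
  rw [pow2N_add_one]
  exact leN_iff_exists.2 ⟨_, rfl⟩

theorem eps_anti {a b : M.N} (h : a ≤ b) : M.eps b ≤ M.eps a :=
  inv_anti₀ (ι_pow2N_pos a) (ι_le.2 (pow2N_mono h))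

/-- The powers of `1 / 2` with exponents in the model are arbitrarily small. -/
theorem exists_eps_lt {δ : M.Q} (hδ : 0 < δ) : ∃ n, M.eps n < δ := by
  obtain ⟨a, ha⟩ := M.fld.exists_ge δ⁻¹
  have ha : δ⁻¹ ≤ M.ι a := ha
  exact ⟨a, inv_lt_of_inv_lt₀ hδ (ha.trans_lt (ι_lt.2 (lt_pow2N a)))⟩

theorem gap_le_iff (q r n : M.N) :
    M.gapN q r * M.pow2N n ≤ M.densN q r ↔ |M.val q - M.val r| ≤ M.eps n := by
  rw [← ι_le, map_mul, ι_gapN, mul_right_comm, mul_le_iff_le_one_left (ι_densN_pos q r), eps,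
    ← one_div, le_div_iff₀ (ι_pow2N_pos n)]

theorem gap_lt_iff (q r n : M.N) :
    M.gapN q r * M.pow2N n < M.densN q r ↔ |M.val q - M.val r| < M.eps n := by
  rw [← ι_lt, map_mul, ι_gapN, mul_right_comm, mul_lt_iff_lt_one_left (ι_densN_pos q r), eps,
    ← one_div, lt_div_iff₀ (ι_pow2N_pos n)]

theorem lt_excess_iff (q r n : M.N) :
    M.densN q r < M.excessN q r * M.pow2N n ↔ M.val r + M.eps n < M.val q := by
  rw [← ι_lt, map_mul, ι_excessN, mul_right_comm, lt_mul_iff_one_lt_left (ι_densN_pos q r), eps,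
    ← one_div, ← div_lt_iff₀ (ι_pow2N_pos n), lt_max_iff, lt_sub_iff_add_lt']
  refine or_iff_left ?_
  have := ι_pow2N_pos n
  exact not_lt.2 (by positivity)

end Arithmetic

section Reals
open Model
variable {M : Model} [IsPRA M]

/-! ### Real numbers -/

/-- The summand of the term `slow`, which is zero exactly if `|x j - x k| < 1 / 2 ^ j`. -/
noncomputable def Model.slowTerm (M : Model) [IsPRA M] (x : M.D ty1) (j k : M.N) : M.N :=
  M.subN (M.gapN (M.app x j) (M.app x k) * M.pow2N j + 1) (M.densN (M.app x j) (M.app x k))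

theorem slowTerm_eq_zero {x : M.D ty1} {j k : M.N} :
    M.slowTerm x j k = 0 ↔ |M.val (M.app x j) - M.val (M.app x k)| < M.eps j := by
  rw [slowTerm, subN_eq_zero, add_one_leN, gap_lt_iff]

/-- A term for the partial sums of `slow x k`. -/
def slowSum {Γ : Ctx} (x : Tm Γ ty1) (k i : Tm Γ ty0) : Tm Γ ty0 :=
  recTm i zero (add v1
    (sub (succ (mul (gap (x.wk.wk ⬝ v0) (x.wk.wk ⬝ succ k.wk.wk)) (pow2 v0)))
      (dens (x.wk.wk ⬝ v0) (x.wk.wk ⬝ succ k.wk.wk))))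

/-- The partial sums of `slow x k`. -/
noncomputable def Model.slowSumN (M : Model) [IsPRA M] (x : M.D ty1) (k i : M.N) : M.N :=
  M.recN i 0 (fun v j => v + M.slowTerm x j (k + 1))

@[simp] theorem eval_slowSum {Γ : Ctx} (e : Env M Γ) (x : Tm Γ ty1) (k i : Tm Γ ty0) :
    (slowSum x k i).eval e = M.slowSumN (x.eval e) (k.eval e) (i.eval e) := by
  simp [slowSum, slowSumN, slowTerm, succN_eq]

@[simp] theorem eval_slow {Γ : Ctx} (e : Env M Γ) (x : Tm Γ ty1) (k : Tm Γ ty0) :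
    (slow x k).eval e = M.slowSumN (x.eval e) (k.eval e) (k.eval e + 1) :=
  (eval_slowSum e x k (succ k)).trans (by rw [eval_succ, succN_eq])

@[fun_prop]
theorem Dfn.slowSumN {ρ : Ty} (x : M.D ty1) {f g : M.D ρ → M.N} (hf : Dfn f) (hg : Dfn g) :
    Dfn (fun a => M.slowSumN x (f a) (g a)) := by
  have := ((Dfn.const ((lam (lam (lam (slowSum v2 v1 v0)))).eval (Env.nil M))).app
    (Dfn.const x)).app hf |>.app hg
  simpa using this

theorem slowSumN_zero (x : M.D ty1) (k : M.N) : M.slowSumN x k 0 = 0 :=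
  recN_zero (((Env.nil M).cons x).cons k) (add v1 (sub (succ (mul (gap (.var (.s (.s (.s .z))) ⬝ v0)
    (.var (.s (.s (.s .z))) ⬝ succ v2)) (pow2 v0)))
      (dens (.var (.s (.s (.s .z))) ⬝ v0) (.var (.s (.s (.s .z))) ⬝ succ v2))))
    (fun v j => by simp [slowTerm, succN_eq]) 0

theorem slowSumN_add_one (x : M.D ty1) (k i : M.N) :
    M.slowSumN x k (i + 1) = M.slowSumN x k i + M.slowTerm x i (k + 1) :=
  recN_add_one (((Env.nil M).cons x).cons k)
    (add v1 (sub (succ (mul (gap (.var (.s (.s (.s .z))) ⬝ v0)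
    (.var (.s (.s (.s .z))) ⬝ succ v2)) (pow2 v0)))
      (dens (.var (.s (.s (.s .z))) ⬝ v0) (.var (.s (.s (.s .z))) ⬝ succ v2))))
    (fun v j => by simp [slowTerm, succN_eq]) i 0

theorem slowSumN_eq_zero {x : M.D ty1} {k i : M.N} :
    M.slowSumN x k i = 0 ↔ ∀ j < i, M.slowTerm x j (k + 1) = 0 := by
  constructor
  · intro h j hj
    have hmono : M.slowSumN x k i = 0 → M.slowSumN x k (j + 1) = 0 := by
      refine inductionN_from (P := fun i => M.slowSumN x k i = 0 → M.slowSumN x k (j + 1) = 0)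
        (DfnP.imp (by fun_prop) (by fun_prop)) _root_.id (fun n _ hn h => hn ?_)
        (add_one_leN.2 hj)
      rw [slowSumN_add_one] at h
      exact add_eq_zeroN h
    have := hmono h
    rw [slowSumN_add_one, add_comm] at this
    exact add_eq_zeroN this
  · intro h
    refine inductionN (P := fun n => n ≤ i → M.slowSumN x k n = 0)
      (DfnP.imp (by fun_prop) (by fun_prop)) (fun _ => slowSumN_zero x k) (fun n hn hi => ?_) i
      le_rfl
    have hni := add_one_leN.1 hi
    rw [slowSumN_add_one, hn hni.le, h n hni, add_zero]

/-- The value of the term `hatIndex`. -/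
noncomputable def Model.hatIndexN (M : Model) [IsPRA M] (x : M.D ty1) (n : M.N) : M.N :=
  M.recN n 0 (fun v k => if v = k ∧ M.slowSumN x k (k + 1) = 0 then k + 1 else v)

@[simp] theorem eval_hatIndex {Γ : Ctx} (e : Env M Γ) (x : Tm Γ ty1) (n : Tm Γ ty0) :
    (hatIndex x n).eval e = M.hatIndexN (x.eval e) (n.eval e) := by
  simp [hatIndex, hatIndexN, succN_eq]

theorem hatIndexN_zero (x : M.D ty1) : M.hatIndexN x 0 = 0 :=
  recN_zero ((Env.nil M).cons x) (ifZero (add (absDiff v1 v0) (slow v2 v0)) (succ v0) v1)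
    (fun v j => by simp [succN_eq]) 0

theorem hatIndexN_add_one (x : M.D ty1) (n : M.N) : M.hatIndexN x (n + 1) =
    if M.hatIndexN x n = n ∧ M.slowSumN x n (n + 1) = 0 then n + 1 else M.hatIndexN x n :=
  recN_add_one ((Env.nil M).cons x) (ifZero (add (absDiff v1 v0) (slow v2 v0)) (succ v0) v1)
    (fun v j => by simp [succN_eq]) n 0

@[fun_prop]
theorem Dfn.hatIndexN {ρ : Ty} (x : M.D ty1) {f : M.D ρ → M.N} (hf : Dfn f) :
    Dfn (fun a => M.hatIndexN x (f a)) := by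
  have := ((Dfn.const ((lam (lam (hatIndex v1 v0))).eval (Env.nil M))).app (Dfn.const x)).app hf
  simpa using this

/-- The value of the term `hat`. -/
def Model.hatN (M : Model) (x : M.D ty1) : M.D ty1 := (hat v0).eval ((Env.nil M).cons x)

@[simp] theorem app_hatN (x : M.D ty1) (n : M.N) :
    M.app (M.hatN x) n = M.app x (M.hatIndexN x n) := by simp [hatN, hat]

@[simp] theorem eval_hat {Γ : Ctx} (e : Env M Γ) (x : Tm Γ ty1) :
    (hat x).eval e = M.hatN (x.eval e) :=
  IsPRA.ext _ _ fun n => by rw [app_hatN]; simp [hat]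

theorem hatIndexN_le (x : M.D ty1) (n : M.N) : M.hatIndexN x n ≤ n := by
  refine inductionN (P := fun n => M.hatIndexN x n ≤ n) (by fun_prop) (hatIndexN_zero x).le
    (fun n hn => ?_) n
  rw [hatIndexN_add_one]
  split_ifs
  · exact le_rfl
  · exact hn.trans (lt_add_oneN n).le

theorem hatIndexN_of_eq {x : M.D ty1} {n m : M.N} (h : n ≤ m) (hm : M.hatIndexN x m = m) :
    M.hatIndexN x n = n := by
  refine inductionN_from (P := fun m => M.hatIndexN x m = m → M.hatIndexN x n = n)
    (DfnP.imp (by fun_prop) (by fun_prop)) _root_.id (fun k _ hk hk1 => hk ?_) h hm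
  rw [hatIndexN_add_one] at hk1
  split_ifs at hk1 with hc
  · exact hc.1
  · exact absurd hk1 ((hatIndexN_le x k).trans_lt (lt_add_oneN k)).ne

/-- The rational approximations of the real coded by `x`. -/
noncomputable def Model.approxQ (M : Model) [IsPRA M] (x : M.D ty1) (n : M.N) : M.Q :=
  M.val (M.app (M.hatN x) n)

/-- The approximations of a real converge fast. -/
theorem approxQ_cauchy (x : M.D ty1) {n m : M.N} (h : n ≤ m) :
    |M.approxQ x n - M.approxQ x m| < M.eps n := by
  simp only [approxQ, app_hatN]
  have key : M.hatIndexN x m = M.hatIndexN x n ∨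
      (M.hatIndexN x n = n ∧ M.slowTerm x n (M.hatIndexN x m) = 0) := by
    refine inductionN_from (P := fun m => M.hatIndexN x m = M.hatIndexN x n ∨
      (M.hatIndexN x n = n ∧ M.slowTerm x n (M.hatIndexN x m) = 0)) ?_ (Or.inl rfl)
      (fun k hnk hk => ?_) h
    · have : Dfn (fun m => M.slowTerm x n m) := by
        simpa [slowTerm, succN_eq] using Dfn.ofTm (((Env.nil M).cons x).cons n)
          (sub (succ (mul (gap (v2 ⬝ v1) (v2 ⬝ v0)) (pow2 v1))) (dens (v2 ⬝ v1) (v2 ⬝ v0)))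
      have := Dfn.comp this (Dfn.hatIndexN x Dfn.id)
      fun_prop
    · by_cases hc : M.hatIndexN x k = k ∧ M.slowSumN x k (k + 1) = 0
      · right
        rw [hatIndexN_add_one, if_pos hc]
        exact ⟨hatIndexN_of_eq hnk hc.1, slowSumN_eq_zero.1 hc.2 n (ltN_add_one.2 hnk)⟩
      · rw [hatIndexN_add_one, if_neg hc]
        exact hk
  rcases key with h | ⟨h1, h2⟩
  · rw [h, sub_self, abs_zero]; exact eps_pos n
  · rw [h1]; exact slowTerm_eq_zero.1 h2

/-- A fast converging sequence is not changed by `hat`. -/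
theorem approxQ_eq {x : M.D ty1}
    (h : ∀ n m, n < m → |M.val (M.app x n) - M.val (M.app x m)| < M.eps n) (n : M.N) :
    M.approxQ x n = M.val (M.app x n) := by
  rw [approxQ, app_hatN]
  congr 2
  refine inductionN (P := fun n => M.hatIndexN x n = n) (by fun_prop) (hatIndexN_zero x)
    (fun n hn => ?_) n
  rw [hatIndexN_add_one, if_pos]
  exact ⟨hn, slowSumN_eq_zero.2 fun j hj => slowTerm_eq_zero.2 (h j _ hj)⟩

/-- The conditions on all `n > 0` with `1 / 2 ^ (n-1)` become conditions on all `n + 1`. -/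
theorem lt_zero_imp_iff {P : M.N → Prop} : (∀ n, 0 < n → P n) ↔ ∀ n, P (n + 1) := by
  constructor
  · exact fun h n => h _ (posN_iff.2 (add_one_ne_zeroN n))
  · intro h n hn
    rw [(zero_or_succ n).resolve_left (posN_iff.1 hn)]
    exact h _

@[simp] theorem predN_add_one (n : M.N) : M.predN (n + 1) = n := by rw [← succN_eq, predN_succ]

/-- `x =_ℝ y` in the model. -/
def Model.RealEq (M : Model) [IsPRA M] (x y : M.D ty1) : Prop :=
  ∀ n, |M.approxQ x (n + 1) - M.approxQ y (n + 1)| ≤ M.eps n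

theorem eval_realEq {b : Bool} {Γ : Ctx} (e : Env M Γ) (x y : Tm Γ ty1) :
    (realEq x y : Fm b Γ).eval e ↔ M.RealEq (x.eval e) (y.eval e) := by
  refine Iff.trans ?_ (lt_zero_imp_iff (P := fun n =>
    |M.approxQ (x.eval e) n - M.approxQ (y.eval e) n| ≤ M.eps (M.predN n))) |>.trans
    (forall_congr' fun n => by rw [predN_add_one])
  simp only [realEq, Fm.eval, eval_lt, eval_zero, eval_var_z, eval_le, eval_mul, eval_gap, eval_app,
    Tm.eval_wk, eval_hat, eval_pow2, eval_pred, eval_dens, gap_le_iff]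
  rfl

theorem eval_approx {Γ : Ctx} (e : Env M Γ) (x y : Tm Γ ty1) :
    (approx x y).eval e ↔ ∀ n : M.N, M.st n → 0 < n →
      |M.approxQ (x.eval e) n - M.approxQ (y.eval e) n| ≤ M.eps (M.predN n) := by
  simp only [approx, Fm.allSt, Fm.eval, eval_lt, eval_zero, eval_var_z, eval_le, eval_mul, eval_gap,
    eval_app, Tm.eval_wk, eval_hat, eval_pow2, eval_pred, eval_dens, gap_le_iff]
  rfl

theorem eval_realLt {b : Bool} {Γ : Ctx} (e : Env M Γ) (x y : Tm Γ ty1) :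
    (realLt x y : Fm b Γ).eval e ↔
      ∃ n, M.approxQ (x.eval e) (n + 1) + M.eps n < M.approxQ (y.eval e) (n + 1) := by
  rw [← not_iff_not]
  push Not
  refine Iff.trans ?_ (lt_zero_imp_iff (P := fun n =>
    M.approxQ (y.eval e) n ≤ M.approxQ (x.eval e) n + M.eps (M.predN n))) |>.trans
    (forall_congr' fun n => by rw [predN_add_one])
  simp only [realLt, Fm.eval, eval_lt, eval_zero, eval_var_z, eval_mul, eval_excess, eval_app,
    Tm.eval_wk, eval_hat, eval_pow2, eval_pred, eval_dens, lt_excess_iff, not_exists, not_and,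
    not_lt]
  rfl

theorem approxQ_const {x : M.D ty1} {c : M.Q} (h : ∀ n, M.val (M.app x n) = c) (n : M.N) :
    M.approxQ x n = c := by
  rw [approxQ_eq (fun i j _ => by rw [h, h, sub_self, abs_zero]; exact eps_pos i), h]

/-- `x ∈ [0,1]` in the model. -/
def Model.InUnit (M : Model) [IsPRA M] (x : M.D ty1) : Prop :=
  ∀ n, -M.eps n ≤ M.approxQ x (n + 1) ∧ M.approxQ x (n + 1) ≤ 1 + M.eps n

theorem eval_inUnit {b : Bool} {Γ : Ctx} (e : Env M Γ) (x : Tm Γ ty1) :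
    (inUnit x : Fm b Γ).eval e ↔ M.InUnit (x.eval e) := by
  have h0 : ∀ n, M.approxQ ((realZero : Tm Γ ty1).eval e) n = 0 := approxQ_const fun n => by
    have := val_pair (M := M) 0 0
    rw [add_zero] at this
    simp only [realZero, app_lam, ratZero, eval_pair, eval_zero, this, map_zero, zero_div]
  have h1 : ∀ n, M.approxQ ((realOne : Tm Γ ty1).eval e) n = 1 := approxQ_const fun n => by
    have := val_pair (M := M) 1 0
    rw [zero_add, map_one, div_one] at this
    simp only [realOne, app_lam, ratOne, eval_pair, eval_zero, eval_succ, eval_one, succN_eq, this]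
  simp only [inUnit, Fm.neg, Fm.eval, eval_realLt, h0, h1, InUnit, forall_and]
  simp only [imp_false, not_exists, not_lt]
  exact and_congr (forall_congr' fun n => by constructor <;> intro h <;> linarith) Iff.rfl

/-- The value of the term `binNum`. -/
noncomputable def Model.binNumN (M : Model) [IsPRA M] (a : M.D ty1) (n : M.N) : M.N :=
  M.recN n 0 (fun v k => v + v + M.app a (k + 1))

@[simp] theorem eval_binNum {Γ : Ctx} (e : Env M Γ) (a : Tm Γ ty1) (n : Tm Γ ty0) :
    (binNum a n).eval e = M.binNumN (a.eval e) (n.eval e) := by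
  simp [binNum, binNumN, succN_eq]

theorem binNumN_zero (a : M.D ty1) : M.binNumN a 0 = 0 :=
  recN_zero ((Env.nil M).cons a) (add (add v1 v1) (v2 ⬝ succ v0)) (fun v j => by simp [succN_eq]) 0

theorem binNumN_add_one (a : M.D ty1) (n : M.N) :
    M.binNumN a (n + 1) = M.binNumN a n + M.binNumN a n + M.app a (n + 1) :=
  recN_add_one ((Env.nil M).cons a) (add (add v1 v1) (v2 ⬝ succ v0)) (fun v j => by simp [succN_eq])
    n 0

@[fun_prop]
theorem Dfn.binNumN {ρ : Ty} (x : M.D ty1) {f : M.D ρ → M.N} (hf : Dfn f) :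
    Dfn (fun a => M.binNumN x (f a)) := by
  have := ((Dfn.const ((lam (lam (binNum v1 v0))).eval (Env.nil M))).app (Dfn.const x)).app hf
  simpa using this

/-- The partial sum `∑_{i=1}^{n} a(i) / 2 ^ i`. -/
noncomputable def Model.partialSum (M : Model) [IsPRA M] (a : M.D ty1) (n : M.N) : M.Q :=
  M.ι (M.binNumN a n) * M.eps n

theorem partialSum_add_one (a : M.D ty1) (n : M.N) :
    M.partialSum a (n + 1) = M.partialSum a n + M.ι (M.app a (n + 1)) * M.eps (n + 1) := by
  rw [partialSum, partialSum, binNumN_add_one, eps_add_one]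
  simp only [map_add]
  ring

theorem predN_pow2N_add_one (n : M.N) : M.predN (M.pow2N n) + 1 = M.pow2N n := by
  refine ((zero_or_succ _).resolve_left fun h => ?_).symm
  have := ι_pow2N_pos n
  rw [h, map_zero] at this
  exact lt_irrefl _ this

theorem val_binSum {Γ : Ctx} (e : Env M Γ) (a : Tm Γ ty1) (n : M.N) :
    M.val (M.app ((binSum a).eval e) n) = M.partialSum (a.eval e) n := by
  simp only [binSum, app_lam, eval_pair, eval_add, eval_binNum, Tm.eval_wk, eval_pred, eval_pow2,
    eval_var_z, val_pair, predN_pow2N_add_one, partialSum, div_eq_mul_inv, eps]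

/-- The partial sums of a sequence of bits increase, by less than `1 / 2 ^ n` from `n` on. -/
theorem partialSum_bounds {a : M.D ty1} (ha : ∀ i, M.app a i ≤ 1) {n m : M.N} (h : n ≤ m) :
    M.partialSum a n ≤ M.partialSum a m ∧
      M.partialSum a m + M.eps m ≤ M.partialSum a n + M.eps n := by
  -- In terms of numbers: `b n * 2 ^ m ≤ b m * 2 ^ n` and `(b m + 1) * 2 ^ n ≤ (b n + 1) * 2 ^ m`.
  have key : ∀ c d : M.N, ∀ k l : M.N, M.ι c * M.eps k ≤ M.ι d * M.eps l ↔
      c * M.pow2N l ≤ d * M.pow2N k := by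
    intro c d k l
    rw [← ι_le, map_mul, map_mul, eps, eps, ← div_eq_mul_inv, ← div_eq_mul_inv,
      div_le_div_iff₀ (ι_pow2N_pos _) (ι_pow2N_pos _)]
  have h1 : ∀ b n : M.N, M.ι b * M.eps n + M.eps n = M.ι (b + 1) * M.eps n := by
    intro b n; rw [map_add, map_one, add_mul, one_mul]
  rw [partialSum, partialSum, h1, h1, key, key]
  refine inductionN_from (P := fun m => M.binNumN a n * M.pow2N m ≤ M.binNumN a m * M.pow2N n ∧
    (M.binNumN a m + 1) * M.pow2N n ≤ (M.binNumN a n + 1) * M.pow2N m) (by fun_prop)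
    ⟨le_rfl, le_rfl⟩ (fun k _ hk => ?_) h
  rw [← key, ← key, ← h1, ← h1] at hk ⊢
  have := partialSum_add_one a k
  rw [partialSum, partialSum] at this
  rw [this, eps_add_one]
  have hb := ι_le.2 (ha (k + 1))
  rw [map_one] at hb
  have hb0 := ι_nonneg (M.app a (k + 1))
  have he := eps_pos (M := M) k
  constructor <;> nlinarith

theorem approxQ_binSum {Γ : Ctx} (e : Env M Γ) {a : Tm Γ ty1} (ha : ∀ i, M.app (a.eval e) i ≤ 1)
    (n : M.N) : M.approxQ ((binSum a).eval e) n = M.partialSum (a.eval e) n := by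
  rw [approxQ_eq, val_binSum]
  intro i j hij
  rw [val_binSum, val_binSum]
  obtain ⟨h1, h2⟩ := partialSum_bounds ha hij.le
  have := eps_pos (M := M) j
  rw [abs_lt]
  constructor <;> linarith

/-- `UBIN(Φ, x)` in the model, for `a = Φ(x)`: the bits of `a` sum up to `x`. -/
def Model.IsBinary (M : Model) [IsPRA M] (a x : M.D ty1) : Prop :=
  (∀ i, M.app a i ≤ 1) ∧ ∀ n, |M.approxQ x (n + 1) - M.partialSum a (n + 1)| ≤ M.eps n

theorem eval_UBINat {b : Bool} {Γ : Ctx} (e : Env M Γ) (Φ : Tm Γ (ty1 ⇒ ty1)) (x : Tm Γ ty1) :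
    (UBINat Φ x : Fm b Γ).eval e ↔ M.IsBinary (M.app (Φ.eval e) (x.eval e)) (x.eval e) := by
  simp only [UBINat, Fm.eval, eval_le, eval_one, eval_realEq, eval_app, eval_var_z, Tm.eval_wk,
    IsBinary, RealEq]
  refine and_congr_right fun h => forall_congr' fun n => ?_
  rw [approxQ_binSum e (a := Φ ⬝ x) h]
  rfl

end Reals

section Reversal
open Model
variable {M : Model} [IsPRA M]

/-! ### The binary expansion from a search functional -/

/-- A sequence with a zero exactly if the real `x` is below the rational `q`. -/
def ltTest {Γ : Ctx} (x : Tm Γ ty1) (q : Tm Γ ty0) : Tm Γ ty1 :=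
  lam (sub (succ (dens q.wk ((hat x).wk ⬝ succ v0)))
    (mul (excess q.wk ((hat x).wk ⬝ succ v0)) (pow2 v0)))

/-- The value of the term `ltTest`. -/
def Model.ltTestN (M : Model) (x : M.D ty1) (q : M.N) : M.D ty1 :=
  (ltTest v1 v0).eval (((Env.nil M).cons x).cons q)

@[simp] theorem app_ltTestN_eq_zero {x : M.D ty1} {q n : M.N} :
    M.app (M.ltTestN x q) n = 0 ↔ M.approxQ x (n + 1) + M.eps n < M.val q := by
  simp only [ltTestN, ltTest, app_lam, eval_sub, eval_succ, eval_dens, Tm.eval_wk, eval_var_z,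
    eval_app, eval_hat, eval_mul, eval_excess, eval_pow2, succN_eq, subN_eq_zero, add_one_leN,
    lt_excess_iff, eval_var_s]
  rfl

@[simp] theorem eval_ltTest {Γ : Ctx} (e : Env M Γ) (x : Tm Γ ty1) (q : Tm Γ ty0) :
    (ltTest x q).eval e = M.ltTestN (x.eval e) (q.eval e) :=
  IsPRA.ext _ _ fun n => by simp [ltTest, ltTestN]

/-- The bit that tells whether the real `x` is at least `q`, computed by `μ`. -/
def bit {Γ : Ctx} (μ : Tm Γ ty2) (x : Tm Γ ty1) (q : Tm Γ ty0) : Tm Γ ty0 :=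
  ifZero (ltTest x q ⬝ (μ ⬝ ltTest x q)) zero one

open Classical in
/-- The value of the term `bit`. -/
noncomputable def Model.bitN (M : Model) (μ : M.D ty2) (x : M.D ty1) (q : M.N) : M.N :=
  if M.app (M.ltTestN x q) (M.app μ (M.ltTestN x q)) = 0 then 0 else 1

@[simp] theorem eval_bit {Γ : Ctx} (e : Env M Γ) (μ : Tm Γ ty2) (x : Tm Γ ty1) (q : Tm Γ ty0) :
    (bit μ x q).eval e = M.bitN (μ.eval e) (x.eval e) (q.eval e) := by
  simp only [bit, bitN, eval_ifZero, eval_app, eval_ltTest, eval_zero, eval_one]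
  congr

@[fun_prop]
theorem Dfn.bitN {ρ : Ty} (μ : M.D ty2) (x : M.D ty1) {f : M.D ρ → M.N} (hf : Dfn f) :
    Dfn (fun a => M.bitN μ x (f a)) := by
  have := (((Dfn.const ((lam (lam (lam (bit v2 v1 v0)))).eval (Env.nil M))).app
    (Dfn.const μ)).app (Dfn.const x)).app hf
  simpa using this

/-- A code of the rational `c / 2 ^ n`. -/
def dyadic {Γ : Ctx} (c n : Tm Γ ty0) : Tm Γ ty0 := pair (add c c) (pred (pow2 n))

/-- The value of the term `dyadic`. -/
noncomputable def Model.dyadicN (M : Model) [IsPRA M] (c n : M.N) : M.N :=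
  M.pairN (c + c) (M.predN (M.pow2N n))

@[simp] theorem eval_dyadic {Γ : Ctx} (e : Env M Γ) (c n : Tm Γ ty0) :
    (dyadic c n).eval e = M.dyadicN (c.eval e) (n.eval e) := by simp [dyadic, dyadicN]

@[fun_prop]
theorem Dfn.dyadicN {ρ : Ty} {f g : M.D ρ → M.N} (hf : Dfn f) (hg : Dfn g) :
    Dfn (fun x => M.dyadicN (f x) (g x)) := Dfn.ofTm₂ (dyadic v1 v0) (by simp) hf hg

theorem val_dyadicN (c n : M.N) : M.val (M.dyadicN c n) = M.ι c * M.eps n := by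
  rw [dyadicN, val_pair, predN_pow2N_add_one, eps, div_eq_mul_inv]

/-- The number with the binary digits number `1` to `n` of `x`: the integer part of `2 ^ n * x`. -/
def digits {Γ : Ctx} (μ : Tm Γ ty2) (x : Tm Γ ty1) (n : Tm Γ ty0) : Tm Γ ty0 :=
  recTm n zero (add (add v1 v1) (bit μ.wk.wk x.wk.wk (dyadic (succ (add v1 v1)) (succ v0))))

/-- The value of the term `digits`. -/
noncomputable def Model.digitsN (M : Model) [IsPRA M] (μ : M.D ty2) (x : M.D ty1) (n : M.N) : M.N :=
  M.recN n 0 (fun v k => v + v + M.bitN μ x (M.dyadicN (v + v + 1) (k + 1)))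

@[simp] theorem eval_digits {Γ : Ctx} (e : Env M Γ) (μ : Tm Γ ty2) (x : Tm Γ ty1) (n : Tm Γ ty0) :
    (digits μ x n).eval e = M.digitsN (μ.eval e) (x.eval e) (n.eval e) := by
  simp [digits, digitsN, succN_eq]

theorem digitsN_zero (μ : M.D ty2) (x : M.D ty1) : M.digitsN μ x 0 = 0 :=
  recN_zero (((Env.nil M).cons μ).cons x)
    (add (add v1 v1) (bit (.var (.s (.s (.s .z)))) v2 (dyadic (succ (add v1 v1)) (succ v0))))
    (fun v k => by simp [succN_eq]) 0

theorem digitsN_add_one (μ : M.D ty2) (x : M.D ty1) (n : M.N) :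
    M.digitsN μ x (n + 1) = M.digitsN μ x n + M.digitsN μ x n +
      M.bitN μ x (M.dyadicN (M.digitsN μ x n + M.digitsN μ x n + 1) (n + 1)) :=
  recN_add_one (((Env.nil M).cons μ).cons x)
    (add (add v1 v1) (bit (.var (.s (.s (.s .z)))) v2 (dyadic (succ (add v1 v1)) (succ v0))))
    (fun v k => by simp [succN_eq]) n 0

@[fun_prop]
theorem Dfn.digitsN {ρ : Ty} (μ : M.D ty2) (x : M.D ty1) {f : M.D ρ → M.N} (hf : Dfn f) :
    Dfn (fun a => M.digitsN μ x (f a)) := by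
  have := (((Dfn.const ((lam (lam (lam (digits v2 v1 v0)))).eval (Env.nil M))).app
    (Dfn.const μ)).app (Dfn.const x)).app hf
  simpa using this

/-- The closed term that computes binary expansions from a search functional. -/
def expansionTm : Tm [] (ty2 ⇒ ty1 ⇒ ty1) := lam (lam (lam (parity (digits v2 v1 v0))))

/-- The value of `expansionTm`. -/
def Model.expansion (M : Model) (μ : M.D ty2) (x : M.D ty1) : M.D ty1 :=
  M.app (M.app (expansionTm.eval (Env.nil M)) μ) x

theorem app_expansion (μ : M.D ty2) (x : M.D ty1) (n : M.N) :
    M.app (M.expansion μ x) n = M.parityN (M.digitsN μ x n) := by simp [expansion, expansionTm]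

/-- The real `x` is below `q`. -/
def Model.BelowQ (M : Model) [IsPRA M] (x : M.D ty1) (q : M.Q) : Prop :=
  ∃ n, M.approxQ x (n + 1) + M.eps n < q

/-- The search functional `μ` decides whether `x` is below a given rational. -/
def Model.Searches (M : Model) (μ : M.D ty2) (x : M.D ty1) : Prop :=
  ∀ q, (∃ n, M.app (M.ltTestN x q) n = 0) →
    M.app (M.ltTestN x q) (M.app μ (M.ltTestN x q)) = 0

theorem bitN_eq_zero {μ : M.D ty2} {x : M.D ty1} (h : M.Searches μ x) {q : M.N} :
    M.bitN μ x q = 0 ↔ M.BelowQ x (M.val q) := by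
  unfold bitN
  split_ifs with h0
  · exact ⟨fun _ => ⟨_, app_ltTestN_eq_zero.1 h0⟩, fun _ => rfl⟩
  · refine ⟨fun h1 => absurd h1 one_ne_zero, ?_⟩
    rintro ⟨n, hn⟩
    exact (h0 (h q ⟨n, app_ltTestN_eq_zero.2 hn⟩)).elim

theorem bitN_eq_zero_or_one (μ : M.D ty2) (x : M.D ty1) (q : M.N) :
    M.bitN μ x q = 0 ∨ M.bitN μ x q = 1 := by
  unfold bitN; split_ifs <;> simp

theorem BelowQ.le {x : M.D ty1} {q : M.Q} (h : M.BelowQ x q) (k : M.N) :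
    M.approxQ x (k + 1) ≤ q + M.eps k := by
  obtain ⟨n, hn⟩ := h
  have hn0 := eps_pos (M := M) n
  have hk0 := eps_pos (M := M) k
  rcases le_total n k with h | h
  · have h' : n + 1 ≤ k + 1 := add_one_leN.2 (ltN_add_one.2 h)
    have := (abs_lt.1 (approxQ_cauchy x h')).1
    rw [eps_add_one] at this
    linarith
  · have h' : k + 1 ≤ n + 1 := add_one_leN.2 (ltN_add_one.2 h)
    have := (abs_lt.1 (approxQ_cauchy x h')).2
    rw [eps_add_one] at this
    linarith

/-- Equal reals are below the same rationals, since the strict inequality leaves room. -/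
theorem BelowQ.congr {x y : M.D ty1} (hxy : M.RealEq x y) {q : M.Q} (h : M.BelowQ x q) :
    M.BelowQ y q := by
  obtain ⟨n, hn⟩ := h
  refine ⟨n + 1 + 1, ?_⟩
  have h1 := (abs_le.1 (hxy (n + 1 + 1))).1
  have h2 : n + 1 ≤ n + 1 + 1 + 1 := ((lt_add_oneN _).trans (lt_add_oneN _)).le
  have h3 := (abs_lt.1 (approxQ_cauchy x h2)).1
  simp only [eps_add_one] at *
  linarith

theorem RealEq.symm {x y : M.D ty1} (h : M.RealEq x y) : M.RealEq y x :=
  fun n => abs_sub_comm (M.approxQ x (n + 1)) _ ▸ h n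

theorem parityN_add_bit (c : M.N) {i : M.N} (h : i = 0 ∨ i = 1) : M.parityN (c + c + i) = i := by
  rcases h with rfl | rfl
  · rw [add_zero, parityN_double]
  · exact parityN_double_add_one c

theorem binNumN_expansion (μ : M.D ty2) (x : M.D ty1) (n : M.N) :
    M.binNumN (M.expansion μ x) n = M.digitsN μ x n := by
  refine inductionN (P := fun n => M.binNumN (M.expansion μ x) n = M.digitsN μ x n) (by fun_prop)
    (by rw [binNumN_zero, digitsN_zero]) (fun n hn => ?_) n
  rw [binNumN_add_one, hn, app_expansion, digitsN_add_one,
    parityN_add_bit _ (bitN_eq_zero_or_one _ _ _)]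

/-- The expansion computed by a search functional is a binary expansion. -/
theorem isBinary_expansion {μ : M.D ty2} {x : M.D ty1} (h : M.Searches μ x) (hx : M.InUnit x) :
    M.IsBinary (M.expansion μ x) x := by
  have hbit : ∀ c n, M.bitN μ x (M.dyadicN c n) = 0 ↔ M.BelowQ x (M.ι c * M.eps n) :=
    fun c n => by rw [bitN_eq_zero h, val_dyadicN]
  -- With `c` the number of the first `n` digits, `x` is not below `c / 2 ^ n`, and it is below
  -- `(c + 1) / 2 ^ n` unless `c + 1 = 2 ^ n`.
  have inv : ∀ n, M.bitN μ x (M.dyadicN (M.digitsN μ x n) n) ≠ 0 ∧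
      (M.bitN μ x (M.dyadicN (M.digitsN μ x n + 1) n) = 0 ∨
        M.digitsN μ x n + 1 = M.pow2N n) := by
    refine inductionN (P := fun n => ¬ M.bitN μ x (M.dyadicN (M.digitsN μ x n) n) = 0 ∧
      (M.bitN μ x (M.dyadicN (M.digitsN μ x n + 1) n) = 0 ∨
        M.digitsN μ x n + 1 = M.pow2N n)) (by fun_prop) ?_ (fun n hn => ?_)
    · rw [digitsN_zero, hbit, map_zero, zero_mul, zero_add, pow2N_zero]
      refine ⟨?_, Or.inr rfl⟩
      rintro ⟨n, hn⟩
      linarith [(hx n).1]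
    · have hhalf : ∀ c : M.N, M.ι (c + c) * M.eps (n + 1) = M.ι c * M.eps n := by
        intro c; rw [eps_add_one, map_add]; ring
      rw [digitsN_add_one]
      generalize M.digitsN μ x n = c at *
      rcases bitN_eq_zero_or_one μ x (M.dyadicN (c + c + 1) (n + 1)) with h0 | h1
      · rw [h0, add_zero]
        refine ⟨?_, Or.inl h0⟩
        rw [hbit, hhalf, ← hbit]
        exact hn.1
      · rw [h1]
        refine ⟨by rw [h1]; exact one_ne_zero, ?_⟩
        have hc : c + c + 1 + 1 = (c + 1) + (c + 1) := by ring
        rw [hc, hbit, hhalf, ← hbit, pow2N_add_one]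
        exact hn.2.imp _root_.id fun h => by rw [h]
  have lower : ∀ n k, M.partialSum (M.expansion μ x) n ≤ M.approxQ x (k + 1) + M.eps k := by
    intro n k
    have := (inv n).1
    rw [Ne, hbit] at this
    rw [partialSum, binNumN_expansion]
    exact not_lt.1 fun hlt => this ⟨k, hlt⟩
  have upper : ∀ n k, M.approxQ x (k + 1) ≤
      M.partialSum (M.expansion μ x) n + M.eps n + M.eps k := by
    intro n k
    have hs : M.partialSum (M.expansion μ x) n + M.eps n = M.ι (M.digitsN μ x n + 1) * M.eps n := by
      rw [partialSum, binNumN_expansion, map_add, map_one]; ring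
    rw [hs]
    rcases (inv n).2 with hlt | hlt
    · exact BelowQ.le ((hbit _ _).1 hlt) k
    · rw [hlt, pow2N_mul_eps]
      exact (hx k).2
  refine ⟨fun i => ?_, fun n => ?_⟩
  · rw [app_expansion]
    rcases zero_or_succ i with hi | hi
    · rw [hi, digitsN_zero, parityN_zero]; exact zero_leN 1
    · rw [hi, digitsN_add_one, parityN_add_bit _ (bitN_eq_zero_or_one _ _ _)]
      rcases bitN_eq_zero_or_one μ x _ with h0 | h0 <;> rw [h0]
      exact zero_leN 1
  · rw [abs_le]
    refine ⟨by linarith [lower (n + 1) n], ?_⟩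
    by_contra! hn
    obtain ⟨m, hm⟩ := exists_eps_lt (sub_pos.2 hn)
    have hnk : n ≤ n + m := leN_iff_exists.2 ⟨m, rfl⟩
    have hmk : m ≤ n + m := leN_iff_exists.2 ⟨n, add_comm _ _⟩
    have h1 := upper (n + 1) (n + m)
    have h2 := (abs_lt.1 (approxQ_cauchy x (add_one_leN.2 (ltN_add_one.2 hnk)))).2
    have h3 := eps_anti hmk
    rw [eps_add_one] at h1 h2
    linarith

/-- Equal reals have equal computed expansions. -/
theorem expansion_congr {μ : M.D ty2} {x y : M.D ty1} (hx : M.Searches μ x) (hy : M.Searches μ y)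
    (hxy : M.RealEq x y) : M.expansion μ x = M.expansion μ y := by
  have hbit : ∀ q, M.bitN μ x q = M.bitN μ y q := by
    intro q
    have : M.bitN μ x q = 0 ↔ M.bitN μ y q = 0 := by
      rw [bitN_eq_zero hx, bitN_eq_zero hy]
      exact ⟨BelowQ.congr hxy, BelowQ.congr (RealEq.symm hxy)⟩
    rcases bitN_eq_zero_or_one μ x q with h | h <;>
      rcases bitN_eq_zero_or_one μ y q with h' | h' <;> simp_all
  have hdig : ∀ n, M.digitsN μ x n = M.digitsN μ y n :=
    inductionN (P := fun n => M.digitsN μ x n = M.digitsN μ y n) (by fun_prop)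
      (by rw [digitsN_zero, digitsN_zero])
      (fun n hn => by rw [digitsN_add_one, digitsN_add_one, hn, hbit])
  exact IsPRA.ext _ _ fun n => by rw [app_expansion, app_expansion, hdig]

/-! ### Bounded search -/

/-- The least zero of `f` below `n`, or `n` if there is none. -/
def leastZero {Γ : Ctx} (f : Tm Γ ty1) (n : Tm Γ ty0) : Tm Γ ty0 :=
  recTm n zero (ifZero (absDiff v1 v0) (ifZero (f.wk.wk ⬝ v0) v1 (succ v1)) v1)

open Classical in
/-- The value of the term `leastZero`. -/
noncomputable def Model.leastZeroN (M : Model) [IsPRA M] (f : M.D ty1) (n : M.N) : M.N :=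
  M.recN n 0 (fun v k => if v = k then if M.app f k = 0 then v else v + 1 else v)

@[simp] theorem eval_leastZero {Γ : Ctx} (e : Env M Γ) (f : Tm Γ ty1) (n : Tm Γ ty0) :
    (leastZero f n).eval e = M.leastZeroN (f.eval e) (n.eval e) := by
  simp only [leastZero, leastZeroN, eval_recTm, eval_ifZero, eval_absDiff_eq_zero, eval_app,
    Tm.eval_wk, eval_var_s, eval_var_z, eval_succ, succN_eq, eval_zero]

theorem leastZeroN_zero (f : M.D ty1) : M.leastZeroN f 0 = 0 :=
  recN_zero ((Env.nil M).cons f)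
    (ifZero (absDiff v1 v0) (ifZero (v2 ⬝ v0) v1 (succ v1)) v1)
    (fun v k => by
      simp only [eval_ifZero, eval_absDiff_eq_zero, eval_app, eval_var_s, eval_var_z, eval_succ,
        succN_eq]) 0

open Classical in
theorem leastZeroN_add_one (f : M.D ty1) (n : M.N) : M.leastZeroN f (n + 1) =
    if M.leastZeroN f n = n then if M.app f n = 0 then M.leastZeroN f n else M.leastZeroN f n + 1
      else M.leastZeroN f n :=
  recN_add_one ((Env.nil M).cons f)
    (ifZero (absDiff v1 v0) (ifZero (v2 ⬝ v0) v1 (succ v1)) v1)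
    (fun v k => by
      simp only [eval_ifZero, eval_absDiff_eq_zero, eval_app, eval_var_s, eval_var_z, eval_succ,
        succN_eq]) n 0

@[fun_prop]
theorem Dfn.leastZeroN {ρ : Ty} (f : M.D ty1) {g : M.D ρ → M.N} (hg : Dfn g) :
    Dfn (fun a => M.leastZeroN f (g a)) := by
  have := ((Dfn.const ((lam (lam (leastZero v1 v0))).eval (Env.nil M))).app (Dfn.const f)).app hg
  simpa using this

theorem leastZeroN_le (f : M.D ty1) (n : M.N) : M.leastZeroN f n ≤ n := by
  refine inductionN (P := fun n => M.leastZeroN f n ≤ n) (by fun_prop) (leastZeroN_zero f).le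
    (fun n hn => ?_) n
  rw [leastZeroN_add_one]
  split_ifs with h1 h2
  · exact hn.trans (lt_add_oneN n).le
  · rw [h1]
  · exact hn.trans (lt_add_oneN n).le

theorem app_leastZeroN {f : M.D ty1} {n : M.N} (h : M.leastZeroN f n < n) :
    M.app f (M.leastZeroN f n) = 0 := by
  refine inductionN (P := fun n => M.leastZeroN f n < n → M.app f (M.leastZeroN f n) = 0)
    (DfnP.imp (by fun_prop) (by fun_prop)) (fun h => absurd h (not_lt.2 (zero_leN _)))
    (fun n hn => ?_) n h
  rw [leastZeroN_add_one]
  split_ifs with h1 h2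
  · rw [h1]; exact fun _ => h2
  · rw [h1]; exact fun h => (lt_irrefl _ h).elim
  · exact fun _ => hn (lt_of_le_of_ne (leastZeroN_le f n) h1)

theorem leastZeroN_le_of_zero {f : M.D ty1} {k : M.N} (hk : M.app f k = 0) (n : M.N) :
    M.leastZeroN f n ≤ k := by
  refine inductionN (P := fun n => M.leastZeroN f n ≤ k) (by fun_prop)
    ((leastZeroN_zero f).le.trans (zero_leN k)) (fun n hn => ?_) n
  rw [leastZeroN_add_one]
  split_ifs with h1 h2
  · exact hn
  · refine add_one_leN.2 (lt_of_le_of_ne hn fun h => h2 ?_)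
    rw [← h1, h, hk]
  · exact hn

theorem leastZeroN_spec {f : M.D ty1} {k n : M.N} (hk : M.app f k = 0) (hkn : k < n) :
    M.app f (M.leastZeroN f n) = 0 := app_leastZeroN ((leastZeroN_le_of_zero hk n).trans_lt hkn)

/-- Once a zero is found, the value no longer changes. -/
theorem leastZeroN_stable {f : M.D ty1} {n m : M.N} (h : M.leastZeroN f n < n) (hnm : n ≤ m) :
    M.leastZeroN f m = M.leastZeroN f n := by
  have h0 := app_leastZeroN h
  have hm : M.leastZeroN f m ≤ M.leastZeroN f n := leastZeroN_le_of_zero h0 m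
  refine le_antisymm hm (leastZeroN_le_of_zero (app_leastZeroN ?_) n)
  exact hm.trans_lt (h.trans_le hnm)

/-! ### Reals around `1 / 2` -/

/-- The constant sequence of (a code of) `1 / 2`. -/
def halfReal {Γ : Ctx} : Tm Γ ty1 := lam (pair (succ one) one)

/-- A code of the real `1 / 2 ± 1 / 2 ^ (p + 2)` if `p` is the least zero of `f`, and of `1 / 2` if
`f` has no zero; the sign is `+` if `d = 0`, and `-` otherwise. Its approximation number `j` is that
of `halfReal` as long as no zero of `f` below `j` is found. -/
def perturb {Γ : Ctx} (d : Tm Γ ty0) (f : Tm Γ ty1) : Tm Γ ty1 :=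
  lam (ifZero (sub (succ (leastZero f.wk v0)) v0)
    (dyadic (ifZero d.wk (succ (pow2 (succ (leastZero f.wk v0))))
      (pred (pow2 (succ (leastZero f.wk v0))))) (succ (succ (leastZero f.wk v0))))
    (pair (succ one) one))

/-- The value of the term `halfReal`. -/
def Model.halfR (M : Model) : M.D ty1 := halfReal.eval (Env.nil M)

/-- The value of the term `perturb`. -/
def Model.perturbN (M : Model) (d : M.N) (f : M.D ty1) : M.D ty1 :=
  (perturb v1 v0).eval (((Env.nil M).cons d).cons f)

theorem app_halfR (n : M.N) : M.app M.halfR n = M.pairN (1 + 1) 1 := by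
  simp [halfR, halfReal, succN_eq]

@[simp] theorem eval_halfReal {Γ : Ctx} (e : Env M Γ) : (halfReal : Tm Γ ty1).eval e = M.halfR :=
  IsPRA.ext _ _ fun n => by rw [app_halfR]; simp [halfReal, succN_eq]

theorem app_perturbN (d : M.N) (f : M.D ty1) (j : M.N) : M.app (M.perturbN d f) j =
    if M.leastZeroN f j < j then
      M.dyadicN (if d = 0 then M.pow2N (M.leastZeroN f j + 1) + 1
        else M.predN (M.pow2N (M.leastZeroN f j + 1))) (M.leastZeroN f j + 1 + 1)
    else M.pairN (1 + 1) 1 := by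
  simp [perturbN, perturb, succN_eq, add_one_leN]

@[simp] theorem eval_perturb {Γ : Ctx} (e : Env M Γ) (d : Tm Γ ty0) (f : Tm Γ ty1) :
    (perturb d f).eval e = M.perturbN (d.eval e) (f.eval e) :=
  IsPRA.ext _ _ fun n => by rw [app_perturbN]; simp [perturb, succN_eq, add_one_leN]

theorem val_half : M.val (M.pairN (1 + 1) 1) = 1 / 2 := by
  rw [val_pair, map_add, map_one]; norm_num

theorem val_perturbN_of_lt {d : M.N} {f : M.D ty1} {j : M.N} (h : M.leastZeroN f j < j) :
    M.val (M.app (M.perturbN d f) j) =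
      1 / 2 + (if d = 0 then 1 else -1) * M.eps (M.leastZeroN f j + 1 + 1) := by
  rw [app_perturbN, if_pos h, val_dyadicN]
  generalize M.leastZeroN f j = p
  have h1 := pow2N_mul_eps (M := M) (p + 1)
  have h2 : M.ι (M.predN (M.pow2N (p + 1))) + 1 = M.ι (M.pow2N (p + 1)) := by
    rw [← map_one M.ι, ← map_add, predN_pow2N_add_one]
  rw [eps_add_one (p + 1)]
  split_ifs
  · rw [map_add, map_one]; linear_combination (1 / 2) * h1
  · linear_combination (1 / 2) * h1 + (1 / 2) * M.eps (p + 1) * h2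

theorem val_perturbN_of_eq {d : M.N} {f : M.D ty1} {j : M.N} (h : M.leastZeroN f j = j) :
    M.val (M.app (M.perturbN d f) j) = 1 / 2 := by
  rw [app_perturbN, if_neg (by rw [h]; exact lt_irrefl j), val_half]

theorem approxQ_perturbN (d : M.N) (f : M.D ty1) (n : M.N) :
    M.approxQ (M.perturbN d f) n = M.val (M.app (M.perturbN d f) n) := by
  refine approxQ_eq (fun i j hij => ?_) n
  rcases (leastZeroN_le f i).lt_or_eq with hi | hi
  · have hj := leastZeroN_stable hi hij.le
    rw [val_perturbN_of_lt hi, val_perturbN_of_lt (hj ▸ hi.trans hij), hj, sub_self, abs_zero]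
    exact eps_pos i
  · rw [val_perturbN_of_eq hi]
    rcases (leastZeroN_le f j).lt_or_eq with hj | hj
    · rw [val_perturbN_of_lt hj]
      have hle : i ≤ M.leastZeroN f j := by
        have := leastZeroN_le_of_zero (app_leastZeroN hj) i
        rwa [hi] at this
      have h1 : M.eps (M.leastZeroN f j + 1 + 1) < M.eps i := by
        have := eps_anti hle
        have := eps_pos (M := M) (M.leastZeroN f j)
        rw [eps_add_one, eps_add_one]
        linarith
      have h2 := eps_pos (M := M) (M.leastZeroN f j + 1 + 1)
      rw [abs_lt]
      split_ifs <;> constructor <;> linarith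
    · rw [val_perturbN_of_eq hj, sub_self, abs_zero]
      exact eps_pos i

theorem inUnit_halfR : M.InUnit M.halfR := by
  intro n
  have := eps_pos (M := M) n
  rw [approxQ_const (c := 1 / 2) (fun n => by rw [app_halfR, val_half])]
  constructor <;> linarith

theorem inUnit_perturbN (d : M.N) (f : M.D ty1) : M.InUnit (M.perturbN d f) := by
  intro n
  have hn := eps_pos (M := M) n
  rw [approxQ_perturbN]
  rcases (leastZeroN_le f (n + 1)).lt_or_eq with h | h
  · rw [val_perturbN_of_lt h]
    have h1 := eps_anti (M := M) (zero_leN (M.leastZeroN f (n + 1)))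
    have h2 := eps_pos (M := M) (M.leastZeroN f (n + 1))
    rw [eps_zero] at h1
    rw [eps_add_one, eps_add_one]
    split_ifs <;> constructor <;> linarith
  · rw [val_perturbN_of_eq h]
    constructor <;> linarith

/-- If `f` has a zero, then the first binary digit of `perturbN d f` is not `d`. -/
theorem not_isBinary_perturbN {d : M.N} {f a : M.D ty1} (ha : M.IsBinary a (M.perturbN d f))
    (had : M.app a 1 = d) {m : M.N} (hm : M.app f m = 0) : False := by
  -- Compare the approximation with the partial sum at a stage where the least zero `p` is found.
  have hp : M.leastZeroN f (m + 1) < m + 1 := ltN_add_one.2 (leastZeroN_le_of_zero hm _)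
  obtain ⟨h1, h2⟩ := ha
  set p := M.leastZeroN f (m + 1) with hpd
  set n := p + 1 + 1 + 1 + m with hn
  have hmn : m + 1 ≤ n + 1 :=
    add_one_leN.2 (ltN_add_one.2 (leN_iff_exists.2 ⟨p + 1 + 1 + 1, by rw [hn, add_comm]⟩))
  have hst := leastZeroN_stable hp hmn
  have h3 := h2 n
  rw [approxQ_perturbN, val_perturbN_of_lt (hst ▸ hp.trans_le hmn), hst, ← hpd, abs_le] at h3
  have hpn : p + 1 + 1 + 1 ≤ n := leN_iff_exists.2 ⟨m, rfl⟩
  have h4 := eps_anti hpn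
  have h5 : (1 : M.N) ≤ n + 1 := leN_iff_exists.2 ⟨n, add_comm _ _⟩
  obtain ⟨h6, h7⟩ := partialSum_bounds h1 h5
  have h8 : M.partialSum a 1 = M.ι d / 2 := by
    rw [← zero_add (1 : M.N), partialSum_add_one, partialSum, binNumN_zero, eps_add_one, eps_zero,
      zero_add, had, map_zero]
    ring
  have h9 : M.eps (1 : M.N) = 1 / 2 := by rw [← zero_add (1 : M.N), eps_add_one, eps_zero]
  have h10 := eps_pos (M := M) p
  have h11 := eps_pos (M := M) (n + 1)
  rw [h8] at h6 h7
  rw [h9] at h7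
  simp only [eps_add_one] at h3 h4 h7 h11
  by_cases hd : d = 0
  · rw [if_pos hd] at h3
    rw [hd, map_zero] at h7
    linarith [h3.2]
  · rw [if_neg hd] at h3
    have hd1 : (1 : M.Q) ≤ M.ι d := by
      rw [← map_one M.ι, ι_le, ← zero_add (1 : M.N)]
      exact add_one_leN.2 (posN_iff.2 hd)
    linarith [h3.1]

/-- The closed term that computes a search functional from binary expansions. -/
def searchTm : Tm [] ((ty1 ⇒ ty1) ⇒ (ty1 ⇒ ty1 ⇒ ty0 ⇒ ty0) ⇒ ty2) :=
  lam (lam (lam (leastZero v0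
    (v1 ⬝ halfReal ⬝ perturb (v2 ⬝ halfReal ⬝ one) v0 ⬝ succ one))))

/-- `searchTm` finds zeros: `Φ` separates `1 / 2` from its perturbation, hence the two sequences
differ below the value of the extensionality functional, and they only differ at numbers above a
zero of `f`. -/
theorem search_spec {Φ : M.D (ty1 ⇒ ty1)} {Ξ : M.D (ty1 ⇒ ty1 ⇒ ty0 ⇒ ty0)}
    (hΦ : ∀ x, M.InUnit x → M.IsBinary (M.app Φ x) x)
    (hΞ : ∀ f g k, (∀ i < M.app (M.app (M.app Ξ f) g) k, M.app f i = M.app g i) →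
      ∀ i < k, M.app (M.app Φ f) i = M.app (M.app Φ g) i) (f : M.D ty1)
    (hf : ∃ n, M.app f n = 0) :
    M.app f (M.app (M.app (M.app (searchTm.eval (Env.nil M)) Φ) Ξ) f) = 0 := by
  obtain ⟨m, hm⟩ := hf
  simp only [searchTm, app_lam, eval_leastZero, eval_app, eval_perturb, eval_halfReal, eval_one,
    eval_succ, eval_var_z, eval_var_s, succN_eq]
  set d := M.app (M.app Φ M.halfR) 1 with hd
  by_contra hn
  refine not_isBinary_perturbN (hΦ _ (inUnit_perturbN d f)) ?_ hm
  rw [hd]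
  refine (hΞ M.halfR (M.perturbN d f) (1 + 1) (fun i hi => ?_) 1 (lt_add_oneN 1)).symm
  rw [app_halfR, app_perturbN, if_neg]
  intro hlt
  exact hn (leastZeroN_spec (app_leastZeroN hlt) (hlt.trans hi))

end Reversal

section Transfer
open Model
variable {M : Model}

/-! ### Standard objects and transfer -/

/-- The axioms that make the standard objects of a model closed under definability: the values of
closed terms are standard, and standard functions map standard objects to standard objects. -/
structure Model.StClosed (M : Model) : Prop where
  closed {σ : Ty} (t : Tm [] σ) : M.st (t.eval (Env.nil M))
  app {σ τ : Ty} {f : M.D (σ ⇒ τ)} {x : M.D σ} : M.st f → M.st x → M.st (M.app f x)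

theorem Model.StClosed.nil (σ : Ty) (v : Var [] σ) : M.st (Env.nil M σ v) := nomatch v

theorem Model.StClosed.cons {Γ : Ctx} {e : Env M Γ} {ρ : Ty} {d : M.D ρ} (hd : M.st d)
    (he : ∀ σ v, M.st (e σ v)) (σ : Ty) (v : Var (ρ :: Γ) σ) : M.st (e.cons d σ v) := by
  cases v with
  | z => exact hd
  | s v => exact he _ v

theorem Model.StClosed.eval (h : M.StClosed) {Γ : Ctx} {e : Env M Γ} (he : ∀ σ v, M.st (e σ v))
    {σ : Ty} (t : Tm Γ σ) : M.st (t.eval e) := by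
  induction t with
  | var v => exact he _ v
  | const c => exact h.closed (.const c)
  | app t u iht ihu => exact h.app iht ihu

/-- `Π⁰₁-TRANS` in the model. -/
def Model.Transfer (M : Model) : Prop :=
  ∀ f : M.D ty1, M.st f → (∀ n, M.st n → M.app f n ≠ 0) → ∀ n, M.app f n ≠ 0

theorem eval_PiTRANS {Γ : Ctx} (e : Env M Γ) : (PiTRANS : Fm true Γ).eval e ↔ M.Transfer := by
  simp only [PiTRANS, Fm.allSt, Fm.neg, Fm.eval, eval_app, eval_var_z, eval_var_s, eval_zero,
    Transfer, Ne]

theorem eval_MU {b : Bool} {Γ : Ctx} (e : Env M Γ) (μ : Tm Γ ty2) :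
    (MU μ : Fm b Γ).eval e ↔
      ∀ f, (∃ n, M.app f n = 0) → M.app f (M.app (μ.eval e) f) = 0 := by
  simp only [MU, Fm.eval, eval_app, eval_var_z, eval_var_s, Tm.eval_wk, eval_zero]

variable [IsPRA M]

/-- `x ≈ y` in the model. -/
def Model.Approx (M : Model) [IsPRA M] (x y : M.D ty1) : Prop :=
  ∀ n : M.N, M.st n → 0 < n → |M.approxQ x n - M.approxQ y n| ≤ M.eps (M.predN n)

/-- If `f` is standard with zeros, but without standard zeros, then `perturbN d f` is infinitely
close to `1 / 2`. -/
theorem approx_perturbN (hM : M.StClosed) {d : M.N} {f : M.D ty1} (hf : M.st f)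
    (h : ∀ n, M.st n → M.app f n ≠ 0) : M.Approx M.halfR (M.perturbN d f) := by
  intro n hn _
  have hl : M.st (M.leastZeroN f n) := by
    have := hM.eval (StClosed.cons hn (StClosed.cons hf StClosed.nil)) (leastZero v1 v0)
    simpa using this
  have heq : M.leastZeroN f n = n :=
    (leastZeroN_le f n).eq_or_lt.resolve_right fun hlt => h _ hl (app_leastZeroN hlt)
  rw [approxQ_const (c := 1 / 2) (fun n => by rw [app_halfR, val_half]), approxQ_perturbN,
    val_perturbN_of_eq heq, sub_self, abs_zero]
  exact (eps_pos _).le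

/-- Binary expansions that do not separate infinitely close standard reals yield `Π⁰₁-TRANS`. -/
theorem transfer_of_binary (hM : M.StClosed) {Φ : M.D (ty1 ⇒ ty1)} (hΦ : M.st Φ)
    (hbin : ∀ x, M.st x → M.InUnit x → M.IsBinary (M.app Φ x) x)
    (hext : ∀ x y, M.st x → M.InUnit x → M.st y → M.InUnit y → M.Approx x y →
      ∀ n, M.st n → M.app (M.app Φ x) n = M.app (M.app Φ y) n) : M.Transfer := by
  intro f hf h m hm
  have h1 : M.st (1 : M.N) := hM.closed one
  have hx : M.st M.halfR := hM.closed halfReal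
  have hy : M.st (M.perturbN (M.app (M.app Φ M.halfR) 1) f) :=
    hM.eval (StClosed.cons hf (StClosed.cons (hM.app (hM.app hΦ hx) h1) StClosed.nil))
      (perturb v1 v0)
  exact not_isBinary_perturbN (hbin _ hy (inUnit_perturbN _ f))
    (hext _ _ hx inUnit_halfR hy (inUnit_perturbN _ f) (approx_perturbN hM hf h) 1 h1).symm hm

/-- With `Π⁰₁-TRANS`, infinitely close standard reals are equal. -/
theorem realEq_of_approx (hM : M.StClosed) (hT : M.Transfer) {x y : M.D ty1} (hx : M.st x)
    (hy : M.st y) (h : M.Approx x y) : M.RealEq x y := by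
  -- The function `t` vanishes exactly where the inequality of the real equality fails.
  set t : Tm [ty0, ty1, ty1] ty0 := sub (succ (dens (hat v2 ⬝ succ v0) (hat v1 ⬝ succ v0)))
    (mul (gap (hat v2 ⬝ succ v0) (hat v1 ⬝ succ v0)) (pow2 v0)) with ht
  set e := ((Env.nil M).cons x).cons y
  have key : ∀ n, M.app ((lam t).eval e) n ≠ 0 ↔
      |M.approxQ x (n + 1) - M.approxQ y (n + 1)| ≤ M.eps n := by
    intro n
    rw [app_lam, ht, ← not_lt, not_iff_not]
    simp only [e, eval_sub, eval_succ, eval_dens, eval_var_z, eval_var_s, eval_app, eval_hat,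
      eval_mul, eval_gap, eval_pow2, succN_eq, subN_eq_zero, add_one_leN]
    rw [← not_le, gap_le_iff, not_le]
    rfl
  have hst : M.st ((lam t).eval e) := hM.eval (StClosed.cons hy (StClosed.cons hx StClosed.nil)) _
  refine fun n => (key n).1 (hT _ hst (fun n hn => (key n).2 ?_) n)
  have hn1 : M.st (n + 1) := by
    have := hM.eval (StClosed.cons hn StClosed.nil) (succ v0)
    simpa [succN_eq] using this
  have := h (n + 1) hn1 (posN_iff.2 (add_one_ne_zeroN n))
  rwa [predN_add_one] at this

/-- With `Π⁰₁-TRANS`, a standard functional that finds zeros of standard functions also finds those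
of the tests with nonstandard rationals, because the test function is uniform in the rational. -/
theorem searches_of_transfer (hM : M.StClosed) (hT : M.Transfer) {μ : M.D ty2} (hμ : M.st μ)
    (h : ∀ f, M.st f → (∃ n, M.app f n = 0) → M.app f (M.app μ f) = 0) {x : M.D ty1}
    (hx : M.st x) : M.Searches μ x := by
  set t : Tm [ty0, ty1, ty2] ty0 := ifZero (ltTest v1 (fst v0) ⬝ snd v0)
    (ifZero (ltTest v1 (fst v0) ⬝ (v2 ⬝ ltTest v1 (fst v0))) one zero) one with ht
  set e := ((Env.nil M).cons μ).cons x
  have key : ∀ p, M.app ((lam t).eval e) p ≠ 0 ↔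
      (M.app (M.ltTestN x (M.fstN p)) (M.sndN p) = 0 →
        M.app (M.ltTestN x (M.fstN p)) (M.app μ (M.ltTestN x (M.fstN p))) = 0) := by
    intro p
    have h10 : (1 : M.N) ≠ 0 := by rw [← zero_add (1 : M.N)]; exact add_one_ne_zeroN 0
    rw [app_lam, ht]
    simp only [e, eval_ifZero, eval_app, eval_ltTest, eval_var_z, eval_var_s, eval_fst, eval_snd,
      eval_one, eval_zero]
    split_ifs <;> simp_all
  have he := StClosed.cons hx (StClosed.cons hμ StClosed.nil)
  have hst : M.st ((lam t).eval e) := hM.eval he _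
  rintro q ⟨n, hn⟩
  have := (key (M.pairN q n)).1 (hT _ hst (fun p hp => (key p).2 fun h0 => h _ ?_ ⟨_, h0⟩) _)
  · simp only [fstN_pair, sndN_pair] at this
    exact this hn
  · have := hM.eval (StClosed.cons hp he) (ltTest v1 (fst v0))
    simpa [e] using this

/-- The closed term that turns a functional `F` such that one of the entries of the finite sequence
`F(f)` is a zero of `f`, if there is any, into a functional that finds zeros. -/
def selectTm : Tm [] ((ty1 ⇒ .seq ty0) ⇒ ty2) :=
  lam (lam (.const (.proj ty0) ⬝ (v1 ⬝ v0) ⬝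
    leastZero (lam (v1 ⬝ (.const (.proj ty0) ⬝ (v2 ⬝ v1) ⬝ v0)))
      (.const (.len ty0) ⬝ (v1 ⬝ v0))))

theorem app_selectTm {F : M.D (ty1 ⇒ .seq ty0)} {f : M.D ty1} {i : M.N}
    (hi : i < M.app (M.con (.len ty0)) (M.app F f))
    (h : M.app f (M.app (M.app (M.con (.proj ty0)) (M.app F f)) i) = 0) :
    M.app f (M.app (M.app (selectTm.eval (Env.nil M)) F) f) = 0 := by
  simp only [selectTm, app_lam, eval_app, eval_leastZero, eval_var_z, eval_var_s]
  set e := ((Env.nil M).cons F).cons f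
  set g : M.D ty1 :=
    (lam (v1 ⬝ (.const (.proj ty0) ⬝ (v2 ⬝ v1) ⬝ v0) : Tm [ty0, ty1, _] ty0)).eval e
  have hg : ∀ j, M.app g j = M.app f (M.app (M.app (M.con (.proj ty0)) (M.app F f)) j) :=
    fun j => app_lam _ _ _
  have := leastZeroN_spec (f := g) (by rw [hg]; exact h) hi
  rwa [hg] at this

/-! ### The principles in a model -/

theorem eval_UBIN {b : Bool} {Γ : Ctx} (e : Env M Γ) (Φ : Tm Γ (ty1 ⇒ ty1)) :
    (UBIN Φ : Fm b Γ).eval e ↔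
      ∀ x, M.InUnit x → M.IsBinary (M.app (Φ.eval e) x) x := by
  simp only [UBIN, Fm.eval, eval_inUnit, eval_UBINat, eval_var_z, Tm.eval_wk]

theorem eval_realExt (hM : M.Extensional) {Γ : Ctx} (e : Env M Γ) (Φ : Tm Γ (ty1 ⇒ ty1)) :
    (realExt Φ : Fm false Γ).eval e ↔
      ∀ x y, M.RealEq x y → M.app (Φ.eval e) x = M.app (Φ.eval e) y := by
  simp only [realExt, Fm.eval, eval_realEq, hM _ _ _, eval_app, eval_var_z, eval_var_s, Tm.eval_wk]

theorem eval_initEq {b : Bool} {Γ : Ctx} (e : Env M Γ) (f g : Tm Γ ty1) (n : Tm Γ ty0) :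
    (initEq f g n : Fm b Γ).eval e ↔
      ∀ i < n.eval e, M.app (f.eval e) i = M.app (g.eval e) i := by
  simp only [initEq, Fm.eval, eval_lt, eval_app, eval_var_z, Tm.eval_wk]

theorem eval_ExtFunctional {b : Bool} {Γ : Ctx} (e : Env M Γ)
    (Ξ : Tm Γ (ty1 ⇒ ty1 ⇒ ty0 ⇒ ty0)) (Φ : Tm Γ (ty1 ⇒ ty1)) :
    (ExtFunctional Ξ Φ : Fm b Γ).eval e ↔
      ∀ f g k, (∀ i < M.app (M.app (M.app (Ξ.eval e) f) g) k, M.app f i = M.app g i) →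
        ∀ i < k, M.app (M.app (Φ.eval e) f) i = M.app (M.app (Φ.eval e) g) i := by
  simp only [ExtFunctional, Fm.eval, eval_initEq, eval_app, eval_var_z, eval_var_s, Tm.eval_wk]

theorem eval_UBINplus {Γ : Ctx} (e : Env M Γ) : (UBINplus : Fm true Γ).eval e ↔
    ∃ Φ : M.D (ty1 ⇒ ty1), M.st Φ ∧ ∀ z, M.st z → M.InUnit z → M.IsBinary (M.app Φ z) z ∧
      ∀ x, M.st x → M.InUnit x → ∀ y, M.st y → M.InUnit y → M.Approx x y →
        ∀ n, M.st n → M.app (M.app Φ x) n = M.app (M.app Φ y) n := by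
  simp only [UBINplus, Fm.allSt, Fm.exSt, approxOne, Fm.eval, eval_inUnit, eval_UBINat,
    eval_approx, eval_app, eval_var_z, eval_var_s, Tm.eval_wk, Approx]

/-- The instance of `HAC_int` for the search of zeros: from `Π⁰₁-TRANS` it yields a standard
functional that finds zeros of standard functions. -/
theorem exists_search (hM : M.StClosed) (hE : M.Extensional)
    (hax : ∀ {Γ : Ctx} {B : Fm true Γ} (e : Env M Γ), RCAΛ Γ B → B.eval e) (hT : M.Transfer) :
    ∃ μ : M.D ty2, M.st μ ∧
      ∀ f, M.st f → (∃ n, M.app f n = 0) → M.app f (M.app μ f) = 0 := by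
  let A : Fm false [ty0, ty1] := .ex ty0 (.eq (v2 ⬝ v0) zero) ⟹ .eq (v1 ⬝ v0) zero
  have hA : ∀ e : Env M [ty0, ty1], A.eval e ↔
      ((∃ n, M.app (e _ (.s .z)) n = 0) → M.app (e _ (.s .z)) (e _ .z) = 0) := fun e => Iff.rfl
  obtain ⟨F, hF, h⟩ := hax (Env.nil M) (RCAΛ.hac ty1 ty0 A) (fun f hf => by
    by_cases h0 : ∃ n, M.app f n = 0
    · by_contra hn
      obtain ⟨n, h0⟩ := h0
      refine hT f hf (fun k hk hk0 => hn ⟨k, hk, ?_⟩) n h0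
      exact (Fm.eval_ofInt A _).2 ((hA _).2 fun _ => hk0)
    · exact ⟨0, hM.closed zero, (Fm.eval_ofInt A _).2 ((hA _).2 fun hn => (h0 hn).elim)⟩)
  refine ⟨M.app (selectTm.eval (Env.nil M)) F, hM.app (hM.closed selectTm) hF, fun f hf h0 => ?_⟩
  obtain ⟨y, ⟨i, hi, hy⟩, hAy⟩ := h f hf
  have hy := (hE _ _ _).1 ((Fm.eval_eqT_bool true false _ _ _).1 hy)
  rw [Fm.eval_ofInt, Fm.rename, Fm.eval_subst, hA] at hAy
  refine app_selectTm (i := i) ?_ ?_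
  · exact (eval_lt _ _ _).1 hi
  · have hy : y = M.app (M.app (M.con (.proj ty0)) (M.app F f)) i := hy
    rw [← hy]
    exact hAy h0

end Transfer

/-! ### Provability -/

theorem provable_UBINplus_iff_PiTRANS : Provable RCAΛ (Fm.iff UBINplus PiTRANS) := by
  refine completeness RCAΛ.substClosed (fun h => .base (.base h)) (fun _ _ _ s t => .st_eq s t)
    fun M hE hax => ?_
  have := isPRA_of_EPRA hE fun e h => hax e (.base (.base h))
  have hM : M.StClosed := ⟨fun t => by
      have := hax (Env.nil M) (.st_closed t)
      rwa [Fm.eval, Tm.eval_closed] at this,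
    fun {_ _ f x} hf hx => hax (((Env.nil M).cons f).cons x) (.st_app v1 v0) hf hx⟩
  simp only [Fm.iff, Fm.eval, eval_UBINplus, eval_PiTRANS]
  constructor
  · rintro ⟨Φ, hΦ, h⟩
    -- The extensionality clause of `UBIN⁺` is stated below the quantifier over a real of `[0,1]`.
    exact transfer_of_binary hM hΦ (fun x hx hxu => (h x hx hxu).1) fun x y hx hxu hy hyu =>
      (h _ (hM.closed halfReal) inUnit_halfR).2 x hx hxu y hy hyu
  · intro hT
    obtain ⟨μ, hμ, h⟩ := exists_search hM hE hax hT
    have hs : ∀ x, M.st x → M.Searches μ x := fun x => searches_of_transfer hM hT hμ h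
    refine ⟨M.app (expansionTm.eval (Env.nil M)) μ, hM.app (hM.closed _) hμ, fun z hz hzu =>
      ⟨isBinary_expansion (hs z hz) hzu, fun x hx _ y hy _ hxy n _ => ?_⟩⟩
    exact congrArg (fun a => M.app a n)
      (expansion_congr (hs x hx) (hs y hy) (realEq_of_approx hM hT hx hy hxy))

theorem provable_expansion_and_search : Provable (RCAω false)
    (Fm.all ty2 (MU v0 ⟹ (realExt (expansionTm.closed ⬝ v0) ⋏ UBIN (expansionTm.closed ⬝ v0))) ⋏
      Fm.all (ty1 ⇒ ty1) (Fm.all (ty1 ⇒ ty1 ⇒ ty0 ⇒ ty0)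
        (UBIN v1 ⟹ ExtFunctional v0 v1 ⟹ MU (searchTm.closed ⬝ v1 ⬝ v0)))) := by
  refine completeness (RCAω.substClosed false) .base (fun h => nomatch h) fun M hE hax => ?_
  have := isPRA_of_EPRA hE fun e h => hax e (.base h)
  simp only [Fm.eval, eval_MU, eval_UBIN, eval_realExt hE, eval_ExtFunctional, eval_app,
    eval_var_z, eval_var_s, Tm.eval_closed]
  refine ⟨fun μ hμ => ?_, fun Φ Ξ hΦ hΞ f hf => search_spec hΦ hΞ f hf⟩
  have hs : ∀ x, M.Searches μ x := fun x q => hμ _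
  exact ⟨fun x y => expansion_congr (hs x) (hs y), fun x => isBinary_expansion (hs x)⟩

end HigherRM

theorem theorem3p2 :
    HigherRM.Provable HigherRM.RCAΛ (HigherRM.Fm.iff HigherRM.UBINplus HigherRM.PiTRANS) ∧
    ∃ (s : HigherRM.Tm [] (HigherRM.ty2 ⇒ HigherRM.ty1 ⇒ HigherRM.ty1))
      (t : HigherRM.Tm []
        ((HigherRM.ty1 ⇒ HigherRM.ty1) ⇒
          (HigherRM.ty1 ⇒ HigherRM.ty1 ⇒ HigherRM.ty0 ⇒ HigherRM.ty0) ⇒ HigherRM.ty2)),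
      HigherRM.Provable (HigherRM.RCAω false)
        (HigherRM.Fm.all HigherRM.ty2
            (HigherRM.MU HigherRM.v0 ⟹
              (HigherRM.realExt (s.closed ⬝ HigherRM.v0) ⋏
                HigherRM.UBIN (s.closed ⬝ HigherRM.v0))) ⋏
          HigherRM.Fm.all (HigherRM.ty1 ⇒ HigherRM.ty1)
            (HigherRM.Fm.all (HigherRM.ty1 ⇒ HigherRM.ty1 ⇒ HigherRM.ty0 ⇒ HigherRM.ty0)
              (HigherRM.UBIN HigherRM.v1 ⟹
                HigherRM.ExtFunctional HigherRM.v0 HigherRM.v1 ⟹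
                HigherRM.MU (t.closed ⬝ HigherRM.v1 ⬝ HigherRM.v0)))) :=
  ⟨HigherRM.provable_UBINplus_iff_PiTRANS, HigherRM.expansionTm, HigherRM.searchTm,
    HigherRM.provable_expansion_and_search⟩
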